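/- \textbf{Setting.} Let $T\ge 1$, let $S=\bigcup_{l=1}^{s}\{-(M_l+N_l),\dots,-M_l\}$ with integers $M_l\ge 1$, $N_l\ge 0$ (possibly $s=0$), $\mathbb Z_-=\{-1,-2,\dots\}$, $U=S\cup\{0,1,2,\dots\}$, $Z^S=\{j\ge 1:\ -j\notin S\}$. Let $a(j)\in\mathbb C^T$, $a(j)=0$ for $j\notin Z^S$, $\sum_j\sum_k|a_k(j)|<\infty$, and $A(e^{i\lambda})=\sum_{j\in Z^S}a(j)e^{-ij\lambda}$. A spectral density is an integrable function on $(-\pi,\pi]$ whose values are a.e. positive semidefinite Hermitian $T\times T$ matrices. A matrix function $W$ satisfies the minimality condition if $W(\lambda)^{-1}$ exists a.e. and is integrable. $L_2(W)$ is the space of $\mathbb C^T$-valued functions with $\int_{-\pi}^{\pi} h^\top W\overline h\,d\lambda<\infty$, and $L_2^s(W)$ is its closed subspace generated by $e^{in\lambda}\delta_k$, $n\in\mathbb Z_-\setminus S$, $k=1,\dots,T$. Put $$\Delta(h;F,G)=\frac1{2\pi}\int_{-\pi}^{\pi}(A-h)^\top F\,\overline{(A-h)}\,d\lambda+\frac1{2\pi}\int_{-\pi}^{\pi}h^\top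 G\,\overline h\,d\lambda,\qquad \Delta(F,G)=\min_{h\in L_2^s(F+G)}\Delta(h;F,G).$$ A minimizer is the spectral characteristic of the optimal estimate. For a set $D$ of pairs of spectral densities, $(F^0,G^0)\in D$ is least favorable in $D$ if $\Delta(F^0,G^0)=\max_{(F,G)\in D}\Delta(F,G)$; with $H_D=\bigcap_{(F,G)\in D}L_2^s(F+G)$, a function $h^0\in H_D$ is minimax-robust for $D$ if $\max_{D}\Delta(h^0;F,G)$ exists and equals $\min_{h\in H_D}\sup_{D}\Delta(h;F,G)$. For spectral densities $F,G$ such that $F+G$ is minimal let $$B(k,j)=\tfrac1{2\pi}\!\int(F+G)^{-1}e^{-i(k-j)\lambda}d\lambda,\quad R(k,j)=\tfrac1{2\pi}\!\int F(F+G)^{-1}e^{-i(k+j)\lambda}d\lambda,\quad Q(k,j)=\tfrac1{2\pi}\!\int F(F+G)^{-1}G\,e^{-i(k-j)\lambda}d\lambda,$$ $(\mathbf Ra)(k)^\top=\sum_j a(j)^\top R(k,j)$, $(\mathbf Bx)(k)^\top=\sum_{j\in U}x(j)^\top B(k,j)$ for $k\in U$, $\langle g,x\rangle=\sum_{k\in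 U} g(k)^\top\overline{x(k)}$, $\langle\mathbf Qa,a\rangle=\sum_{k,j}a(k)^\top Q(k,j)\overline{a(j)}$. The inverse of the (in general unbounded) positive operator $\mathbf B$ is understood through its closed quadratic form: $\mathbf B^{-1}g$ is the coordinatewise limit, and $\langle g,\mathbf B^{-1}g\rangle$ the limit of $\langle g,x_m\rangle$, along finitely supported sequences $x_m$ over $U$ that are Cauchy for $\langle\mathbf Bx,x\rangle$ and satisfy $(\mathbf Bx_m)(k)\to g(k)$ for all $k\in U$. Let $C(e^{i\lambda})=\sum_{k\in U}(\mathbf B^{-1}\mathbf Ra)(k)e^{ik\lambda}$ be the integrable function with these Fourier coefficients, and $$h(F,G)^\top=A^\top F(F+G)^{-1}-C^\top(F+G)^{-1}.\qquad(4)$$ Let $F$ be a known spectral density, $G_1$ and $G^0$ spectral densities, and let $F+G^0$ satisfy the minimality condition. With $C$ taken for $(F,G^0)$, let $r$ be either $r_F$, $r_F^\top=(A^\top F-C^\top)(F+G^0)^{-1}$, or its numerator, $r^\top=A^\top F-C^\top$, and write $r^*r^\top=(\overline{r_k}\,r_l)_{k,l=1}^T$. Consider the following classes of spectral densities $G$ (where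 $\delta,\delta_k,\delta_{ij}\ge0$, $B_2$ is a positive definite Hermitian matrix, $\langle X,Y\rangle=\operatorname{Tr}(XY^*)$ for matrices), each with its relations on $G^0$, where the first holds a.e. for some constants $\beta,\beta_k\in\mathbb R$, $\beta_{ij}\in\mathbb C$: $D^1_{2\delta}$: $\frac1{2\pi}\int|\operatorname{Tr}(G-G_1)|^2d\lambda\le\delta$; relations: $r^*r^\top=\beta^2\,\operatorname{Tr}(G^0-G_1)\,(F+G^0)^2$, and equality in the constraint for $G=G^0$. $D^2_{2\delta}$: $\frac1{2\pi}\int|g_{kk}-g^1_{kk}|^2d\lambda\le\delta_k$ for all $k$; relations: $r^*r^\top=(F+G^0)\{\beta_k^2(g^0_{kk}-g^1_{kk})\delta_{kl}\}_{k,l}(F+G^0)$, and equality in all constraints for $G=G^0$. $D^3_{2\delta}$: $\frac1{2\pi}\int|\langle B_2,G-G_1\rangle|^2d\lambda\le\delta$; relations: $r^*r^\top=\beta^2\langle B_2,G^0-G_1\rangle(F+G^0)^2$, and equality in the constraint for $G=G^0$. $D^4_{2\delta}$: $\frac1{2\pi}\int|g_{ij}-g^1_{ij}|^2d\lambda\le\delta_{ij}$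 for all $i,j$; relations: $r^*r^\top=(F+G^0)\{\beta_{ij}(g^0_{ij}-g^1_{ij})\}_{i,j}(F+G^0)$, and equality in all constraints for $G=G^0$. \textbf{Claim.} (a) For every spectral density $G$ and all uncorrelated centred stationary sequences $\xi,\eta$ with spectral densities $F,G$, every $h\in L_2^s(F+G)$ is the spectral characteristic of a linear estimate $\hat A\xi=\int h^\top d(Z_\xi+Z_\eta)$ of $A\xi=\sum_{j\in Z^S}a(j)^\top\xi(-j)$ from the observations $\xi(n)+\eta(n)$, $n\in\mathbb Z_-\setminus S$, and $E|A\xi-\hat A\xi|^2=\Delta(h;F,G)$. (b) For every spectral density $G$ with $F+G$ minimal, the objects $\mathbf B^{-1}\mathbf Ra$, $C$ and $\langle\mathbf Ra,\mathbf B^{-1}\mathbf Ra\rangle$ exist and are unique ($C$ up to null sets). (c) Let $k\in\{1,2,3,4\}$. If $G^0$ satisfies the relations of the class $D^k_{2\delta}$ and the pair $(F,G^0)$ is a solution of $$\langle\mathbf Ra,\mathbf B^{-1}\mathbf Ra\rangle+\langle\mathbf Qa,a\rangle\ \to\ \max$$ over the pairs $(F,G)$, $G\in D^k_{2\delta}$,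 for which $F+G$ satisfies the minimality condition, then $(F,G^0)$ is least favorable in $\{F\}\times D^k_{2\delta}$ (that is, $G^0$ is least favorable in $D^k_{2\delta}$), the function $h(F,G^0)$ given by (4) is the spectral characteristic of the optimal estimate for $(F,G^0)$, and it is minimax-robust for $\{F\}\times D^k_{2\delta}$. -/

import Mathlib

open MeasureTheory Filter Topology
open scoped ENNReal NNReal Matrix ComplexOrder

universe u

noncomputable section

namespace MinimaxFilter

/-! ### Densities on `(-π, π]` -/

/-- Lebesgue measure on one period. -/
def period : Measure ℝ := volume.restrict (Set.Ioc (-Real.pi) Real.pi)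

/-- Vectors with `T` complex coordinates. -/
abbrev Vec (T : ℕ) : Type := Fin T → ℂ

/-- Matrix valued functions of the frequency. -/
abbrev Dens (T : ℕ) : Type := ℝ → Matrix (Fin T) (Fin T) ℂ

variable {T : ℕ}

/-- A spectral density: an integrable function whose values are positive semidefinite
Hermitian matrices. -/
def IsSpectralDensity (F : Dens T) : Prop :=
  (∀ᵐ t ∂period, (F t).PosSemidef) ∧ ∀ k l, Integrable (fun t => F t k l) period

/-- The minimality condition `∫ W⁻¹ < ∞`: the inverse matrix exists almost everywhere and is
integrable. -/
def IsMinimal (W : Dens T) : Prop :=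
  (∀ᵐ t ∂period, IsUnit (W t).det) ∧ ∀ k l, Integrable (fun t => (W t)⁻¹ k l) period

/-- The character `e^{i n t}`. -/
def character (n : ℤ) (t : ℝ) : ℂ := Complex.exp (Complex.I * n * t)

/-- `n`-th Fourier coefficient `(1/2π) ∫ Φ(t) e^{-int} dt` of a matrix function. -/
def fourierMat (Φ : Dens T) (n : ℤ) : Matrix (Fin T) (Fin T) ℂ :=
  Matrix.of fun k l => (1 / (2 * Real.pi) : ℂ) * ∫ t, Φ t k l * character (-n) t ∂period

/-- The trigonometric polynomial `∑ p(n) e^{int}`. -/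
def trigPoly (p : ℤ →₀ Vec T) (t : ℝ) : Vec T := p.sum fun n v => character n t • v

/-- `(1/2π) ∫ h(t)ᵀ W(t) conj h(t) dt`. -/
def energy (W : Dens T) (h : ℝ → Vec T) : ℝ≥0∞ :=
  ENNReal.ofReal (1 / (2 * Real.pi)) *
    ∫⁻ t, ENNReal.ofReal (h t ⬝ᵥ (W t *ᵥ star (h t))).re ∂period

/-! ### Index sets -/

/-- `S = ⋃ₗ {-(Mₗ + Nₗ), …, -Mₗ}`, the points where the observation is missing. -/
def missing {s : ℕ} (M N : Fin s → ℕ) : Set ℤ :=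
  {n | ∃ l, -((M l : ℤ) + N l) ≤ n ∧ n ≤ -(M l : ℤ)}

/-- `ℤ₋ \ S`, the points of observation. -/
def observed (S : Set ℤ) : Set ℤ := {n | n < 0 ∧ n ∉ S}

/-- `Z^S = {1, 2, …} \ S⁺`, where `S⁺ = -S`. -/
def functionalIndex (S : Set ℤ) : Set ℤ := {j | 1 ≤ j ∧ -j ∉ S}

/-- `U = S ∪ {0, 1, 2, …}`. -/
def unknown (S : Set ℤ) : Set ℤ := S ∪ {n | 0 ≤ n}

/-! ### Spectral characteristics and mean square errors -/

/-- `A(e^{it}) = ∑ a(j) e^{-ijt}`; the coefficients `a(j)` vanish for `j ∉ Z^S`. -/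
def symbolA (a : ℤ → Vec T) (t : ℝ) : Vec T := ∑' j, character (-j) t • a j

/-- `L₂(W)`. -/
def MemL2 (W : Dens T) (h : ℝ → Vec T) : Prop :=
  AEStronglyMeasurable h period ∧ energy W h < ∞

/-- `L₂ˢ(W)`: the closed subspace of `L₂(W)` generated by `e^{int} δ_k`, `n ∈ ℤ₋ \ S`. -/
def MemL2s (S : Set ℤ) (W : Dens T) (h : ℝ → Vec T) : Prop :=
  MemL2 W h ∧ ∀ ε : ℝ≥0∞, 0 < ε →
    ∃ p : ℤ →₀ Vec T, (p.support : Set ℤ) ⊆ observed S ∧ energy W (h - trigPoly p) < ε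

/-- `Δ(h; F, G)`. -/
def meanSquareError (a : ℤ → Vec T) (h : ℝ → Vec T) (F G : Dens T) : ℝ≥0∞ :=
  energy F (symbolA a - h) + energy G h

/-- `h` is the spectral characteristic of the optimal linear estimate for `(F, G)`. -/
def IsOptimal (S : Set ℤ) (a : ℤ → Vec T) (F G : Dens T) (h : ℝ → Vec T) : Prop :=
  MemL2s S (F + G) h ∧
    ∀ h', MemL2s S (F + G) h' → meanSquareError a h F G ≤ meanSquareError a h' F G

/-- `Δ(F, G) = Δ(h(F, G); F, G)`, the mean square error of the optimal linear estimate. -/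
def optimalError (S : Set ℤ) (a : ℤ → Vec T) (F G : Dens T) : ℝ≥0∞ :=
  ⨅ (h : ℝ → Vec T) (_ : MemL2s S (F + G) h), meanSquareError a h F G

/-- `(F⁰, G⁰)` is least favorable in the class `D` of pairs of spectral densities. -/
def IsLeastFavorable (S : Set ℤ) (a : ℤ → Vec T) (D : Set (Dens T × Dens T))
    (F₀ G₀ : Dens T) : Prop :=
  (F₀, G₀) ∈ D ∧ ∀ p ∈ D, optimalError S a p.1 p.2 ≤ optimalError S a F₀ G₀

/-- `H_D = ⋂_{(F, G) ∈ D} L₂ˢ(F + G)`. -/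
def admissible (S : Set ℤ) (D : Set (Dens T × Dens T)) : Set (ℝ → Vec T) :=
  {h | ∀ p ∈ D, MemL2s S (p.1 + p.2) h}

/-- `h⁰` is a minimax-robust spectral characteristic for the class `D`: it lies in `H_D`, the
maximum of `Δ(h⁰; F, G)` over `D` is attained, and it equals `min_{h ∈ H_D} max_D Δ(h; F, G)`. -/
def IsMinimaxRobust (S : Set ℤ) (a : ℤ → Vec T) (D : Set (Dens T × Dens T))
    (h₀ : ℝ → Vec T) : Prop :=
  h₀ ∈ admissible S D ∧
  (∃ p ∈ D, ∀ q ∈ D, meanSquareError a h₀ q.1 q.2 ≤ meanSquareError a h₀ p.1 p.2) ∧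
  ∀ h ∈ admissible S D,
    (⨆ p ∈ D, meanSquareError a h₀ p.1 p.2) ≤ ⨆ p ∈ D, meanSquareError a h p.1 p.2

/-! ### The underlying stochastic sequences -/

/-- `ξ` and `η` are uncorrelated centred stationary sequences with spectral densities `F`
and `G`. -/
structure IsUncorrelatedPair {Ω : Type u} [MeasurableSpace Ω] (P : Measure Ω)
    (ξ η : ℤ → Ω → Vec T) (F G : Dens T) : Prop where
  memLp_signal : ∀ j k, MemLp (fun ω => ξ j ω k) 2 P
  memLp_noise : ∀ j k, MemLp (fun ω => η j ω k) 2 P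
  mean_signal : ∀ j k, ∫ ω, ξ j ω k ∂P = 0
  mean_noise : ∀ j k, ∫ ω, η j ω k ∂P = 0
  corr_signal : ∀ (j n : ℤ) k l, ∫ ω, ξ (j + n) ω k * star (ξ j ω l) ∂P =
    (1 / (2 * Real.pi) : ℂ) * ∫ t, character n t * F t k l ∂period
  corr_noise : ∀ (j n : ℤ) k l, ∫ ω, η (j + n) ω k * star (η j ω l) ∂P =
    (1 / (2 * Real.pi) : ℂ) * ∫ t, character n t * G t k l ∂period
  uncorrelated : ∀ (i j : ℤ) k l, ∫ ω, ξ i ω k * star (η j ω l) ∂P = 0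

/-- The functional `Aξ = ∑ a(j)ᵀ ξ(-j)`. -/
def functionalA {Ω : Type u} (a : ℤ → Vec T) (ξ : ℤ → Ω → Vec T) (ω : Ω) : ℂ :=
  ∑' j, a j ⬝ᵥ ξ (-j) ω

/-- The random variable `Y` is the linear estimate with spectral characteristic `h`, that is
`Y = ∫ hᵀ d(Z_ξ + Z_η)`: it is the mean square limit of finite combinations
`∑ p(n)ᵀ (ξ(n) + η(n))`, `n ∈ ℤ₋ \ S`, whose symbols `∑ p(n) e^{int}` converge to `h` in
`L₂(F + G)`. -/
def IsEstimate {Ω : Type u} [MeasurableSpace Ω] (P : Measure Ω) (S : Set ℤ)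
    (ξ η : ℤ → Ω → Vec T) (F G : Dens T) (h : ℝ → Vec T) (Y : Ω → ℂ) : Prop :=
  MemLp Y 2 P ∧ ∃ p : ℕ → ℤ →₀ Vec T,
    (∀ m, ((p m).support : Set ℤ) ⊆ observed S) ∧
    Tendsto (fun m => energy (F + G) (h - trigPoly (p m))) atTop (𝓝 0) ∧
    Tendsto (fun m => ∫⁻ ω, ‖Y ω - (p m).sum fun n v => v ⬝ᵥ (ξ n ω + η n ω)‖ₑ ^ 2 ∂P)
      atTop (𝓝 0)

/-- For all stationary sequences with spectral densities `F`, `G`, every `h ∈ L₂ˢ(F + G)` is the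
spectral characteristic of a linear estimate, whose mean square error is `Δ(h; F, G)`. -/
def ErrorFormula (S : Set ℤ) (a : ℤ → Vec T) (F G : Dens T) : Prop :=
  ∀ (Ω : Type u) [MeasurableSpace Ω] (P : Measure Ω) [IsProbabilityMeasure P]
    (ξ η : ℤ → Ω → Vec T), IsUncorrelatedPair P ξ η F G →
    ∀ h, MemL2s S (F + G) h →
      (∃ Y, IsEstimate P S ξ η F G h Y) ∧
      ∀ Y, IsEstimate P S ξ η F G h Y →
        ∫⁻ ω, ‖functionalA a ξ ω - Y ω‖ₑ ^ 2 ∂P = meanSquareError a h F G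

/-! ### The operators `B`, `R`, `Q` -/

/-- `B(k, j)`. -/
def coeffB (F G : Dens T) (k j : ℤ) : Matrix (Fin T) (Fin T) ℂ :=
  fourierMat (fun t => (F t + G t)⁻¹) (k - j)

/-- `R(k, j)`. -/
def coeffR (F G : Dens T) (k j : ℤ) : Matrix (Fin T) (Fin T) ℂ :=
  fourierMat (fun t => F t * (F t + G t)⁻¹) (k + j)

/-- `Q(k, j)`. -/
def coeffQ (F G : Dens T) (k j : ℤ) : Matrix (Fin T) (Fin T) ℂ :=
  fourierMat (fun t => F t * (F t + G t)⁻¹ * G t) (k - j)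

/-- `(R a)(k)ᵀ = ∑ⱼ a(j)ᵀ R(k, j)`. -/
def applyR (F G : Dens T) (a : ℤ → Vec T) (k : ℤ) : Vec T := ∑' j, a j ᵥ* coeffR F G k j

/-- `⟨Q a, a⟩ = ∑ a(k)ᵀ Q(k, j) conj a(j)`. -/
def formQ (F G : Dens T) (a : ℤ → Vec T) : ℂ :=
  ∑' kj : ℤ × ℤ, a kj.1 ⬝ᵥ (coeffQ F G kj.1 kj.2 *ᵥ star (a kj.2))

/-- `(B x)(k)ᵀ = ∑ⱼ x(j)ᵀ B(k, j)` for a finitely supported sequence `x`. -/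
def applyB (F G : Dens T) (x : ℤ →₀ Vec T) (k : ℤ) : Vec T :=
  x.sum fun j v => v ᵥ* coeffB F G k j

/-- `⟨g, x⟩ = ∑ₖ g(k)ᵀ conj x(k)`. -/
def pairing (g : ℤ → Vec T) (x : ℤ →₀ Vec T) : ℂ := x.sum fun k v => g k ⬝ᵥ star v

/-- Under the minimality condition `B` is a positive operator in `ℓ₂` over `U`, in general
unbounded and with an unbounded inverse, so `B⁻¹ g` is taken in the sense of the closed quadratic
form `⟨B x, x⟩`: the `x_m` are finitely supported sequences over `U` that are Cauchy with respect
to this form and such that `B x_m` tends to `g` in every coordinate of `U`. -/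
def IsInverseApprox (S : Set ℤ) (F G : Dens T) (g : ℤ → Vec T) (x : ℕ → ℤ →₀ Vec T) : Prop :=
  (∀ m, ((x m).support : Set ℤ) ⊆ unknown S) ∧
  (∀ ε : ℝ, 0 < ε → ∃ m₀, ∀ m ≥ m₀, ∀ n ≥ m₀,
    ‖pairing (applyB F G (x m - x n)) (x m - x n)‖ < ε) ∧
  ∀ k ∈ unknown S, Tendsto (fun m => applyB F G (x m) k) atTop (𝓝 (g k))

/-- `c = B⁻¹ g`. -/
def IsInverse (S : Set ℤ) (F G : Dens T) (g c : ℤ → Vec T) : Prop :=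
  ∃ x, IsInverseApprox S F G g x ∧ ∀ k, Tendsto (fun m => x m k) atTop (𝓝 (c k))

/-- `v = ⟨g, B⁻¹ g⟩`. -/
def IsInverseForm (S : Set ℤ) (F G : Dens T) (g : ℤ → Vec T) (v : ℝ) : Prop :=
  ∃ x, IsInverseApprox S F G g x ∧ Tendsto (fun m => pairing g (x m)) atTop (𝓝 (v : ℂ))

/-- `C` is (almost everywhere) the sum of the Fourier series `∑ₖ c(k) e^{ikt}`. -/
def IsFourierSum (c : ℤ → Vec T) (C : ℝ → Vec T) : Prop :=
  ∀ l, Integrable (fun t => C t l) period ∧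
    ∀ k : ℤ, (1 / (2 * Real.pi) : ℂ) * ∫ t, C t l * character (-k) t ∂period = c k l

/-- The sequence `B⁻¹ R a`. -/
def solutionC (S : Set ℤ) (a : ℤ → Vec T) (F G : Dens T) : ℤ → Vec T :=
  Classical.epsilon (IsInverse S F G (applyR F G a))

/-- The function `∑_{k ∈ U} (B⁻¹ R a)(k) e^{ikt}`. -/
def symbolC (S : Set ℤ) (a : ℤ → Vec T) (F G : Dens T) : ℝ → Vec T :=
  Classical.epsilon (IsFourierSum (solutionC S a F G))

/-- The number `⟨R a, B⁻¹ R a⟩`. -/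
def formInvB (S : Set ℤ) (a : ℤ → Vec T) (F G : Dens T) : ℝ :=
  Classical.epsilon (IsInverseForm S F G (applyR F G a))

/-- `B⁻¹ R a`, `∑ (B⁻¹ R a)(k) e^{ikt}` and `⟨R a, B⁻¹ R a⟩` exist and are uniquely determined. -/
def IsWellDefined (S : Set ℤ) (a : ℤ → Vec T) (F G : Dens T) : Prop :=
  (∃! c, IsInverse S F G (applyR F G a) c) ∧
  (∃ C, IsFourierSum (solutionC S a F G) C) ∧
  (∀ C C', IsFourierSum (solutionC S a F G) C → IsFourierSum (solutionC S a F G) C' →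
    C =ᵐ[period] C') ∧
  ∃! v, IsInverseForm S F G (applyR F G a) v

/-- `A(e^{it})ᵀ F(t) - (∑ (B⁻¹ R a)(k) e^{ikt})ᵀ`. -/
def numeratorF (S : Set ℤ) (a : ℤ → Vec T) (F G : Dens T) (t : ℝ) : Vec T :=
  symbolA a t ᵥ* F t - symbolC S a F G t

/-- `r_F(t)ᵀ = (A(e^{it})ᵀ F(t) - (∑ (B⁻¹ R a)(k) e^{ikt})ᵀ) (F(t) + G(t))⁻¹`. -/
def rF (S : Set ℤ) (a : ℤ → Vec T) (F G : Dens T) (t : ℝ) : Vec T :=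
  numeratorF S a F G t ᵥ* (F t + G t)⁻¹

/-- `h(F, G)ᵀ = Aᵀ F (F + G)⁻¹ - (∑ (B⁻¹ R a)(k) e^{ikt})ᵀ (F + G)⁻¹`. -/
def characteristic (S : Set ℤ) (a : ℤ → Vec T) (F G : Dens T) (t : ℝ) : Vec T :=
  symbolA a t ᵥ* (F t * (F t + G t)⁻¹) - symbolC S a F G t ᵥ* (F t + G t)⁻¹

/-- `⟨R a, B⁻¹ R a⟩ + ⟨Q a, a⟩`. -/
def objective (S : Set ℤ) (a : ℤ → Vec T) (F G : Dens T) : ℝ :=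
  formInvB S a F G + (formQ F G a).re

/-- `(F⁰, G⁰)` solves the problem of maximizing `⟨R a, B⁻¹ R a⟩ + ⟨Q a, a⟩` over the pairs of `D`
for which the operators are defined, that is, which satisfy the minimality condition. -/
def IsExtremal (S : Set ℤ) (a : ℤ → Vec T) (D : Set (Dens T × Dens T)) (F₀ G₀ : Dens T) : Prop :=
  IsMaxOn (fun p : Dens T × Dens T => objective S a p.1 p.2)
    {p | p ∈ D ∧ IsMinimal (p.1 + p.2)} (F₀, G₀) ∧
  (F₀, G₀) ∈ D ∧ IsMinimal (F₀ + G₀)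

/-! ### The classes `D_{2δ}` and the relations that determine least favorable densities -/

/-- `(1/2π) ∫ |f(t)|² dt`. -/
def meanSq (f : ℝ → ℂ) : ℝ≥0∞ :=
  ENNReal.ofReal (1 / (2 * Real.pi)) * ∫⁻ t, ‖f t‖ₑ ^ 2 ∂period

/-- The inner product `⟨X, Y⟩ = Tr (X Y*)` of matrices. -/
def matInner (X Y : Matrix (Fin T) (Fin T) ℂ) : ℂ := (X * Yᴴ).trace

def class1 (G₁ : Dens T) (δ : ℝ≥0) : Set (Dens T) :=
  {G | IsSpectralDensity G ∧ meanSq (fun t => (G t - G₁ t).trace) ≤ δ}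

def class2 (G₁ : Dens T) (δ : Fin T → ℝ≥0) : Set (Dens T) :=
  {G | IsSpectralDensity G ∧ ∀ k, meanSq (fun t => G t k k - G₁ t k k) ≤ δ k}

def class3 (G₁ : Dens T) (B₂ : Matrix (Fin T) (Fin T) ℂ) (δ : ℝ≥0) : Set (Dens T) :=
  {G | IsSpectralDensity G ∧ meanSq (fun t => matInner B₂ (G t - G₁ t)) ≤ δ}

def class4 (G₁ : Dens T) (δ : Fin T → Fin T → ℝ≥0) : Set (Dens T) :=
  {G | IsSpectralDensity G ∧ ∀ i j, meanSq (fun t => G t i j - G₁ t i j) ≤ δ i j}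

/-- `r* rᵀ = β² Tr(G⁰ - G₁) (F + G⁰)²`, and the constraint is active. -/
def Relations1 (F G₁ G₀ : Dens T) (δ : ℝ≥0) (r : ℝ → Vec T) : Prop :=
  (∃ β : ℝ, ∀ᵐ t ∂period, Matrix.vecMulVec (star (r t)) (r t) =
    ((β : ℂ) ^ 2 * (G₀ t - G₁ t).trace) • (F t + G₀ t) ^ 2) ∧
  meanSq (fun t => (G₀ t - G₁ t).trace) = δ

/-- `r* rᵀ = (F + G⁰) {β_k² (g⁰_kk - g¹_kk) δ_kl} (F + G⁰)`, and the constraints are active. -/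
def Relations2 (F G₁ G₀ : Dens T) (δ : Fin T → ℝ≥0) (r : ℝ → Vec T) : Prop :=
  (∃ β : Fin T → ℝ, ∀ᵐ t ∂period, Matrix.vecMulVec (star (r t)) (r t) =
    (F t + G₀ t) * Matrix.diagonal (fun k => (β k : ℂ) ^ 2 * (G₀ t k k - G₁ t k k)) *
      (F t + G₀ t)) ∧
  ∀ k, meanSq (fun t => G₀ t k k - G₁ t k k) = δ k

/-- `r* rᵀ = β² ⟨B₂, G⁰ - G₁⟩ (F + G⁰)²`, and the constraint is active. -/
def Relations3 (F G₁ G₀ : Dens T) (B₂ : Matrix (Fin T) (Fin T) ℂ) (δ : ℝ≥0)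
    (r : ℝ → Vec T) : Prop :=
  (∃ β : ℝ, ∀ᵐ t ∂period, Matrix.vecMulVec (star (r t)) (r t) =
    ((β : ℂ) ^ 2 * matInner B₂ (G₀ t - G₁ t)) • (F t + G₀ t) ^ 2) ∧
  meanSq (fun t => matInner B₂ (G₀ t - G₁ t)) = δ

/-- `r* rᵀ = (F + G⁰) {β_ij (g⁰_ij - g¹_ij)} (F + G⁰)`, and the constraints are active. -/
def Relations4 (F G₁ G₀ : Dens T) (δ : Fin T → Fin T → ℝ≥0) (r : ℝ → Vec T) : Prop :=
  (∃ β : Matrix (Fin T) (Fin T) ℂ, ∀ᵐ t ∂period, Matrix.vecMulVec (star (r t)) (r t) =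
    (F t + G₀ t) * Matrix.of (fun i j => β i j * (G₀ t i j - G₁ t i j)) * (F t + G₀ t)) ∧
  ∀ i j, meanSq (fun t => G₀ t i j - G₁ t i j) = δ i j

/-- For a known `F` and the class `D_G` of noise densities: `G⁰` is least favorable, and
`h(F, G⁰)` is the spectral characteristic of the optimal estimate for `(F, G⁰)` and is
minimax-robust for the class `{F} × D_G`. -/
def IsRobustSolution (S : Set ℤ) (a : ℤ → Vec T) (F : Dens T) (DG : Set (Dens T))
    (G₀ : Dens T) : Prop :=
  IsLeastFavorable S a ({F} ×ˢ DG) F G₀ ∧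
  IsOptimal S a F G₀ (characteristic S a F G₀) ∧
  IsMinimaxRobust S a ({F} ×ˢ DG) (characteristic S a F G₀)

end MinimaxFilter

end

/-! Write W = F + G, and let w be the Wiener filter, wᵀ = Aᵀ F W⁻¹. Completing the square pointwise
gives Δ(h; F, G) = ‖h - w‖² + ⟨Qa, a⟩ in L₂(W) (`form_completed_square`, `meanSquareError_eq`), so
the optimal h is the projection of w on L₂ˢ(W). If W is minimal, the orthogonal complement of L₂ˢ(W)
is the closed span of the functions xᵀ W⁻¹ with x a polynomial over U (`orthogonal_unkSpace`). For
these generators B is the Gram operator and Ra lists the inner products with w. Hence B⁻¹Ra encodes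
the projection Pw on that span: Cᵀ = (Pw)ᵀ W, formula (4) is w - Pw, and the objective is the
minimal error (`meanSquareError_characteristic`). The error formula itself is the isometry between
random variables and L₂, combined with the orthogonality of ξ and η (`errorFormula`).

The hard point is that no nonzero h in L₂(W) is orthogonal to both spans. Orthogonality says that h
has no Fourier coefficients on U and that hᵀ W has none at the observed points. Parseval would give
∫ hᵀ W h̄ = 0, but both factors are only integrable. Removing finitely many coefficients reduces
this to products of analytic L₁ functions whose sum is integrable. They are multiplied by a bounded
analytic function exp(-s l), with Re l the square root of the sum of their moduli, which makes them
bounded, and then s → 0 (`integral_sum_mul_eq_zero`).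

For part (c) the classes are convex, and extremality compares G⁰ only with G for which F + G is
minimal. A mixture of G and G⁰ with positive weight on G⁰ is always minimal, and letting that weight
tend to zero gives least favorability. For robustness, let x_n be optimal for (1 - c_n) G⁰ + c_n G
with c_n → 0. Extremality bounds the errors Δ(x_n; F, G) by the value at G⁰. These errors increase
with n, and their increments dominate the squared distances in L₂ of (F + G⁰) + (F + G). So x_n
converges there, necessarily to h(F, G⁰), which therefore lies in L₂ˢ(F + G) and satisfies the
saddle point inequality (`IsExtremal.characteristic_mem`). -/

noncomputable section

namespace MinimaxFilter

variable {T : ℕ}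

/-! ### Measurable square roots of densities -/

section Root
open scoped MatrixOrder Matrix.Norms.L2Operator

/-- The positive square root of a density. -/
def root (W : Dens T) : Dens T := fun t => CFC.sqrt (W t)

lemma root_isHermitian (W : Dens T) (t : ℝ) : (root W t)ᴴ = root W t :=
  (Matrix.nonneg_iff_posSemidef.1 (CFC.sqrt_nonneg (W t))).isHermitian

lemma root_mul_root {W : Dens T} {t : ℝ} (h : (W t).PosSemidef) :
    root W t * root W t = W t :=
  CFC.sqrt_mul_sqrt_self (W t) h.nonneg

lemma continuousOn_matrixSqrt :
    ContinuousOn (fun A : Matrix (Fin T) (Fin T) ℂ => CFC.sqrt A) {A | 0 ≤ A} := by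
  have h : (fun A : Matrix (Fin T) (Fin T) ℂ => CFC.sqrt A) = fun A => cfc NNReal.sqrt A := by
    funext A
    exact CFC.sqrt_eq_cfc
  rw [h]
  exact ContinuousOn.cfc_nnreal_of_mem_nhdsSet (s := Set.univ) NNReal.sqrt Filter.univ_mem
    continuousOn_id (fun x hx => hx) NNReal.continuous_sqrt.continuousOn

lemma isClosed_nonneg_matrix : IsClosed {A : Matrix (Fin T) (Fin T) ℂ | 0 ≤ A} :=
  isClosed_le continuous_const continuous_id

/-- The matrix square root is continuous on the closed cone of nonnegative matrices. Extended by
zero outside the cone it is a Borel function, and W takes values in the cone almost everywhere. -/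
lemma aestronglyMeasurable_root {W : Dens T} (hp : ∀ᵐ t ∂period, (W t).PosSemidef)
    (hm : ∀ k l, AEStronglyMeasurable (fun t => W t k l) period) (k l : Fin T) :
    AEStronglyMeasurable (fun t => root W t k l) period := by
  classical
  have hW : AEMeasurable (fun t => (fun k l => W t k l : Fin T → Fin T → ℂ)) period :=
    aemeasurable_pi_iff.2 fun k => aemeasurable_pi_iff.2 fun l => (hm k l).aemeasurable
  have hcl : IsClosed {A : Fin T → Fin T → ℂ | 0 ≤ Matrix.of A} := isClosed_nonneg_matrix
  have hc : ContinuousOn (fun A : Fin T → Fin T → ℂ => CFC.sqrt (Matrix.of A) k l)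
      {A | 0 ≤ Matrix.of A} :=
    (continuous_apply_apply k l).comp_continuousOn continuousOn_matrixSqrt
  have hg := hc.measurable_piecewise (g := fun _ => 0) continuousOn_const hcl.measurableSet
  refine ((hg.comp_aemeasurable hW).congr ?_).aestronglyMeasurable
  filter_upwards [hp] with t ht
  have h0 : (0 : Matrix (Fin T) (Fin T) ℂ) ≤ Matrix.of fun k l => W t k l := ht.nonneg
  simp only [Function.comp, Set.piecewise, Set.mem_ofPred_eq, h0, if_true]
  rfl

lemma isUnit_det_root {W : Dens T} {t : ℝ} (h : (W t).PosSemidef) (hu : IsUnit (W t).det) :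
    IsUnit (root W t).det := by
  rw [← root_mul_root h, Matrix.det_mul] at hu
  exact isUnit_of_mul_isUnit_left hu

end Root


/-! ### The isometry of `L₂(W)` into the space of square integrable vector functions -/

lemma IsSpectralDensity.add {F G : Dens T} (hF : IsSpectralDensity F)
    (hG : IsSpectralDensity G) : IsSpectralDensity (F + G) := by
  refine ⟨?_, fun k l => (hF.2 k l).add (hG.2 k l)⟩
  filter_upwards [hF.1, hG.1] with t h1 h2
  exact h1.add h2

lemma IsSpectralDensity.smul {F : Dens T} (hF : IsSpectralDensity F) {c : ℝ} (hc : 0 ≤ c) :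
    IsSpectralDensity ((c : ℂ) • F) := by
  refine ⟨?_, fun k l => (hF.2 k l).const_mul (c : ℂ)⟩
  filter_upwards [hF.1] with t h1
  exact h1.smul (by exact_mod_cast hc)

instance : IsFiniteMeasure period := by unfold period; infer_instance

/-- `hᵀ W^{1/2}`, as a function with values in a Euclidean space. -/
def wmap (W : Dens T) (h : ℝ → Vec T) (t : ℝ) : EuclideanSpace ℂ (Fin T) :=
  WithLp.toLp 2 (h t ᵥ* root W t)

lemma wmap_add (W : Dens T) (h k : ℝ → Vec T) : wmap W (h + k) = wmap W h + wmap W k := by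
  funext t; simp [wmap, Matrix.add_vecMul]

lemma wmap_sub (W : Dens T) (h k : ℝ → Vec T) : wmap W (h - k) = wmap W h - wmap W k := by
  funext t; simp [wmap, Matrix.sub_vecMul]

lemma wmap_smul (W : Dens T) (c : ℂ) (h : ℝ → Vec T) : wmap W (c • h) = c • wmap W h := by
  funext t; simp [wmap, Matrix.smul_vecMul]

/-- The order of `h` and `k` is reversed because `inner` is conjugate linear in its first argument,
while the form is conjugate linear in its second. -/
lemma inner_wmap {W : Dens T} {t : ℝ} (hW : (W t).PosSemidef) (h k : ℝ → Vec T) :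
    inner ℂ (wmap W k t) (wmap W h t) = h t ⬝ᵥ (W t *ᵥ star (k t)) := by
  simp only [wmap, EuclideanSpace.inner_toLp_toLp]
  rw [Matrix.star_vecMul, root_isHermitian, ← Matrix.dotProduct_mulVec, Matrix.mulVec_mulVec,
    root_mul_root hW]

lemma normSq_wmap {W : Dens T} {t : ℝ} (hW : (W t).PosSemidef) (h : ℝ → Vec T) :
    ‖wmap W h t‖ ^ 2 = (h t ⬝ᵥ (W t *ᵥ star (h t))).re := by
  rw [← inner_wmap hW, ← inner_self_eq_norm_sq (𝕜 := ℂ)]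
  rfl

lemma enormSq_wmap {W : Dens T} {t : ℝ} (hW : (W t).PosSemidef) (h : ℝ → Vec T) :
    ENNReal.ofReal (h t ⬝ᵥ (W t *ᵥ star (h t))).re = ‖wmap W h t‖ₑ ^ 2 := by
  rw [← normSq_wmap hW, ENNReal.ofReal_pow (norm_nonneg _), ofReal_norm]

lemma aestronglyMeasurable_apply {h : ℝ → Vec T} (hh : AEStronglyMeasurable h period)
    (k : Fin T) : AEStronglyMeasurable (fun t => h t k) period :=
  (continuous_apply k).comp_aestronglyMeasurable hh

lemma aestronglyMeasurable_of_apply {h : ℝ → Vec T}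
    (hh : ∀ k, AEStronglyMeasurable (fun t => h t k) period) : AEStronglyMeasurable h period :=
  (aemeasurable_pi_iff.2 fun k => (hh k).aemeasurable).aestronglyMeasurable

lemma aestronglyMeasurable_vecMul {h : ℝ → Vec T} {W : Dens T}
    (hh : AEStronglyMeasurable h period)
    (hm : ∀ k l, AEStronglyMeasurable (fun t => W t k l) period) :
    AEStronglyMeasurable (fun t => h t ᵥ* W t) period := by
  refine aestronglyMeasurable_of_apply fun l => ?_
  simp only [Matrix.vecMul, dotProduct]
  exact Finset.aestronglyMeasurable_fun_sum _
    fun k _ => (aestronglyMeasurable_apply hh k).mul (hm k l)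

lemma IsSpectralDensity.aestronglyMeasurable {W : Dens T} (hW : IsSpectralDensity W)
    (k l : Fin T) : AEStronglyMeasurable (fun t => W t k l) period :=
  (hW.2 k l).aestronglyMeasurable

lemma aestronglyMeasurable_wmap {W : Dens T} (hW : IsSpectralDensity W) {h : ℝ → Vec T}
    (hh : AEStronglyMeasurable h period) : AEStronglyMeasurable (wmap W h) period :=
  (PiLp.continuous_toLp 2 _).comp_aestronglyMeasurable
    (aestronglyMeasurable_vecMul hh (aestronglyMeasurable_root hW.1 hW.aestronglyMeasurable))

lemma energy_eq_lintegral {W : Dens T} (hW : IsSpectralDensity W) (h : ℝ → Vec T) :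
    energy W h = ENNReal.ofReal (1 / (2 * Real.pi)) * ∫⁻ t, ‖wmap W h t‖ₑ ^ 2 ∂period := by
  unfold energy
  congr 1
  refine lintegral_congr_ae ?_
  filter_upwards [hW.1] with t ht
  exact enormSq_wmap ht h

lemma eLpNorm_two_sq {α E : Type*} [MeasurableSpace α] [NormedAddCommGroup E] (μ : Measure α)
    (f : α → E) : eLpNorm f 2 μ ^ 2 = ∫⁻ t, ‖f t‖ₑ ^ 2 ∂μ := by
  rw [eLpNorm_eq_lintegral_rpow_enorm_toReal (by norm_num) (by norm_num), ← ENNReal.rpow_natCast,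
    ← ENNReal.rpow_mul]
  simp

lemma energy_eq {W : Dens T} (hW : IsSpectralDensity W) (h : ℝ → Vec T) :
    energy W h = ENNReal.ofReal (1 / (2 * Real.pi)) * eLpNorm (wmap W h) 2 period ^ 2 := by
  rw [energy_eq_lintegral hW, eLpNorm_two_sq]

lemma ofReal_inv_two_pi_ne_zero : ENNReal.ofReal (1 / (2 * Real.pi)) ≠ 0 := by
  have : (0 : ℝ) < 1 / (2 * Real.pi) := by positivity
  simpa using this

lemma energy_lt_top_iff {W : Dens T} (hW : IsSpectralDensity W) (h : ℝ → Vec T) :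
    energy W h < ∞ ↔ eLpNorm (wmap W h) 2 period < ∞ := by
  rw [energy_eq hW, ENNReal.mul_lt_top_iff]
  simp only [ENNReal.ofReal_lt_top, true_and, ofReal_inv_two_pi_ne_zero, false_or,
    ENNReal.pow_lt_top_iff, pow_eq_zero_iff two_ne_zero, OfNat.ofNat_ne_zero, or_false]
  exact ⟨fun h => h.elim id fun h => h ▸ ENNReal.zero_lt_top, Or.inl⟩

lemma memL2_iff {W : Dens T} (hW : IsSpectralDensity W) {h : ℝ → Vec T}
    (hh : AEStronglyMeasurable h period) : MemL2 W h ↔ MemLp (wmap W h) 2 period := by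
  rw [MemL2, energy_lt_top_iff hW]
  exact ⟨fun h1 => ⟨aestronglyMeasurable_wmap hW hh, h1.2⟩, fun h1 => ⟨hh, h1.2⟩⟩

lemma MemL2.memLp {W : Dens T} (hW : IsSpectralDensity W) {h : ℝ → Vec T} (hh : MemL2 W h) :
    MemLp (wmap W h) 2 period :=
  (memL2_iff hW hh.1).1 hh

lemma MemL2.add {W : Dens T} (hW : IsSpectralDensity W) {h k : ℝ → Vec T} (hh : MemL2 W h)
    (hk : MemL2 W k) : MemL2 W (h + k) := by
  rw [memL2_iff hW (hh.1.add hk.1), wmap_add]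
  exact (hh.memLp hW).add (hk.memLp hW)

lemma MemL2.sub {W : Dens T} (hW : IsSpectralDensity W) {h k : ℝ → Vec T} (hh : MemL2 W h)
    (hk : MemL2 W k) : MemL2 W (h - k) := by
  rw [memL2_iff hW (hh.1.sub hk.1), wmap_sub]
  exact (hh.memLp hW).sub (hk.memLp hW)

lemma energy_congr (W : Dens T) {h k : ℝ → Vec T} (hhk : h =ᵐ[period] k) :
    energy W h = energy W k := by
  unfold energy
  congr 1
  refine lintegral_congr_ae ?_
  filter_upwards [hhk] with t ht
  rw [ht]

lemma aemeasurable_form {W : Dens T} (hW : IsSpectralDensity W) {h : ℝ → Vec T}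
    (hh : AEStronglyMeasurable h period) :
    AEMeasurable (fun t => ENNReal.ofReal (h t ⬝ᵥ (W t *ᵥ star (h t))).re) period := by
  refine ((aestronglyMeasurable_wmap hW hh).enorm.pow_const 2).congr ?_
  filter_upwards [hW.1] with t ht
  exact (enormSq_wmap ht h).symm

lemma form_re_nonneg {A : Matrix (Fin T) (Fin T) ℂ} (hA : A.PosSemidef) (v : Vec T) :
    0 ≤ (v ⬝ᵥ (A *ᵥ star v)).re := by
  have := hA.dotProduct_mulVec_nonneg (star v)
  rw [star_star, Complex.le_def] at this
  exact this.1

lemma energy_add_density {F G : Dens T} (hF : IsSpectralDensity F) (hG : IsSpectralDensity G)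
    {h : ℝ → Vec T} (hh : AEStronglyMeasurable h period) :
    energy (F + G) h = energy F h + energy G h := by
  unfold energy
  rw [← mul_add, ← lintegral_add_left' (aemeasurable_form hF hh)]
  congr 1
  refine lintegral_congr_ae ?_
  filter_upwards [hF.1, hG.1] with t h1 h2
  rw [← ENNReal.ofReal_add (form_re_nonneg h1 _) (form_re_nonneg h2 _)]
  simp [Matrix.add_mulVec]

lemma energy_smul_density (W : Dens T) {c : ℝ} (hc : 0 ≤ c) (h : ℝ → Vec T) :
    energy ((c : ℂ) • W) h = ENNReal.ofReal c * energy W h := by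
  unfold energy
  rw [mul_left_comm, ← lintegral_const_mul' (ENNReal.ofReal c) _ ENNReal.ofReal_ne_top]
  congr 1
  refine lintegral_congr fun t => ?_
  rw [← ENNReal.ofReal_mul hc]
  simp [Matrix.smul_mulVec]

/-! ### Minkowski's inequality and continuity of the energy -/

lemma eLpNorm_tendsto_of_sub {α E : Type*} [MeasurableSpace α] [NormedAddCommGroup E]
    {μ : Measure α} {f : ℕ → α → E} {g : α → E} (hf : ∀ n, AEStronglyMeasurable (f n) μ)
    (hg : AEStronglyMeasurable g μ)
    (h : Tendsto (fun n => eLpNorm (g - f n) 2 μ) atTop (𝓝 0)) :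
    Tendsto (fun n => eLpNorm (f n) 2 μ) atTop (𝓝 (eLpNorm g 2 μ)) := by
  have h1 : ∀ n, eLpNorm (f n) 2 μ ≤ eLpNorm g 2 μ + eLpNorm (g - f n) 2 μ := fun n => by
    have := eLpNorm_sub_le hg (hg.sub (hf n)) (p := 2) (by norm_num)
    simpa using this
  have h2 : ∀ n, eLpNorm g 2 μ - eLpNorm (g - f n) 2 μ ≤ eLpNorm (f n) 2 μ := fun n => by
    rw [tsub_le_iff_right]
    have := eLpNorm_add_le (hf n) (hg.sub (hf n)) (p := 2) (by norm_num)
    simpa using this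
  refine tendsto_of_tendsto_of_tendsto_of_le_of_le ?_ ?_ h2 h1
  · simpa using ENNReal.Tendsto.sub tendsto_const_nhds h (Or.inr (by norm_num))
  · simpa using tendsto_const_nhds.add h

lemma tendsto_energy_zero_iff {W : Dens T} (hW : IsSpectralDensity W) {ι : Type*}
    {l : Filter ι} (h : ι → ℝ → Vec T) :
    Tendsto (fun n => energy W (h n)) l (𝓝 0) ↔
      Tendsto (fun n => eLpNorm (wmap W (h n)) 2 period) l (𝓝 0) := by
  simp only [energy_eq hW]
  constructor
  · intro H
    have H2 := ENNReal.Tendsto.const_mul (a := (ENNReal.ofReal (1 / (2 * Real.pi)))⁻¹) H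
      (Or.inr (by simp [Real.pi_pos]))
    have H3 : Tendsto (fun n => eLpNorm (wmap W (h n)) 2 period ^ 2) l (𝓝 0) := by
      refine (H2.congr fun n => ?_).trans (by simp)
      rw [← mul_assoc, ENNReal.inv_mul_cancel ofReal_inv_two_pi_ne_zero ENNReal.ofReal_ne_top,
        one_mul]
    have H4 := H3.ennrpow_const (1 / 2 : ℝ)
    simp only [← ENNReal.rpow_natCast, ← ENNReal.rpow_mul] at H4
    simpa using H4
  · intro H
    have := ENNReal.Tendsto.const_mul (a := ENNReal.ofReal (1 / (2 * Real.pi)))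
      (ENNReal.Tendsto.pow (n := 2) H) (Or.inr ENNReal.ofReal_ne_top)
    simpa using this

lemma tendsto_energy_of_sub {W : Dens T} (hW : IsSpectralDensity W) {f : ℕ → ℝ → Vec T}
    {g : ℝ → Vec T} (hf : ∀ n, AEStronglyMeasurable (f n) period)
    (hg : AEStronglyMeasurable g period)
    (h : Tendsto (fun n => energy W (g - f n)) atTop (𝓝 0)) :
    Tendsto (fun n => energy W (f n)) atTop (𝓝 (energy W g)) := by
  rw [tendsto_energy_zero_iff hW] at h
  simp only [wmap_sub] at h
  have := eLpNorm_tendsto_of_sub (fun n => aestronglyMeasurable_wmap hW (hf n))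
    (aestronglyMeasurable_wmap hW hg) h
  simp only [energy_eq hW]
  exact ENNReal.Tendsto.const_mul (ENNReal.Tendsto.pow this) (Or.inr ENNReal.ofReal_ne_top)

lemma energy_add_le {W : Dens T} (hW : IsSpectralDensity W) {h k : ℝ → Vec T}
    (hh : AEStronglyMeasurable h period) (hk : AEStronglyMeasurable k period) :
    energy W (h + k) ≤ 2 * (energy W h + energy W k) := by
  simp only [energy_eq hW, wmap_add]
  rw [← mul_add, mul_left_comm]
  gcongr ENNReal.ofReal (1 / (2 * Real.pi)) * ?_
  have h1 := eLpNorm_add_le (aestronglyMeasurable_wmap hW hh) (aestronglyMeasurable_wmap hW hk)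
    (p := 2) (by norm_num)
  calc eLpNorm (wmap W h + wmap W k) 2 period ^ 2
      ≤ (eLpNorm (wmap W h) 2 period + eLpNorm (wmap W k) 2 period) ^ 2 := by gcongr
    _ ≤ _ := by
      have := ENNReal.rpow_add_le_mul_rpow_add_rpow (eLpNorm (wmap W h) 2 period)
        (eLpNorm (wmap W k) 2 period) (p := 2) (by norm_num)
      norm_num at this
      exact this

/-! ### Functions on the circle whose Fourier coefficients vanish on a half-line -/

section Circle
open AddCircle Polynomial

variable {τ : ℝ}

lemma fourier_one_pow (n : ℕ) : (fourier 1 : C(AddCircle τ, ℂ)) ^ n = fourier n := by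
  induction n with
  | zero => ext x; simp
  | succ n ih =>
    rw [pow_succ, ih]
    ext x
    push_cast
    rw [Pi.mul_apply, ← fourier_add]

variable [hτ : Fact (0 < τ)]

lemma integrable_continuousMap (f : C(AddCircle τ, ℂ)) : Integrable f haarAddCircle :=
  f.continuous.integrable_of_hasCompactSupport (HasCompactSupport.of_compactSpace _)

lemma integral_fourier (n : ℤ) :
    ∫ x, fourier n x ∂(haarAddCircle : Measure (AddCircle τ)) = if n = 0 then 1 else 0 := by
  have h := congrFun (fourierCoeff_fourier (T := τ) n) 0
  rw [fourierCoeff] at h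
  simp only [neg_zero, fourier_zero, one_smul] at h
  rw [h]
  by_cases hn : n = 0
  · subst hn; simp
  · simp [hn, eq_comm]

/-- The mean is multiplicative on analytic polynomials, which is what makes the mean of a square
computable below. -/
lemma integral_aeval_fourier (q : ℂ[X]) :
    ∫ x, aeval (fourier 1 : C(AddCircle τ, ℂ)) q x ∂haarAddCircle = q.coeff 0 := by
  induction q using Polynomial.induction_on' with
  | add p q hp hq =>
    simp only [map_add, ContinuousMap.add_apply, coeff_add]
    rw [integral_add (integrable_continuousMap _) (integrable_continuousMap _), hp, hq]
  | monomial n c =>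
    have h : ∀ x, aeval (fourier 1 : C(AddCircle τ, ℂ)) (monomial n c) x = c * fourier n x := by
      intro x
      rw [aeval_monomial, fourier_one_pow]
      rfl
    simp only [h]
    rw [integral_const_mul, integral_fourier, coeff_monomial]
    by_cases hn : n = 0 <;> simp [hn]

/-- Every trigonometric polynomial has the same real part as an analytic one. -/
lemma exists_analytic_re_eq {p : C(AddCircle τ, ℂ)}
    (hp : p ∈ Submodule.span ℂ (Set.range (@fourier τ))) :
    ∃ q : ℂ[X], (q.coeff 0).im = 0 ∧
      ∀ x, (aeval (fourier 1 : C(AddCircle τ, ℂ)) q x).re = (p x).re := by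
  have key : ∃ q : ℂ[X], ∀ x, (aeval (fourier 1 : C(AddCircle τ, ℂ)) q x).re = (p x).re := by
    induction hp using Submodule.closure_induction with
    | zero => exact ⟨0, fun x => by simp⟩
    | add p p' _ _ h h' =>
      obtain ⟨q, hq⟩ := h
      obtain ⟨q', hq'⟩ := h'
      exact ⟨q + q', fun x => by
        rw [map_add, ContinuousMap.add_apply, Complex.add_re, hq, hq']; rfl⟩
    | smul_mem c p hp =>
      obtain ⟨n, rfl⟩ := hp
      obtain ⟨m, rfl | rfl⟩ := n.eq_nat_or_neg
      · refine ⟨monomial m c, fun x => ?_⟩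
        rw [aeval_monomial, fourier_one_pow]
        rfl
      -- A negative frequency is replaced by its complex conjugate, which has the same real part.
      · refine ⟨monomial m (star c), fun x => ?_⟩
        rw [aeval_monomial, fourier_one_pow, ContinuousMap.smul_apply, fourier_neg,
          ContinuousMap.mul_apply]
        have : (algebraMap ℂ C(AddCircle τ, ℂ)) (star c) x = star c := rfl
        rw [this, smul_eq_mul]
        simp
  obtain ⟨q, hq⟩ := key
  -- An imaginary constant does not affect real parts, so the mean can be made real.
  refine ⟨q - C (Complex.I * (q.coeff 0).im), by simp, fun x => ?_⟩
  rw [← hq, map_sub, aeval_C, ContinuousMap.sub_apply]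
  have : (algebraMap ℂ C(AddCircle τ, ℂ)) (Complex.I * (q.coeff 0).im) x =
    Complex.I * (q.coeff 0).im := rfl
  rw [this]
  simp

/-- The L₂ bound for the conjugate function. Pointwise |f|² = 2 (Re f)² - Re f², and the mean of f²
is the square of the real number q(0), hence nonnegative. -/
lemma integral_normSq_analytic_le {q : ℂ[X]} (hq : (q.coeff 0).im = 0) :
    ∫ x, ‖aeval (fourier 1 : C(AddCircle τ, ℂ)) q x‖ ^ 2 ∂haarAddCircle ≤
      2 * ∫ x, (aeval (fourier 1 : C(AddCircle τ, ℂ)) q x).re ^ 2 ∂haarAddCircle := by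
  set f := aeval (fourier 1 : C(AddCircle τ, ℂ)) q with hf
  have h1 : ∫ x, (f * f) x ∂haarAddCircle = (q.coeff 0) ^ 2 := by
    rw [hf, ← map_mul, integral_aeval_fourier, mul_coeff_zero, sq]
  have h2 : 0 ≤ ∫ x, ((f * f) x).re ∂haarAddCircle := by
    have := integral_re (integrable_continuousMap (f * f))
    simp only [RCLike.re_to_complex] at this
    rw [this, h1]
    simp only [sq, Complex.mul_re, hq]
    nlinarith [mul_self_nonneg (q.coeff 0).re]
  have hc : ∀ g : AddCircle τ → ℝ, Continuous g → Integrable g haarAddCircle := fun g hg =>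
    hg.integrable_of_hasCompactSupport (HasCompactSupport.of_compactSpace _)
  have h3 : ∀ x, ‖f x‖ ^ 2 = 2 * (f x).re ^ 2 - ((f * f) x).re := by
    intro x
    rw [← Complex.normSq_eq_norm_sq, Complex.normSq_apply, ContinuousMap.mul_apply,
      Complex.mul_re]
    ring
  simp only [h3]
  rw [integral_sub (hc _ (by fun_prop)) (hc _ (by fun_prop)), integral_const_mul]
  linarith

lemma eLpNorm_analytic_le {q : ℂ[X]} (hq : (q.coeff 0).im = 0) :
    eLpNorm (aeval (fourier 1 : C(AddCircle τ, ℂ)) q) 2 haarAddCircle ≤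
      2 * eLpNorm (fun x => (aeval (fourier 1 : C(AddCircle τ, ℂ)) q x).re) 2 haarAddCircle := by
  set f := aeval (fourier 1 : C(AddCircle τ, ℂ)) q with hf
  have hint : ∀ g : AddCircle τ → ℝ, Continuous g → Integrable g haarAddCircle := fun g hg =>
    hg.integrable_of_hasCompactSupport (HasCompactSupport.of_compactSpace _)
  have e1 : eLpNorm f 2 haarAddCircle ^ 2 =
      ENNReal.ofReal (∫ x, ‖f x‖ ^ 2 ∂haarAddCircle) := by
    rw [eLpNorm_two_sq, ofReal_integral_eq_lintegral_ofReal (hint _ (by fun_prop))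
      (ae_of_all _ fun x => by positivity)]
    refine lintegral_congr fun x => ?_
    rw [ENNReal.ofReal_pow (norm_nonneg _), ofReal_norm]
  have e2 : eLpNorm (fun x => (f x).re) 2 haarAddCircle ^ 2 =
      ENNReal.ofReal (∫ x, (f x).re ^ 2 ∂haarAddCircle) := by
    rw [eLpNorm_two_sq, ofReal_integral_eq_lintegral_ofReal (hint _ (by fun_prop))
      (ae_of_all _ fun x => by positivity)]
    refine lintegral_congr fun x => ?_
    rw [← sq_abs, ENNReal.ofReal_pow (abs_nonneg _), Real.enorm_eq_ofReal_abs]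
  have h := ENNReal.ofReal_le_ofReal (integral_normSq_analytic_le (τ := τ) hq)
  rw [← hf, ENNReal.ofReal_mul (by norm_num), ← e1, ← e2] at h
  refine (ENNReal.pow_le_pow_left_iff two_ne_zero).1 (h.trans ?_)
  rw [mul_pow]
  gcongr
  norm_num

/-- A nonnegative square integrable function is approximated by nonnegative real parts of
analytic polynomials. -/
lemma exists_analytic_approx {w : AddCircle τ → ℝ} (hw : MemLp w 2 haarAddCircle)
    (hw0 : ∀ x, 0 ≤ w x) {ε : ℝ} (hε : 0 < ε) :
    ∃ q : ℂ[X], (q.coeff 0).im = 0 ∧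
      (∀ x, 0 ≤ (aeval (fourier 1 : C(AddCircle τ, ℂ)) q x).re) ∧
      eLpNorm (fun x => w x - (aeval (fourier 1 : C(AddCircle τ, ℂ)) q x).re) 2 haarAddCircle ≤
        ENNReal.ofReal (3 * ε) := by
  obtain ⟨g, hg, hgm⟩ := hw.exists_boundedContinuous_eLpNorm_sub_le (by norm_num)
    (ε := ENNReal.ofReal ε) (by simpa using hε)
  let g' : C(AddCircle τ, ℂ) := ⟨fun x => ((max (g x) 0 : ℝ) : ℂ), by fun_prop⟩
  have hg' : g' ∈ closure (Submodule.span ℂ (Set.range (@fourier τ)) : Set C(AddCircle τ, ℂ)) := by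
    rw [← Submodule.topologicalClosure_coe, span_fourier_closure_eq_top]; trivial
  obtain ⟨p, hp, hpd⟩ := Metric.mem_closure_iff.1 hg' ε hε
  -- The shift by ε absorbs the uniform error and keeps the real part nonnegative. Altogether three
  -- errors of size ε occur: the density of continuous functions, the trigonometric approximation
  -- and this shift.
  have hp' : p + (ε : ℂ) • fourier 0 ∈ Submodule.span ℂ (Set.range (@fourier τ)) :=
    add_mem hp (Submodule.smul_mem _ _ (Submodule.subset_span ⟨0, rfl⟩))
  obtain ⟨q, hq0, hq⟩ := exists_analytic_re_eq hp'
  have hre : ∀ x, (aeval (fourier 1 : C(AddCircle τ, ℂ)) q x).re = (p x).re + ε := fun x => by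
    rw [hq]; simp
  have hd : ∀ x, |max (g x) 0 - (p x).re| ≤ ε := fun x => by
    have h1 : ‖g' x - p x‖ ≤ ε := by
      rw [← dist_eq_norm]
      exact (ContinuousMap.dist_apply_le_dist x).trans hpd.le
    refine le_trans ?_ h1
    have := Complex.abs_re_le_norm (g' x - p x)
    simpa [g'] using this
  refine ⟨q, hq0, fun x => ?_, ?_⟩
  · rw [hre]
    have := (abs_le.1 (hd x)).2
    have := le_max_right (g x) 0
    linarith
  · have hb : ∀ x, ‖w x - (aeval (fourier 1 : C(AddCircle τ, ℂ)) q x).re‖ ≤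
        ‖|w x - g x| + 2 * ε‖ := fun x => by
      rw [hre, Real.norm_eq_abs, Real.norm_of_nonneg (by positivity)]
      have h1 : |w x - max (g x) 0| ≤ |w x - g x| := by
        have := abs_max_sub_max_le_abs (w x) (g x) 0
        rwa [max_eq_left (hw0 x)] at this
      have h2 := hd x
      have h3 : w x - ((p x).re + ε) = (w x - max (g x) 0) + (max (g x) 0 - (p x).re) - ε := by
        ring
      rw [h3]
      have := abs_sub ((w x - max (g x) 0) + (max (g x) 0 - (p x).re)) ε
      have := abs_add_le (w x - max (g x) 0) (max (g x) 0 - (p x).re)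
      rw [abs_of_pos hε] at *
      linarith
    calc _ ≤ eLpNorm (fun x => |w x - g x| + 2 * ε) 2 haarAddCircle :=
          eLpNorm_mono hb
      _ ≤ eLpNorm (fun x => |w x - g x|) 2 haarAddCircle +
          eLpNorm (fun _ : AddCircle τ => 2 * ε) 2 haarAddCircle :=
          eLpNorm_add_le (hw.sub hgm).1.norm aestronglyMeasurable_const (by norm_num)
      _ ≤ ENNReal.ofReal ε + ENNReal.ofReal (2 * ε) := by
          gcongr
          · rw [← eLpNorm_norm] at hg
            exact hg
          · rw [eLpNorm_const _ (by norm_num) (IsProbabilityMeasure.ne_zero _)]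
            simp [Real.enorm_eq_ofReal hε.le, ENNReal.ofReal_mul, Real.enorm_eq_ofReal]
      _ = ENNReal.ofReal (3 * ε) := by
          rw [← ENNReal.ofReal_add hε.le (by positivity)]
          ring_nf

/-- A nonnegative square integrable function is almost everywhere the real part of a limit of
analytic polynomials with nonnegative real parts. -/
lemma exists_analytic_seq {w : AddCircle τ → ℝ} (hw : MemLp w 2 haarAddCircle)
    (hw0 : ∀ x, 0 ≤ w x) :
    ∃ q : ℕ → ℂ[X], (∀ n x, 0 ≤ (aeval (fourier 1 : C(AddCircle τ, ℂ)) (q n) x).re) ∧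
      ∀ᵐ x ∂haarAddCircle, ∃ l : ℂ, l.re = w x ∧
        Tendsto (fun n => aeval (fourier 1 : C(AddCircle τ, ℂ)) (q n) x) atTop (𝓝 l) := by
  have hex := fun n : ℕ => exists_analytic_approx hw hw0 (ε := (1 / 2) ^ n) (by positivity)
  choose q hq0 hqpos hq using hex
  let f : ℕ → AddCircle τ → ℂ := fun n => aeval (fourier 1 : C(AddCircle τ, ℂ)) (q n)
  have hfc : ∀ n, Continuous (f n) := fun n => (aeval (fourier 1 : C(AddCircle τ, ℂ)) (q n)).continuous
  have hfr : ∀ n, AEStronglyMeasurable (fun x => (f n x).re) haarAddCircle := fun n =>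
    (Complex.continuous_re.comp (hfc n)).aestronglyMeasurable
  have hlim : Tendsto (fun n : ℕ => ENNReal.ofReal (3 * (1 / 2) ^ n)) atTop (𝓝 0) := by
    have : Tendsto (fun n : ℕ => 3 * (1 / 2 : ℝ) ^ n) atTop (𝓝 0) := by
      simpa using (tendsto_pow_atTop_nhds_zero_of_lt_one (r := (1 / 2 : ℝ)) (by norm_num)
        (by norm_num)).const_mul 3
    simpa using ENNReal.tendsto_ofReal this
  have hw1 : Tendsto (fun n => eLpNorm ((fun x => (f n x).re) - w) 2 haarAddCircle) atTop (𝓝 0) := by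
    refine tendsto_of_tendsto_of_tendsto_of_le_of_le tendsto_const_nhds hlim
      (fun _ => zero_le) fun n => ?_
    rw [eLpNorm_sub_comm]
    exact hq n
  obtain ⟨ns, hns, hae⟩ := (tendstoInMeasure_of_tendsto_eLpNorm (by norm_num) hfr hw.1
    hw1).exists_seq_tendsto_ae
  refine ⟨fun n => q (ns n), fun n x => hqpos _ x, ?_⟩
  -- Convergence of the real parts forces the whole functions to be Cauchy, by the conjugate
  -- function bound. The estimate gives 2 (3 + 3) = 12 times 2⁻ᴺ, and 16 makes it strict.
  -- Summability in N then yields convergence almost everywhere.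
  have hcau : ∀ N n m : ℕ, N ≤ n → N ≤ m →
      eLpNorm (f (ns n) - f (ns m)) 2 haarAddCircle < ENNReal.ofReal (16 * (1 / 2) ^ N) := by
    intro N n m hn hm
    have e1 : f (ns n) - f (ns m) =
        aeval (fourier 1 : C(AddCircle τ, ℂ)) (q (ns n) - q (ns m)) := by
      funext x; simp [f]
    have e2 : (fun x => (aeval (fourier 1 : C(AddCircle τ, ℂ)) (q (ns n) - q (ns m)) x).re) =
        (fun x => w x - (f (ns m) x).re) - (fun x => w x - (f (ns n) x).re) := by
      funext x; simp [f]
    have hb : ∀ k, N ≤ k → eLpNorm (fun x => w x - (f (ns k) x).re) 2 haarAddCircle ≤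
        ENNReal.ofReal (3 * (1 / 2) ^ N) := fun k hk => (hq (ns k)).trans <| by
      apply ENNReal.ofReal_le_ofReal
      have : (1 / 2 : ℝ) ^ ns k ≤ (1 / 2) ^ N :=
        pow_le_pow_of_le_one (by norm_num) (by norm_num) (hk.trans (hns.id_le k))
      linarith
    have hsub := eLpNorm_sub_le (hw.1.sub (hfr (ns m))) (hw.1.sub (hfr (ns n))) (p := 2)
      (by norm_num)
    rw [e1]
    refine (eLpNorm_analytic_le (by simp [hq0])).trans_lt ?_
    rw [e2]
    calc _ ≤ 2 * (ENNReal.ofReal (3 * (1 / 2) ^ N) + ENNReal.ofReal (3 * (1 / 2) ^ N)) := by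
          gcongr
          exact hsub.trans (add_le_add (hb m hm) (hb n hn))
      _ = ENNReal.ofReal (12 * (1 / 2) ^ N) := by
          rw [← ENNReal.ofReal_add (by positivity) (by positivity),
            ← ENNReal.ofReal_ofNat 2, ← ENNReal.ofReal_mul (by norm_num)]
          ring_nf
      _ < _ := by
          have h12 : (0 : ℝ) < (1 / 2) ^ N := by positivity
          exact (ENNReal.ofReal_lt_ofReal_iff (by positivity)).2 (by linarith)
  have hB : ∑' N : ℕ, ENNReal.ofReal (16 * (1 / 2) ^ N) ≠ ∞ := by
    rw [← ENNReal.ofReal_tsum_of_nonneg (fun n => by positivity)]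
    · exact ENNReal.ofReal_ne_top
    · exact summable_geometric_two.mul_left 16
  have hconv := Lp.ae_tendsto_of_cauchy_eLpNorm (fun n => (hfc (ns n)).aestronglyMeasurable)
    (p := 2) (by norm_num) hB hcau
  filter_upwards [hae, hconv] with x hx1 hx2
  obtain ⟨l, hl⟩ := hx2
  exact ⟨l, tendsto_nhds_unique ((Complex.continuous_re.tendsto l).comp hl) hx1, hl⟩

lemma fourierCoeff_fourier_one_mul (u : AddCircle τ → ℂ) (k : ℤ) :
    fourierCoeff (fun x => fourier 1 x * u x) k = fourierCoeff u (k - 1) := by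
  unfold fourierCoeff
  refine integral_congr_ae (ae_of_all _ fun x => ?_)
  simp only [smul_eq_mul]
  rw [← mul_assoc, ← fourier_add]
  congr 3
  ring

lemma integrable_continuousMap_mul (φ : C(AddCircle τ, ℂ)) {u : AddCircle τ → ℂ}
    (hu : Integrable u haarAddCircle) : Integrable (fun x => φ x * u x) haarAddCircle :=
  hu.bdd_mul φ.continuous.aestronglyMeasurable (ae_of_all _ fun x => φ.norm_coe_le_norm x)

/-- Multiplication by the uniform limit of analytic polynomials does not produce Fourier
coefficients of smaller index. -/
lemma fourierCoeff_mul_eq_zero {a : ℤ} {u : AddCircle τ → ℂ} (hu : Integrable u haarAddCircle)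
    (hu0 : ∀ k < a, fourierCoeff u k = 0) {φ : C(AddCircle τ, ℂ)}
    (hφ : φ ∈ (Algebra.adjoin ℂ {(fourier 1 : C(AddCircle τ, ℂ))}).topologicalClosure) :
    ∀ k < a, fourierCoeff (fun x => φ x * u x) k = 0 := by
  intro k hk
  have hpoly : ∀ q : ℂ[X], ∀ k < a,
      fourierCoeff (fun x => aeval (fourier 1 : C(AddCircle τ, ℂ)) q x * u x) k = 0 := by
    intro q
    induction q using Polynomial.induction_on with
    | C c =>
      intro k hk
      have : (fun x => aeval (fourier 1 : C(AddCircle τ, ℂ)) (C c) x * u x) =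
          fun x => c * u x := by
        funext x; rw [aeval_C]; rfl
      rw [this, fourierCoeff.const_mul, hu0 k hk, mul_zero]
    | add p q hp hq =>
      intro k hk
      have : (fun x => aeval (fourier 1 : C(AddCircle τ, ℂ)) (p + q) x * u x) =
          (fun x => aeval (fourier 1 : C(AddCircle τ, ℂ)) p x * u x) +
          fun x => aeval (fourier 1 : C(AddCircle τ, ℂ)) q x * u x := by
        funext x; rw [map_add, ContinuousMap.add_apply, add_mul]; rfl
      rw [this, fourierCoeff.add (integrable_continuousMap_mul _ hu)
        (integrable_continuousMap_mul _ hu)]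
      rw [Pi.add_apply, hp k hk, hq k hk, add_zero]
    | monomial n c ih =>
      intro k hk
      have : (fun x => aeval (fourier 1 : C(AddCircle τ, ℂ)) (C c * X ^ (n + 1)) x * u x) =
          fun x => fourier 1 x *
            (aeval (fourier 1 : C(AddCircle τ, ℂ)) (C c * X ^ n) x * u x) := by
        funext x
        rw [pow_succ, ← mul_assoc, map_mul, aeval_X, ContinuousMap.mul_apply]
        ring
      rw [this, fourierCoeff_fourier_one_mul]
      exact ih (k - 1) (by omega)
  let L : C(AddCircle τ, ℂ) → ℂ := fun φ => fourierCoeff (fun x => φ x * u x) k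
  have hL : Continuous L := by
    refine continuous_iff_continuousAt.2 fun φ₀ => ?_
    refine tendsto_integral_filter_of_dominated_convergence (fun x => (‖φ₀‖ + 1) * ‖u x‖)
      (Eventually.of_forall fun φ =>
        ((integrable_continuousMap_mul φ hu).fourier_smul _).aestronglyMeasurable) ?_
      (hu.norm.const_mul _) (ae_of_all _ fun x => ?_)
    · filter_upwards [Metric.ball_mem_nhds φ₀ one_pos] with φ hφ
      refine ae_of_all _ fun x => ?_
      have h1 : ‖φ x‖ ≤ ‖φ₀‖ + 1 := by
        have h2 : ‖φ - φ₀‖ < 1 := by rwa [mem_ball_iff_norm] at hφ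
        have h3 := norm_le_norm_add_norm_sub' φ φ₀
        have h4 := φ.norm_coe_le_norm x
        linarith
      rw [norm_smul, fourier_apply, Circle.norm_coe, one_mul, norm_mul]
      gcongr
    · have : Continuous fun φ : C(AddCircle τ, ℂ) => fourier (-k) x • (φ x * u x) := by
        have h1 : Continuous fun φ : C(AddCircle τ, ℂ) => φ x := continuous_eval_const x
        fun_prop
      exact this.tendsto φ₀
  have hcl : IsClosed {φ | L φ = 0} := isClosed_eq hL continuous_const
  have hsub : ((Algebra.adjoin ℂ {(fourier 1 : C(AddCircle τ, ℂ))} : Subalgebra ℂ _) :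
      Set C(AddCircle τ, ℂ)) ⊆ {φ | L φ = 0} := by
    intro ψ hψ
    rw [SetLike.mem_coe, Algebra.adjoin_singleton_eq_range_aeval] at hψ
    obtain ⟨q, rfl⟩ := hψ
    exact hpoly q k hk
  have : φ ∈ closure ((Algebra.adjoin ℂ {(fourier 1 : C(AddCircle τ, ℂ))} : Subalgebra ℂ _) :
      Set C(AddCircle τ, ℂ)) := hφ
  exact closure_minimal hsub hcl this

/-- The exponential series stays in a closed subalgebra, so these multipliers are admissible in
`fourierCoeff_mul_eq_zero`. -/
lemma exp_smul_mem (q : ℂ[X]) (s : ℂ) :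
    NormedSpace.exp (s • aeval (fourier 1 : C(AddCircle τ, ℂ)) q) ∈
      (Algebra.adjoin ℂ {(fourier 1 : C(AddCircle τ, ℂ))}).topologicalClosure := by
  refine NormedSpace.exp_mem (R := ℂ) (Subalgebra.isClosed_topologicalClosure _) ?_
  refine Subalgebra.smul_mem _ (Subalgebra.le_topologicalClosure _ ?_) _
  rw [Algebra.adjoin_singleton_eq_range_aeval]
  exact ⟨q, rfl⟩

lemma exp_continuousMap_apply (f : C(AddCircle τ, ℂ)) (x : AddCircle τ) :
    NormedSpace.exp f x = Complex.exp (f x) := by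
  rw [Complex.exp_eq_exp_ℂ]
  exact NormedSpace.map_exp (ContinuousMap.evalAlgHom ℂ ℂ x) (continuous_eval_const x) f

/-- By Parseval the integral is the sum of the products of the coefficients of U at -i and of V at
i. The second vanishes for i < 0 and the first for i ≥ 0. -/
lemma integral_mul_eq_zero_of_bounded {U V : AddCircle τ → ℂ}
    (hU : MemLp U 2 haarAddCircle) (hV : MemLp V 2 haarAddCircle)
    (hU0 : ∀ k < 1, fourierCoeff U k = 0) (hV0 : ∀ k < 0, fourierCoeff V k = 0) :
    ∫ x, U x * V x ∂haarAddCircle = 0 := by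
  have hU' : MemLp (fun x => star (U x)) 2 haarAddCircle := hU.star
  have h := HilbertBasis.hasSum_inner_mul_inner (fourierBasis (T := τ)) (hU'.toLp _) (hV.toLp _)
  have hz : ∀ i : ℤ, inner ℂ (hU'.toLp _) (fourierBasis (T := τ) i) *
      inner ℂ (fourierBasis (T := τ) i) (hV.toLp _) = 0 := by
    intro i
    rw [← HilbertBasis.repr_apply_apply, ← inner_conj_symm, ← HilbertBasis.repr_apply_apply,
      fourierBasis_repr, fourierBasis_repr, fourierCoeff_congr_ae hU'.coeFn_toLp,
      fourierCoeff_congr_ae hV.coeFn_toLp]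
    rcases lt_or_ge i 0 with hi | hi
    · rw [hV0 i hi, mul_zero]
    · have : fourierCoeff (fun x => star (U x)) i = star (fourierCoeff U (-i)) := by
        unfold fourierCoeff
        rw [RCLike.star_def, ← integral_conj]
        refine integral_congr_ae (ae_of_all _ fun x => ?_)
        simp only [smul_eq_mul, map_mul, neg_neg]
        rw [fourier_neg]
      rw [this, hU0 (-i) (by omega)]
      simp
  simp only [hz] at h
  have h0 := h.unique hasSum_zero
  rw [MeasureTheory.L2.inner_def] at h0
  rw [← h0]
  refine integral_congr_ae ?_
  filter_upwards [hU'.coeFn_toLp, hV.coeFn_toLp] with x h1 h2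
  rw [h1, h2]
  simp [mul_comm]

/-- If the functions `u i` have vanishing Fourier coefficients at `k ≤ 0`, the functions `v i` have
vanishing coefficients at `k < 0`, and `∑ u i v i` is integrable, then its integral vanishes. -/
theorem integral_sum_mul_eq_zero {ι : Type*} [Fintype ι] {u v : ι → AddCircle τ → ℂ}
    (hu : ∀ i, Integrable (u i) haarAddCircle) (hv : ∀ i, Integrable (v i) haarAddCircle)
    (hu0 : ∀ i, ∀ k < 1, fourierCoeff (u i) k = 0)
    (hv0 : ∀ i, ∀ k < 0, fourierCoeff (v i) k = 0)
    (huv : Integrable (fun x => ∑ i, u i x * v i x) haarAddCircle) :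
    ∫ x, ∑ i, u i x * v i x ∂haarAddCircle = 0 := by
  let m : AddCircle τ → ℝ := fun x => ∑ i, (‖u i x‖ + ‖v i x‖)
  have hm : Integrable m haarAddCircle :=
    integrable_finsetSum _ fun i _ => (hu i).norm.add (hv i).norm
  have hm0 : ∀ x, 0 ≤ m x := fun x => by positivity
  -- The square root of the integrable majorant is square integrable, so it is the real part of a
  -- limit of analytic polynomials. The majorant itself is only integrable, where the conjugate
  -- function is not controlled.
  let w : AddCircle τ → ℝ := fun x => Real.sqrt (m x)
  have hw0 : ∀ x, 0 ≤ w x := fun x => Real.sqrt_nonneg _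
  have hw2 : ∀ x, w x ^ 2 = m x := fun x => Real.sq_sqrt (hm0 x)
  have hw : MemLp w 2 haarAddCircle := by
    rw [memLp_two_iff_integrable_sq
      (Real.continuous_sqrt.comp_aestronglyMeasurable hm.aestronglyMeasurable)]
    exact hm.congr (ae_of_all _ fun x => (hw2 x).symm)
  obtain ⟨q, hq, hae⟩ := exists_analytic_seq hw hw0
  have hsel : ∃ l : AddCircle τ → ℂ, ∀ᵐ x ∂haarAddCircle, (l x).re = w x ∧
      Tendsto (fun n => aeval (fourier 1 : C(AddCircle τ, ℂ)) (q n) x) atTop (𝓝 (l x)) := by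
    classical
    refine ⟨fun x => if h : ∃ l : ℂ, l.re = w x ∧
      Tendsto (fun n => aeval (fourier 1 : C(AddCircle τ, ℂ)) (q n) x) atTop (𝓝 l)
      then h.choose else 0, ?_⟩
    filter_upwards [hae] with x hx
    rw [dif_pos hx]
    exact hx.choose_spec
  obtain ⟨l, hl⟩ := hsel
  have hlm : AEStronglyMeasurable l haarAddCircle :=
    aestronglyMeasurable_of_tendsto_ae atTop
      (fun n => (aeval (fourier 1 : C(AddCircle τ, ℂ)) (q n)).continuous.aestronglyMeasurable)
      (hl.mono fun x hx => hx.2)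
  -- A bounded analytic multiplier of modulus exp(-s w). It is small where the u and v are large,
  -- and it tends to 1 as s → 0.
  let E : ℝ → AddCircle τ → ℂ := fun s x => Complex.exp (-(s : ℂ) * l x)
  have hEm : ∀ s, AEStronglyMeasurable (E s) haarAddCircle := fun s =>
    (by fun_prop : Continuous fun z : ℂ => Complex.exp (-(s : ℂ) * z)).comp_aestronglyMeasurable hlm
  have hEn : ∀ s, ∀ᵐ x ∂haarAddCircle, ‖E s x‖ = Real.exp (-(s * w x)) := fun s => by
    filter_upwards [hl] with x hx
    simp [E, Complex.norm_exp, hx.1]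
  have hE1 : ∀ s, 0 ≤ s → ∀ᵐ x ∂haarAddCircle, ‖E s x‖ ≤ 1 := fun s hs => by
    filter_upwards [hEn s] with x hx
    rw [hx, Real.exp_le_one_iff]
    have := mul_nonneg hs (hw0 x)
    linarith
  -- The multiplier is a pointwise limit of the exponentials φ_n. These have modulus at most 1
  -- because the polynomials have nonnegative real parts, so the coefficients pass to the limit by
  -- dominated convergence.
  have hcoef : ∀ (s : ℝ), 0 ≤ s → ∀ (a : ℤ) (g : AddCircle τ → ℂ), Integrable g haarAddCircle →
      (∀ k < a, fourierCoeff g k = 0) → ∀ k < a, fourierCoeff (fun x => E s x * g x) k = 0 := by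
    intro s hs a g hg hg0 k hk
    let φ : ℕ → C(AddCircle τ, ℂ) := fun n =>
      NormedSpace.exp ((-(s : ℂ)) • aeval (fourier 1 : C(AddCircle τ, ℂ)) (q n))
    have hφ : ∀ n x, φ n x = Complex.exp (-(s : ℂ) *
        aeval (fourier 1 : C(AddCircle τ, ℂ)) (q n) x) := fun n x => by
      rw [exp_continuousMap_apply]; rfl
    have hφ1 : ∀ n x, ‖φ n x‖ ≤ 1 := fun n x => by
      rw [hφ, Complex.norm_exp, Real.exp_le_one_iff]
      have := mul_nonneg hs (hq n x)
      rw [← Complex.ofReal_neg, Complex.re_ofReal_mul]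
      linarith
    have hlim : Tendsto (fun n => fourierCoeff (fun x => φ n x * g x) k) atTop
        (𝓝 (fourierCoeff (fun x => E s x * g x) k)) := by
      refine tendsto_integral_of_dominated_convergence (fun x => ‖g x‖)
        (fun n => ((integrable_continuousMap_mul (φ n) hg).fourier_smul _).aestronglyMeasurable)
        hg.norm (fun n => ae_of_all _ fun x => ?_) ?_
      · rw [norm_smul, fourier_apply, Circle.norm_coe, one_mul, norm_mul]
        exact mul_le_of_le_one_left (norm_nonneg _) (hφ1 n x)
      · filter_upwards [hl] with x hx
        refine Tendsto.const_smul (Tendsto.mul_const _ ?_) _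
        simp only [hφ]
        exact (Complex.continuous_exp.tendsto _).comp (hx.2.const_mul _)
    have hz : ∀ n, fourierCoeff (fun x => φ n x * g x) k = 0 := fun n =>
      fourierCoeff_mul_eq_zero hg hg0 (exp_smul_mem (q n) _) k hk
    simp only [hz] at hlim
    exact (tendsto_nhds_unique hlim tendsto_const_nhds)
  have hbdd : ∀ s, 0 < s → ∀ g : AddCircle τ → ℂ, AEStronglyMeasurable g haarAddCircle →
      (∀ x, ‖g x‖ ≤ m x) → MemLp (fun x => E s x * g x) 2 haarAddCircle := by
    intro s hs g hg hgm
    refine MemLp.of_bound ((hEm s).mul hg) (2 / s ^ 2) ?_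
    filter_upwards [hEn s] with x hx
    rw [norm_mul, hx]
    -- Since |g| ≤ w², the product satisfies |E g| ≤ w² exp(-s w) ≤ 2 / s².
    have h1 : (s * w x) ^ 2 / 2 ≤ Real.exp (s * w x) := by
      have := Real.quadratic_le_exp_of_nonneg (mul_nonneg hs.le (hw0 x))
      have := mul_nonneg hs.le (hw0 x)
      linarith
    rw [Real.exp_neg]
    have h2 := hgm x
    rw [← hw2] at h2
    rw [inv_mul_le_iff₀ (Real.exp_pos _)]
    calc ‖g x‖ ≤ w x ^ 2 := h2
      _ = (s * w x) ^ 2 / 2 * (2 / s ^ 2) := by field_simp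
      _ ≤ _ := by gcongr
  have hum : ∀ i x, ‖u i x‖ ≤ m x := fun i x =>
    (le_add_of_nonneg_right (norm_nonneg (v i x))).trans
      (Finset.single_le_sum (f := fun i => ‖u i x‖ + ‖v i x‖) (fun j _ => by positivity)
        (Finset.mem_univ i))
  have hvm : ∀ i x, ‖v i x‖ ≤ m x := fun i x =>
    (le_add_of_nonneg_left (norm_nonneg (u i x))).trans
      (Finset.single_le_sum (f := fun i => ‖u i x‖ + ‖v i x‖) (fun j _ => by positivity)
        (Finset.mem_univ i))
  have hzero : ∀ s, 0 < s → ∫ x, E s x ^ 2 * ∑ i, u i x * v i x ∂haarAddCircle = 0 := by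
    intro s hs
    have e : ∀ x, E s x ^ 2 * ∑ i, u i x * v i x = ∑ i, (E s x * u i x) * (E s x * v i x) := by
      intro x
      rw [Finset.mul_sum]
      exact Finset.sum_congr rfl fun i _ => by ring
    simp only [e]
    have hUm := fun i => hbdd s hs (u i) (hu i).aestronglyMeasurable (hum i)
    have hVm := fun i => hbdd s hs (v i) (hv i).aestronglyMeasurable (hvm i)
    have hint : ∀ i, Integrable (fun x => (E s x * u i x) * (E s x * v i x)) haarAddCircle :=
      fun i => (hUm i).integrable_mul (hVm i)
    rw [integral_finsetSum _ fun i _ => hint i]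
    refine Finset.sum_eq_zero fun i _ => ?_
    exact integral_mul_eq_zero_of_bounded (hUm i) (hVm i)
      (hcoef s hs.le 1 (u i) (hu i) (hu0 i)) (hcoef s hs.le 0 (v i) (hv i) (hv0 i))
  -- Only the sum of the products is assumed integrable, so the multiplier is removed from the sum
  -- as a whole.
  have hlim : Tendsto (fun n : ℕ => ∫ x, E (1 / ((n : ℝ) + 1)) x ^ 2 *
      ∑ i, u i x * v i x ∂haarAddCircle) atTop (𝓝 (∫ x, ∑ i, u i x * v i x ∂haarAddCircle)) := by
    refine tendsto_integral_of_dominated_convergence (fun x => ‖∑ i, u i x * v i x‖)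
      (fun n => ((hEm _).pow 2).mul huv.aestronglyMeasurable) huv.norm (fun n => ?_)
      (ae_of_all _ fun x => ?_)
    · filter_upwards [hE1 (1 / ((n : ℝ) + 1)) (by positivity)] with x hx
      rw [norm_mul, norm_pow]
      exact mul_le_of_le_one_left (norm_nonneg _) (pow_le_one₀ (norm_nonneg _) hx)
    · have h1 : Tendsto (fun n : ℕ => E (1 / ((n : ℝ) + 1)) x) atTop (𝓝 1) := by
        have hc : Continuous fun s : ℝ => E s x := by
          simp only [E]; fun_prop
        have := (hc.tendsto 0).comp (tendsto_one_div_add_atTop_nhds_zero_nat (𝕜 := ℝ))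
        simpa [E, Function.comp_def] using this
      simpa using (h1.pow 2).mul_const (∑ i, u i x * v i x)
  have hz : ∀ n : ℕ, ∫ x, E (1 / ((n : ℝ) + 1)) x ^ 2 *
      ∑ i, u i x * v i x ∂haarAddCircle = 0 := fun n => hzero _ (by positivity)
  simp only [hz] at hlim
  exact (tendsto_nhds_unique hlim tendsto_const_nhds)

/-- An integrable function whose Fourier coefficients all vanish is zero almost everywhere. -/
theorem ae_eq_zero_of_fourierCoeff_eq_zero {f : AddCircle τ → ℂ}
    (hf : Integrable f haarAddCircle) (h0 : ∀ k, fourierCoeff f k = 0) :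
    f =ᵐ[haarAddCircle] 0 := by
  -- Integration against f is a continuous functional on continuous functions, and it vanishes on
  -- the dense span of the characters.
  have hc : ∀ φ : C(AddCircle τ, ℂ), ∫ x, φ x * f x ∂haarAddCircle = 0 := by
    let L : C(AddCircle τ, ℂ) →L[ℂ] ℂ := LinearMap.mkContinuous
      { toFun := fun φ => ∫ x, φ x * f x ∂haarAddCircle
        map_add' := fun φ ψ => by
          simp only [ContinuousMap.add_apply, add_mul]
          exact integral_add (integrable_continuousMap_mul φ hf) (integrable_continuousMap_mul ψ hf)
        map_smul' := fun c φ => by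
          simp only [ContinuousMap.smul_apply, smul_eq_mul, mul_assoc, RingHom.id_apply]
          exact integral_const_mul _ _ } (∫ x, ‖f x‖ ∂haarAddCircle) fun φ => by
        refine (norm_integral_le_integral_norm _).trans ?_
        rw [← integral_mul_const]
        refine integral_mono (integrable_continuousMap_mul φ hf).norm (hf.norm.mul_const _)
          fun x => ?_
        simp only [norm_mul]
        rw [mul_comm]
        gcongr
        exact φ.norm_coe_le_norm x
    have hL : L = 0 := by
      refine ContinuousLinearMap.ext_on (s := Set.range (@fourier τ)) ?_ ?_
      · rw [dense_iff_closure_eq, ← Submodule.topologicalClosure_coe, span_fourier_closure_eq_top]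
        rfl
      · rintro _ ⟨n, rfl⟩
        have := h0 (-n)
        simpa [fourierCoeff, L] using this
    intro φ
    exact congrArg (fun M : C(AddCircle τ, ℂ) →L[ℂ] ℂ => M φ) hL
  -- It remains to integrate over closed sets, whose indicators are bounded pointwise limits of
  -- continuous functions.
  refine ae_eq_zero_of_forall_setIntegral_isClosed_eq_zero hf fun K hK => ?_
  have hlim : Tendsto (fun n : ℕ => ∫ x, ((thickenedIndicator
      (Nat.one_div_pos_of_nat (α := ℝ) (n := n)) K x : ℝ≥0) : ℂ) * f x ∂haarAddCircle) atTop
      (𝓝 (∫ x, K.indicator f x ∂haarAddCircle)) := by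
    refine tendsto_integral_of_dominated_convergence (fun x => ‖f x‖) (fun n => ?_) hf.norm
      (fun n => ae_of_all _ fun x => ?_) (ae_of_all _ fun x => ?_)
    · refine AEStronglyMeasurable.mul (Continuous.aestronglyMeasurable ?_) hf.aestronglyMeasurable
      fun_prop
    · rw [norm_mul]
      refine mul_le_of_le_one_left (norm_nonneg _) ?_
      have := thickenedIndicator_le_one (Nat.one_div_pos_of_nat (α := ℝ) (n := n)) K x
      simpa using this
    · have h1 := thickenedIndicator_tendsto_indicator_closure
        (fun n => Nat.one_div_pos_of_nat (α := ℝ) (n := n))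
        tendsto_one_div_add_atTop_nhds_zero_nat K
      rw [tendsto_pi_nhds] at h1
      have h2 := h1 x
      rw [hK.closure_eq] at h2
      have h3 : Tendsto (fun n : ℕ => ((thickenedIndicator
        (Nat.one_div_pos_of_nat (α := ℝ) (n := n)) K x : ℝ≥0) : ℂ)) atTop
          (𝓝 ((K.indicator (fun _ => (1 : ℝ≥0)) x : ℝ≥0) : ℂ)) :=
        ((by fun_prop : Continuous fun r : ℝ≥0 => ((r : ℝ) : ℂ)).tendsto _).comp h2
      have h4 := h3.mul_const (f x)
      convert h4 using 2
      by_cases hx : x ∈ K <;> simp [hx]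
  have hz : ∀ n : ℕ, ∫ x, ((thickenedIndicator
      (Nat.one_div_pos_of_nat (α := ℝ) (n := n)) K x : ℝ≥0) : ℂ) * f x ∂haarAddCircle = 0 :=
    fun n => hc ⟨fun x => ((thickenedIndicator
      (Nat.one_div_pos_of_nat (α := ℝ) (n := n)) K x : ℝ≥0) : ℂ), by fun_prop⟩
  simp only [hz] at hlim
  rw [← integral_indicator hK.measurableSet]
  exact (tendsto_nhds_unique hlim tendsto_const_nhds)

end Circle

/-! ### Transfer from the circle to `(-π, π]` -/

instance fact_two_pi_pos : Fact (0 < 2 * Real.pi) := ⟨Real.two_pi_pos⟩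

/-- The function on the circle which agrees with `f` on `(-π, π]`. -/
def circleLift (f : ℝ → ℂ) : AddCircle (2 * Real.pi) → ℂ :=
  AddCircle.liftIoc (2 * Real.pi) (-Real.pi) f

lemma period_eq : period = volume.restrict (Set.Ioc (-Real.pi) (-Real.pi + 2 * Real.pi)) := by
  unfold period; congr 2; ring

lemma circleLift_coe {f : ℝ → ℂ} {t : ℝ}
    (ht : t ∈ Set.Ioc (-Real.pi) (-Real.pi + 2 * Real.pi)) : circleLift f t = f t :=
  AddCircle.liftIoc_coe_apply ht

lemma integrable_circleLift {f : ℝ → ℂ} (hf : Integrable f period) :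
    Integrable (circleLift f) AddCircle.haarAddCircle := by
  have h1 : MeasurePreserving (fun x : AddCircle (2 * Real.pi) =>
      (AddCircle.equivIoc (2 * Real.pi) (-Real.pi) x : ℝ)) volume period := by
    rw [period_eq]
    exact (measurePreserving_subtype_coe measurableSet_Ioc).comp
      (AddCircle.measurePreserving_equivIoc (2 * Real.pi))
  have h2 : Integrable (circleLift f) volume := h1.integrable_comp_of_integrable hf
  rw [AddCircle.volume_eq_smul_haarAddCircle] at h2
  rwa [integrable_smul_measure (by simp [Real.pi_pos]) ENNReal.ofReal_ne_top] at h2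

lemma circleLift_apply (f : ℝ → ℂ) (x : AddCircle (2 * Real.pi)) :
    circleLift f x = f (AddCircle.equivIoc (2 * Real.pi) (-Real.pi) x) := rfl

lemma integral_circleLift (f : ℝ → ℂ) :
    ∫ x, circleLift f x ∂AddCircle.haarAddCircle =
      (1 / (2 * Real.pi) : ℂ) * ∫ t, f t ∂period := by
  rw [AddCircle.integral_haarAddCircle, ← AddCircle.integral_preimage _ (-Real.pi), period_eq,
    setIntegral_congr_fun measurableSet_Ioc (fun t ht => circleLift_coe ht)]
  simp [Complex.real_smul]

lemma fourier_eq_character (n : ℤ) (t : ℝ) :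
    fourier n (t : AddCircle (2 * Real.pi)) = character n t := by
  rw [fourier_coe_apply, character]
  congr 1
  have : (Real.pi : ℂ) ≠ 0 := by exact_mod_cast Real.pi_ne_zero
  push_cast
  field_simp

lemma fourierCoeff_circleLift (f : ℝ → ℂ) (n : ℤ) :
    fourierCoeff (circleLift f) n =
      (1 / (2 * Real.pi) : ℂ) * ∫ t, f t * character (-n) t ∂period := by
  rw [← integral_circleLift, fourierCoeff]
  congr 1
  funext x
  obtain ⟨t, ht, rfl⟩ : ∃ t ∈ Set.Ioc (-Real.pi) (-Real.pi + 2 * Real.pi),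
      (t : AddCircle (2 * Real.pi)) = x := by
    have := (AddCircle.equivIoc (2 * Real.pi) (-Real.pi)).symm_apply_apply x
    exact ⟨_, (AddCircle.equivIoc (2 * Real.pi) (-Real.pi) x).2, this⟩
  rw [circleLift_coe ht, circleLift_coe ht, fourier_eq_character, smul_eq_mul, mul_comm]

lemma ae_eq_zero_of_circleLift {f : ℝ → ℂ}
    (hf : circleLift f =ᵐ[AddCircle.haarAddCircle] 0) : f =ᵐ[period] 0 := by
  have h1 : circleLift f =ᵐ[volume] 0 := by
    rw [AddCircle.volume_eq_smul_haarAddCircle]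
    exact Measure.ae_smul_measure hf _
  have h2 := (AddCircle.measurePreserving_mk (2 * Real.pi) (-Real.pi)).quasiMeasurePreserving.ae
    h1
  rw [← period_eq] at h2
  have h3 : ∀ᵐ t ∂period, t ∈ Set.Ioc (-Real.pi) (-Real.pi + 2 * Real.pi) := by
    rw [period_eq]; exact ae_restrict_mem measurableSet_Ioc
  filter_upwards [h2, h3] with t ht ht'
  have h4 : circleLift f t = 0 := ht
  rwa [circleLift_coe ht'] at h4

/-- An integrable function is determined by its Fourier coefficients. -/
lemma ae_eq_zero_of_coeff_eq_zero {f : ℝ → ℂ} (hf : Integrable f period)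
    (h0 : ∀ n : ℤ, ∫ t, f t * character (-n) t ∂period = 0) : f =ᵐ[period] 0 := by
  refine ae_eq_zero_of_circleLift
    (ae_eq_zero_of_fourierCoeff_eq_zero (integrable_circleLift hf) fun k => ?_)
  rw [fourierCoeff_circleLift, h0, mul_zero]

lemma norm_character (n : ℤ) (t : ℝ) : ‖character n t‖ = 1 := by
  rw [← fourier_eq_character, fourier_apply, Circle.norm_coe]

lemma star_character (n : ℤ) (t : ℝ) : star (character n t) = character (-n) t := by
  rw [← fourier_eq_character, ← fourier_eq_character, fourier_neg]; rfl

lemma character_add (m n : ℤ) (t : ℝ) : character (m + n) t = character m t * character n t := by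
  rw [← fourier_eq_character, ← fourier_eq_character, ← fourier_eq_character, fourier_add]

lemma character_zero (t : ℝ) : character 0 t = 1 := by simp [character]

lemma continuous_character (n : ℤ) : Continuous (character n) := by
  unfold character; fun_prop

lemma integral_character (n : ℤ) :
    (1 / (2 * Real.pi) : ℂ) * ∫ t, character n t ∂period = if n = 0 then 1 else 0 := by
  have h := integral_fourier (τ := 2 * Real.pi) n
  rw [← h, ← integral_circleLift]
  congr 1
  funext x
  obtain ⟨t, ht, rfl⟩ : ∃ t ∈ Set.Ioc (-Real.pi) (-Real.pi + 2 * Real.pi),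
      (t : AddCircle (2 * Real.pi)) = x := by
    have := (AddCircle.equivIoc (2 * Real.pi) (-Real.pi)).symm_apply_apply x
    exact ⟨_, (AddCircle.equivIoc (2 * Real.pi) (-Real.pi) x).2, this⟩
  rw [circleLift_coe ht, fourier_eq_character]

lemma integrable_mul_character {f : ℝ → ℂ} (hf : Integrable f period) (n : ℤ) :
    Integrable (fun t => f t * character n t) period :=
  hf.mul_bdd (c := 1) (continuous_character n).aestronglyMeasurable
    (ae_of_all _ fun t => (norm_character n t).le)

lemma integrable_character (n : ℤ) : Integrable (character n) period := by
  simpa using integrable_mul_character (integrable_const (1 : ℂ)) n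

lemma integrable_star {α : Type*} [MeasurableSpace α] {μ : Measure α} {f : α → ℂ}
    (hf : Integrable f μ) : Integrable (fun t => star (f t)) μ :=
  (RCLike.conjCLE (K := ℂ)).toContinuousLinearMap.integrable_comp hf

lemma inv_two_pi_ne_zero : (1 / (2 * Real.pi) : ℂ) ≠ 0 := by
  have : (Real.pi : ℂ) ≠ 0 := by exact_mod_cast Real.pi_ne_zero
  simp [this]

/-- If the Fourier coefficients of `k` vanish outside of the points of observation and those of `g`
vanish at the points of observation, then `k` and `g` are orthogonal. -/
theorem integral_dotProduct_star_eq_zero {S : Set ℤ} (hS : S.Finite)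
    {k g : ℝ → Vec T} (hk : ∀ l, Integrable (fun t => k t l) period)
    (hg : ∀ l, Integrable (fun t => g t l) period)
    (hk0 : ∀ n ∉ observed S, ∀ l, ∫ t, k t l * character (-n) t ∂period = 0)
    (hg0 : ∀ n ∈ observed S, ∀ l, ∫ t, g t l * character (-n) t ∂period = 0)
    (hkg : Integrable (fun t => k t ⬝ᵥ star (g t)) period) :
    ∫ t, k t ⬝ᵥ star (g t) ∂period = 0 := by
  let c : ℤ → Vec T := fun n l => (1 / (2 * Real.pi) : ℂ) * ∫ t, g t l * character (-n) t ∂period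
  -- The part of g with frequencies in S. It is a polynomial because S is finite, and it is
  -- orthogonal to k, whose coefficients vanish on S. Subtracting it leaves a one-sided spectrum.
  let p : ℝ → Vec T := fun t l => ∑ n ∈ hS.toFinset, c n l * character n t
  have hp : ∀ l, Integrable (fun t => p t l) period := fun l =>
    integrable_finsetSum _ fun n _ => (integrable_character n).const_mul _
  have hkp : ∀ t, k t ⬝ᵥ star (p t) =
      ∑ n ∈ hS.toFinset, ∑ l, star (c n l) * (k t l * character (-n) t) := by
    intro t
    simp only [dotProduct, Pi.star_apply, p, star_sum, star_mul', star_character, Finset.mul_sum]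
    rw [Finset.sum_comm]
    exact Finset.sum_congr rfl fun n _ => Finset.sum_congr rfl fun l _ => by ring
  have hkpi : Integrable (fun t => k t ⬝ᵥ star (p t)) period := by
    simp only [hkp]
    exact integrable_finsetSum _ fun n _ => integrable_finsetSum _ fun l _ =>
      (integrable_mul_character (hk l) _).const_mul _
  have hkp0 : ∫ t, k t ⬝ᵥ star (p t) ∂period = 0 := by
    simp only [hkp]
    rw [integral_finsetSum _ fun n _ => integrable_finsetSum _ fun l _ =>
      (integrable_mul_character (hk l) _).const_mul _]
    refine Finset.sum_eq_zero fun n hn => ?_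
    rw [integral_finsetSum _ fun l _ => (integrable_mul_character (hk l) _).const_mul _]
    refine Finset.sum_eq_zero fun l _ => ?_
    rw [integral_const_mul, hk0 n (fun h => h.2 (hS.mem_toFinset.1 hn)), mul_zero]
  have hsplit : ∀ t, k t ⬝ᵥ star (g t - p t) = k t ⬝ᵥ star (g t) - k t ⬝ᵥ star (p t) := by
    intro t; rw [star_sub, dotProduct_sub]
  have hd : Integrable (fun t => k t ⬝ᵥ star (g t - p t)) period := by
    simp only [hsplit]; exact hkg.sub hkpi
  suffices h : ∫ t, k t ⬝ᵥ star (g t - p t) ∂period = 0 by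
    simp only [hsplit] at h
    rwa [integral_sub hkg hkpi, hkp0, sub_zero] at h
  -- A negative frequency is either in S, where p cancels g, or observed, where g has no
  -- coefficient.
  have hcoef : ∀ n < 0, ∀ l, ∫ t, (g t l - p t l) * character (-n) t ∂period = 0 := by
    intro n hn l
    have e : ∀ t, (g t l - p t l) * character (-n) t = g t l * character (-n) t -
        ∑ m ∈ hS.toFinset, c m l * character (m - n) t := by
      intro t
      simp only [sub_mul, p, Finset.sum_mul, sub_eq_add_neg _ n, character_add, mul_assoc]
    simp only [e]
    rw [integral_sub (integrable_mul_character (hg l) _)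
      (integrable_finsetSum _ fun m _ => (integrable_character _).const_mul _),
      integral_finsetSum _ fun m _ => (integrable_character _).const_mul _]
    simp only [integral_const_mul]
    refine mul_left_cancel₀ inv_two_pi_ne_zero ?_
    rw [mul_sub, Finset.mul_sum, mul_zero]
    simp only [mul_left_comm _ (c _ l), integral_character, sub_eq_zero (b := n)]
    by_cases hnS : n ∈ S
    · simp [hnS, c]
    · simp [hnS, hg0 n ⟨hn, hnS⟩ l]
  -- Conjugating the integrand makes both factors analytic: k has only negative frequencies, so its
  -- conjugate has only positive ones, and g - p has only nonnegative ones.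
  have hprod : ∀ x, ∑ l, circleLift (fun t => star (k t l)) x *
      circleLift (fun t => g t l - p t l) x =
      circleLift (fun t => star (k t ⬝ᵥ star (g t - p t))) x := by
    intro x
    simp [circleLift_apply, dotProduct, star_sum]
  have key := integral_sum_mul_eq_zero (τ := 2 * Real.pi)
    (u := fun l => circleLift fun t => star (k t l))
    (v := fun l => circleLift fun t => g t l - p t l)
    (fun l => integrable_circleLift (integrable_star (hk l)))
    (fun l => integrable_circleLift ((hg l).sub (hp l))) ?_ ?_ ?_
  · simp only [hprod] at key
    rw [integral_circleLift, mul_eq_zero, or_iff_right inv_two_pi_ne_zero] at key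
    simpa using congrArg star (key.symm.trans (integral_conj (f := fun t =>
      k t ⬝ᵥ star (g t - p t)))).symm
  · intro l j hj
    have e : ∀ t, star (k t l) * character (-j) t = star (k t l * character (-(-j)) t) := by
      intro t; rw [star_mul', star_character, neg_neg]
    rw [fourierCoeff_circleLift]
    simp_rw [e]
    simp only [RCLike.star_def]
    rw [integral_conj, hk0 (-j) (fun h => by have := h.1; omega), map_zero, mul_zero]
  · intro l j hj
    rw [fourierCoeff_circleLift, hcoef j hj, mul_zero]
  · simp only [hprod]
    exact integrable_circleLift (integrable_star hd)

/-! ### Measurability and integrability -/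

/-- Cramer's rule expresses the entries by Borel functions of W. The formula also holds at singular
matrices, where both sides are zero by convention. -/
lemma aestronglyMeasurable_inv {W : Dens T}
    (hm : ∀ k l, AEStronglyMeasurable (fun t => W t k l) period) (k l : Fin T) :
    AEStronglyMeasurable (fun t => (W t)⁻¹ k l) period := by
  have hW : AEMeasurable (fun t => (fun k l => W t k l : Fin T → Fin T → ℂ)) period :=
    aemeasurable_pi_iff.2 fun k => aemeasurable_pi_iff.2 fun l => (hm k l).aemeasurable
  have hd : Continuous fun A : Fin T → Fin T → ℂ => (Matrix.of A).det :=
    Continuous.matrix_det (A := fun A : Fin T → Fin T → ℂ => Matrix.of A) continuous_id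
  have ha : Continuous fun A : Fin T → Fin T → ℂ => (Matrix.of A).adjugate k l :=
    (Continuous.matrix_adjugate (A := fun A : Fin T → Fin T → ℂ => Matrix.of A)
      continuous_id).matrix_elem k l
  have e : (fun t => (W t)⁻¹ k l) = fun t => (W t).det⁻¹ * (W t).adjugate k l := by
    funext t
    rw [Matrix.inv_def, Ring.inverse_eq_inv', Matrix.smul_apply, smul_eq_mul]
  rw [e]
  exact (((hd.measurable.comp_aemeasurable hW).inv).mul
    (ha.measurable.comp_aemeasurable hW)).aestronglyMeasurable

lemma aestronglyMeasurable_matMul {V W : Dens T}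
    (hV : ∀ k l, AEStronglyMeasurable (fun t => V t k l) period)
    (hW : ∀ k l, AEStronglyMeasurable (fun t => W t k l) period) (k l : Fin T) :
    AEStronglyMeasurable (fun t => (V t * W t) k l) period := by
  simp only [Matrix.mul_apply]
  exact Finset.aestronglyMeasurable_fun_sum _ fun i _ => (hV k i).mul (hW i l)

lemma integrable_form {W : Dens T} (hW : ∀ k l, Integrable (fun t => W t k l) period)
    {h k : ℝ → Vec T} (hh : AEStronglyMeasurable h period) (hk : AEStronglyMeasurable k period)
    {C : ℝ} (hC : ∀ t, ‖h t‖ ≤ C) (hC' : ∀ t, ‖k t‖ ≤ C) :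
    Integrable (fun t => h t ⬝ᵥ (W t *ᵥ star (k t))) period := by
  simp only [dotProduct, Matrix.mulVec]
  refine integrable_finsetSum _ fun i _ => ?_
  refine Integrable.bdd_mul (c := C) ?_ (aestronglyMeasurable_apply hh i)
    (ae_of_all _ fun t => (norm_le_pi_norm _ _).trans (hC t))
  refine integrable_finsetSum _ fun j _ => ?_
  refine (hW i j).mul_bdd (c := C) (continuous_star.comp_aestronglyMeasurable
    (aestronglyMeasurable_apply hk j)) (ae_of_all _ fun t => ?_)
  simp only [Pi.star_apply, norm_star]
  exact (norm_le_pi_norm _ _).trans (hC' t)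

lemma memL2_of_integrable {W : Dens T} (hW : IsSpectralDensity W) {h : ℝ → Vec T}
    (hh : AEStronglyMeasurable h period)
    (hi : Integrable (fun t => h t ⬝ᵥ (W t *ᵥ star (h t))) period) : MemL2 W h := by
  rw [memL2_iff hW hh, memLp_two_iff_integrable_sq_norm (aestronglyMeasurable_wmap hW hh)]
  refine hi.re.congr ?_
  filter_upwards [hW.1] with t ht
  exact (normSq_wmap ht h).symm

lemma memL2_of_bounded {W : Dens T} (hW : IsSpectralDensity W) {h : ℝ → Vec T}
    (hh : AEStronglyMeasurable h period) {C : ℝ} (hC : ∀ t, ‖h t‖ ≤ C) : MemL2 W h :=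
  memL2_of_integrable hW hh (integrable_form hW.2 hh hh hC hC)

/-- The weight cancels in a pairing with xᵀ A⁻¹. This is why inner products in L₂(W) with xᵀ W⁻¹ are
ordinary Fourier coefficients. -/
lemma form_dual {A : Matrix (Fin T) (Fin T) ℂ} (hA : A.PosSemidef) (hu : IsUnit A.det)
    (h x : Vec T) : h ⬝ᵥ (A *ᵥ star (x ᵥ* A⁻¹)) = h ⬝ᵥ star x := by
  rw [Matrix.star_vecMul, hA.inv.isHermitian.eq, Matrix.mulVec_mulVec,
    Matrix.mul_nonsing_inv _ hu, Matrix.one_mulVec]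

lemma form_dual_self {A : Matrix (Fin T) (Fin T) ℂ} (hA : A.PosSemidef) (hu : IsUnit A.det)
    (x : Vec T) : (x ᵥ* A⁻¹) ⬝ᵥ (A *ᵥ star (x ᵥ* A⁻¹)) = x ⬝ᵥ (A⁻¹ *ᵥ star x) := by
  rw [form_dual hA hu, Matrix.dotProduct_mulVec]

/-- The norm of xᵀ W⁻¹ in L₂(W) is governed by the form of W⁻¹ at x, so this is where integrability
of the inverse enters. -/
lemma memL2_dual_of_bounded {W : Dens T} (hW : IsSpectralDensity W) (hm : IsMinimal W)
    {x : ℝ → Vec T} (hx : AEStronglyMeasurable x period) {C : ℝ} (hC : ∀ t, ‖x t‖ ≤ C) :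
    MemL2 W (fun t => x t ᵥ* (W t)⁻¹) := by
  refine memL2_of_integrable hW (aestronglyMeasurable_vecMul hx
    (aestronglyMeasurable_inv hW.aestronglyMeasurable)) ?_
  refine (integrable_form hm.2 hx hx hC hC).congr ?_
  filter_upwards [hW.1, hm.1] with t h1 h2
  exact (form_dual_self h1 h2 _).symm

/-! ### Trigonometric polynomials -/

lemma trigPoly_single (n : ℤ) (v : Vec T) (t : ℝ) :
    trigPoly (Finsupp.single n v) t = character n t • v := by
  simp [trigPoly]

lemma trigPoly_add (p q : ℤ →₀ Vec T) : trigPoly (p + q) = trigPoly p + trigPoly q := by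
  funext t
  exact Finsupp.sum_add_index' (fun _ => smul_zero _) fun _ _ _ => smul_add _ _ _

lemma trigPoly_smul (c : ℂ) (p : ℤ →₀ Vec T) : trigPoly (c • p) = c • trigPoly p := by
  funext t
  simp only [trigPoly, Pi.smul_apply]
  rw [Finsupp.sum_smul_index' (fun _ => smul_zero _), Finsupp.smul_sum]
  exact Finsupp.sum_congr fun n _ => smul_comm _ _ _

lemma continuous_trigPoly (p : ℤ →₀ Vec T) : Continuous (trigPoly p) :=
  continuous_finsetSum _ fun n _ => (continuous_character n).smul continuous_const

lemma norm_trigPoly_le (p : ℤ →₀ Vec T) (t : ℝ) : ‖trigPoly p t‖ ≤ p.sum fun _ v => ‖v‖ := by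
  refine (norm_sum_le _ _).trans (Finset.sum_le_sum fun n _ => ?_)
  rw [norm_smul, norm_character, one_mul]

/-! ### The Hilbert space `L₂(W)` of a minimal density -/

/-- The Hilbert space of square integrable vector functions. -/
abbrev VecL2 (T : ℕ) : Type := Lp (EuclideanSpace ℂ (Fin T)) 2 period

open Classical in
/-- The image of `h ∈ L₂(W)` under the isometry `h ↦ hᵀ W^{1/2}`. -/
def toH (W : Dens T) (h : ℝ → Vec T) : VecL2 T :=
  if hh : MemLp (wmap W h) 2 period then hh.toLp (wmap W h) else 0

lemma coeFn_toH {W : Dens T} (hW : IsSpectralDensity W) {h : ℝ → Vec T} (hh : MemL2 W h) :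
    toH W h =ᵐ[period] wmap W h := by
  rw [toH, dif_pos (hh.memLp hW)]
  exact (hh.memLp hW).coeFn_toLp

lemma toH_add {W : Dens T} (hW : IsSpectralDensity W) {h k : ℝ → Vec T} (hh : MemL2 W h)
    (hk : MemL2 W k) : toH W (h + k) = toH W h + toH W k := by
  refine Lp.ext ?_
  filter_upwards [coeFn_toH hW (hh.add hW hk), coeFn_toH hW hh, coeFn_toH hW hk,
    Lp.coeFn_add (toH W h) (toH W k)] with t h1 h2 h3 h4
  rw [h1, h4, wmap_add, Pi.add_apply, Pi.add_apply, h2, h3]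

lemma toH_sub {W : Dens T} (hW : IsSpectralDensity W) {h k : ℝ → Vec T} (hh : MemL2 W h)
    (hk : MemL2 W k) : toH W (h - k) = toH W h - toH W k := by
  refine Lp.ext ?_
  filter_upwards [coeFn_toH hW (hh.sub hW hk), coeFn_toH hW hh, coeFn_toH hW hk,
    Lp.coeFn_sub (toH W h) (toH W k)] with t h1 h2 h3 h4
  rw [h1, h4, wmap_sub, Pi.sub_apply, Pi.sub_apply, h2, h3]

lemma MemL2.smul {W : Dens T} (hW : IsSpectralDensity W) {h : ℝ → Vec T} (hh : MemL2 W h)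
    (c : ℂ) : MemL2 W (c • h) := by
  rw [memL2_iff hW (hh.1.const_smul c), wmap_smul]
  exact (hh.memLp hW).const_smul c

lemma toH_smul {W : Dens T} (hW : IsSpectralDensity W) {h : ℝ → Vec T} (hh : MemL2 W h)
    (c : ℂ) : toH W (c • h) = c • toH W h := by
  refine Lp.ext ?_
  filter_upwards [coeFn_toH hW (hh.smul hW c), coeFn_toH hW hh,
    Lp.coeFn_smul c (toH W h)] with t h1 h2 h4
  rw [h1, h4, wmap_smul, Pi.smul_apply, Pi.smul_apply, h2]

lemma MemL2.congr {W : Dens T} {h k : ℝ → Vec T} (hh : MemL2 W h)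
    (hhk : h =ᵐ[period] k) : MemL2 W k :=
  ⟨hh.1.congr hhk, energy_congr W hhk ▸ hh.2⟩

lemma toH_congr {W : Dens T} (hW : IsSpectralDensity W) {h k : ℝ → Vec T} (hh : MemL2 W h)
    (hhk : h =ᵐ[period] k) : toH W h = toH W k := by
  refine Lp.ext ?_
  filter_upwards [coeFn_toH hW hh, coeFn_toH hW (hh.congr hhk), hhk] with t h1 h2 h3
  rw [h1, h2, wmap, wmap, h3]

lemma inner_toH {W : Dens T} (hW : IsSpectralDensity W) {h k : ℝ → Vec T} (hh : MemL2 W h)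
    (hk : MemL2 W k) :
    inner ℂ (toH W k) (toH W h) = ∫ t, h t ⬝ᵥ (W t *ᵥ star (k t)) ∂period := by
  rw [MeasureTheory.L2.inner_def]
  refine integral_congr_ae ?_
  filter_upwards [coeFn_toH hW hh, coeFn_toH hW hk, hW.1] with t h1 h2 h3
  rw [h1, h2, inner_wmap h3]

lemma integrable_inner {W : Dens T} (hW : IsSpectralDensity W) {h k : ℝ → Vec T}
    (hh : MemL2 W h) (hk : MemL2 W k) :
    Integrable (fun t => h t ⬝ᵥ (W t *ᵥ star (k t))) period := by
  refine (MeasureTheory.L2.integrable_inner (𝕜 := ℂ) (toH W k) (toH W h)).congr ?_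
  filter_upwards [coeFn_toH hW hh, coeFn_toH hW hk, hW.1] with t h1 h2 h3
  rw [h1, h2, inner_wmap h3]

lemma energy_eq_norm {W : Dens T} (hW : IsSpectralDensity W) {h : ℝ → Vec T}
    (hh : MemL2 W h) : energy W h = ENNReal.ofReal (1 / (2 * Real.pi) * ‖toH W h‖ ^ 2) := by
  rw [energy_eq hW, ENNReal.ofReal_mul (by positivity), ENNReal.ofReal_pow (norm_nonneg _),
    Lp.norm_def, ENNReal.ofReal_toReal (Lp.eLpNorm_ne_top _), eLpNorm_congr_ae (coeFn_toH hW hh)]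

/-- The function `h` with `hᵀ W^{1/2} = f`. -/
def fromH (W : Dens T) (f : VecL2 T) (t : ℝ) : Vec T := (f t).ofLp ᵥ* (root W t)⁻¹

lemma wmap_fromH {W : Dens T} (hW : IsSpectralDensity W) (hm : IsMinimal W) (f : VecL2 T) :
    wmap W (fromH W f) =ᵐ[period] f := by
  filter_upwards [hW.1, hm.1] with t h1 h2
  rw [wmap, fromH, Matrix.vecMul_vecMul, Matrix.nonsing_inv_mul _ (isUnit_det_root h1 h2),
    Matrix.vecMul_one]

lemma memL2_fromH {W : Dens T} (hW : IsSpectralDensity W) (hm : IsMinimal W) (f : VecL2 T) :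
    MemL2 W (fromH W f) := by
  have h1 : AEStronglyMeasurable (fromH W f) period :=
    aestronglyMeasurable_vecMul (h := fun t => (f t).ofLp)
      ((PiLp.continuous_ofLp 2 _).comp_aestronglyMeasurable (Lp.aestronglyMeasurable f))
      (aestronglyMeasurable_inv (aestronglyMeasurable_root hW.1 hW.aestronglyMeasurable))
  rw [memL2_iff hW h1]
  exact (memLp_congr_ae (wmap_fromH hW hm f)).2 (Lp.memLp f)

lemma toH_fromH {W : Dens T} (hW : IsSpectralDensity W) (hm : IsMinimal W) (f : VecL2 T) :
    toH W (fromH W f) = f :=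
  Lp.ext ((coeFn_toH hW (memL2_fromH hW hm f)).trans (wmap_fromH hW hm f))

lemma ae_eq_of_toH_eq {W : Dens T} (hW : IsSpectralDensity W) (hm : IsMinimal W)
    {h k : ℝ → Vec T} (hh : MemL2 W h) (hk : MemL2 W k) (hhk : toH W h = toH W k) :
    h =ᵐ[period] k := by
  filter_upwards [coeFn_toH hW hh, coeFn_toH hW hk, hW.1, hm.1] with t h1 h2 h3 h4
  rw [hhk, h2] at h1
  have h5 : k t ᵥ* root W t = h t ᵥ* root W t := congrArg WithLp.ofLp h1
  have h6 := congrArg (· ᵥ* (root W t)⁻¹) h5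
  simpa [Matrix.vecMul_vecMul, Matrix.mul_nonsing_inv _ (isUnit_det_root h3 h4)] using h6.symm

lemma memL2_trigPoly {W : Dens T} (hW : IsSpectralDensity W) (p : ℤ →₀ Vec T) :
    MemL2 W (trigPoly p) :=
  memL2_of_bounded hW (continuous_trigPoly _).aestronglyMeasurable (norm_trigPoly_le _)

/-- The trigonometric polynomials as elements of `L₂(W)`. -/
def polyMap {W : Dens T} (hW : IsSpectralDensity W) : (ℤ →₀ Vec T) →ₗ[ℂ] VecL2 T where
  toFun p := toH W (trigPoly p)
  map_add' p q := by
    rw [trigPoly_add, toH_add hW (memL2_trigPoly hW p) (memL2_trigPoly hW q)]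
  map_smul' c p := by
    rw [trigPoly_smul, toH_smul hW (memL2_trigPoly hW p)]
    rfl

lemma memL2_dual_trigPoly {W : Dens T} (hW : IsSpectralDensity W) (hm : IsMinimal W)
    (p : ℤ →₀ Vec T) : MemL2 W (fun t => trigPoly p t ᵥ* (W t)⁻¹) :=
  memL2_dual_of_bounded hW hm (continuous_trigPoly _).aestronglyMeasurable (norm_trigPoly_le _)

/-- The elements `xᵀ W⁻¹` of `L₂(W)`, for trigonometric polynomials `x`. -/
def dualMap {W : Dens T} (hW : IsSpectralDensity W) (hm : IsMinimal W) :
    (ℤ →₀ Vec T) →ₗ[ℂ] VecL2 T where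
  toFun p := toH W (fun t => trigPoly p t ᵥ* (W t)⁻¹)
  map_add' p q := by
    rw [← toH_add hW (memL2_dual_trigPoly hW hm p) (memL2_dual_trigPoly hW hm q)]
    congr 1
    funext t
    rw [trigPoly_add, Pi.add_apply, Pi.add_apply, Matrix.add_vecMul]
  map_smul' c p := by
    rw [RingHom.id_apply, ← toH_smul hW (memL2_dual_trigPoly hW hm p)]
    congr 1
    funext t
    rw [trigPoly_smul, Pi.smul_apply, Pi.smul_apply, Matrix.smul_vecMul]

/-- The finitely supported sequence `v` at `n`, for a unit coordinate vector `v`. -/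
def unitSeq (n : ℤ) (l : Fin T) : ℤ →₀ Vec T := Finsupp.single n (Pi.single l 1)

/-- Reduces inner products to unit sequences. It serves `polyMap` and `dualMap`, and also the map
into random variables. -/
lemma inner_linearMap {H : Type*} [NormedAddCommGroup H] [InnerProductSpace ℂ H]
    (L : (ℤ →₀ Vec T) →ₗ[ℂ] H) (p : ℤ →₀ Vec T) (z : H) :
    inner ℂ (L p) z = p.sum fun n v => ∑ l, star (v l) * inner ℂ (L (unitSeq n l)) z := by
  have h1 : ∀ (n : ℤ) (v : Vec T), Finsupp.single n v = ∑ l, v l • unitSeq n l := by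
    intro n v
    simp only [unitSeq, Finsupp.smul_single]
    rw [← Finsupp.single_finsetSum]
    congr 1
    ext i
    simp [Finset.sum_apply, Pi.single_apply]
  conv_lhs => rw [← Finsupp.sum_single p]
  rw [Finsupp.sum, map_sum, sum_inner, Finsupp.sum]
  refine Finset.sum_congr rfl fun n _ => ?_
  rw [h1, map_sum, sum_inner]
  refine Finset.sum_congr rfl fun l _ => ?_
  rw [map_smul, inner_smul_left]
  rfl

lemma inner_dualMap_unitSeq {W : Dens T} (hW : IsSpectralDensity W) (hm : IsMinimal W)
    {h : ℝ → Vec T} (hh : MemL2 W h) (n : ℤ) (l : Fin T) :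
    inner ℂ (dualMap hW hm (unitSeq n l)) (toH W h) = ∫ t, h t l * character (-n) t ∂period := by
  have h1 := inner_toH hW hh (memL2_dual_trigPoly hW hm (unitSeq n l))
  refine h1.trans (integral_congr_ae ?_)
  filter_upwards [hW.1, hm.1] with t h2 h3
  rw [form_dual h2 h3, unitSeq, trigPoly_single, star_smul, star_character, dotProduct_smul]
  simp [mul_comm]

lemma inner_polyMap_unitSeq {W : Dens T} (hW : IsSpectralDensity W)
    {h : ℝ → Vec T} (hh : MemL2 W h) (n : ℤ) (l : Fin T) :
    inner ℂ (polyMap hW (unitSeq n l)) (toH W h) =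
      ∫ t, (h t ᵥ* W t) l * character (-n) t ∂period := by
  have h1 := inner_toH hW hh (memL2_trigPoly hW (unitSeq n l))
  refine h1.trans (integral_congr_ae (ae_of_all _ fun t => ?_))
  simp only
  rw [unitSeq, trigPoly_single, star_smul, star_character, Matrix.dotProduct_mulVec,
    dotProduct_smul]
  simp [mul_comm]

/-- A coordinate of h is, pointwise, the form of h with a row of W⁻¹, and both lie in L₂(W). -/
lemma MemL2.integrable_apply {W : Dens T} (hW : IsSpectralDensity W) (hm : IsMinimal W)
    {h : ℝ → Vec T} (hh : MemL2 W h) (l : Fin T) : Integrable (fun t => h t l) period := by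
  refine (integrable_inner hW hh (memL2_dual_trigPoly hW hm (unitSeq 0 l))).congr ?_
  filter_upwards [hW.1, hm.1] with t h2 h3
  rw [form_dual h2 h3, unitSeq, trigPoly_single, star_smul, star_character, dotProduct_smul]
  simp [character_zero]

lemma MemL2.integrable_vecMul {W : Dens T} (hW : IsSpectralDensity W)
    {h : ℝ → Vec T} (hh : MemL2 W h) (l : Fin T) :
    Integrable (fun t => (h t ᵥ* W t) l) period := by
  refine (integrable_inner hW hh (memL2_trigPoly hW (unitSeq 0 l))).congr
    (ae_of_all _ fun t => ?_)
  simp only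
  rw [unitSeq, trigPoly_single, star_smul, star_character, Matrix.dotProduct_mulVec,
    dotProduct_smul]
  simp [character_zero]

/-! ### The two complementary subspaces -/

/-- The subspace of `L₂(W)` generated by the observed characters. -/
def obsSpace (S : Set ℤ) {W : Dens T} (hW : IsSpectralDensity W) : Submodule ℂ (VecL2 T) :=
  ((Finsupp.supported (Vec T) ℂ (observed S)).map (polyMap hW)).topologicalClosure

/-- The closed subspace of `L₂(W)` generated by `xᵀ W⁻¹`, for polynomials `x` over `U`. -/
def unkSpace (S : Set ℤ) {W : Dens T} (hW : IsSpectralDensity W) (hm : IsMinimal W) :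
    Submodule ℂ (VecL2 T) :=
  ((Finsupp.supported (Vec T) ℂ (unknown S)).map (dualMap hW hm)).topologicalClosure

lemma not_mem_observed_iff {S : Set ℤ} {n : ℤ} : n ∉ observed S ↔ n ∈ unknown S := by
  simp only [observed, unknown, Set.mem_ofPred_eq, Set.mem_union]
  by_cases h : n ∈ S <;> simp [h]

lemma unitSeq_mem_supported {s : Set ℤ} {n : ℤ} (hn : n ∈ s) (l : Fin T) :
    unitSeq n l ∈ Finsupp.supported (Vec T) ℂ s :=
  Finsupp.single_mem_supported ℂ _ hn

instance (S : Set ℤ) {W : Dens T} (hW : IsSpectralDensity W) :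
    CompleteSpace (obsSpace S hW) :=
  (Submodule.isClosed_topologicalClosure _).completeSpace_coe

instance (S : Set ℤ) {W : Dens T} (hW : IsSpectralDensity W) (hm : IsMinimal W) :
    CompleteSpace (unkSpace S hW hm) :=
  (Submodule.isClosed_topologicalClosure _).completeSpace_coe

/-- Biorthogonality: the inner product is the n-th Fourier coefficient of a character of frequency
m. -/
lemma inner_dualMap_polyMap {W : Dens T} (hW : IsSpectralDensity W) (hm : IsMinimal W)
    (n m : ℤ) (k l : Fin T) (hnm : n ≠ m) :
    inner ℂ (dualMap hW hm (unitSeq n k)) (polyMap hW (unitSeq m l)) = 0 := by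
  refine (inner_dualMap_unitSeq hW hm (memL2_trigPoly hW (unitSeq m l)) n k).trans ?_
  simp only [unitSeq, trigPoly_single, Pi.smul_apply, smul_eq_mul]
  simp_rw [mul_right_comm _ _ (character (-n) _), ← character_add]
  rw [integral_mul_const]
  have := integral_character (m + -n)
  rw [if_neg (by omega), mul_eq_zero, or_iff_right inv_two_pi_ne_zero] at this
  rw [this, zero_mul]

/-- The two subspaces are orthogonal complements of each other. -/
theorem orthogonal_unkSpace {S : Set ℤ} (hS : S.Finite) {W : Dens T}
    (hW : IsSpectralDensity W) (hm : IsMinimal W) :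
    (unkSpace S hW hm)ᗮ = obsSpace S hW := by
  -- The easy inclusion is biorthogonality, since U and the observed points are disjoint.
  have hle : obsSpace S hW ≤ (unkSpace S hW hm)ᗮ := by
    refine Submodule.topologicalClosure_minimal _ ?_ (Submodule.isClosed_orthogonal _)
    rintro _ ⟨p, hp, rfl⟩
    rw [unkSpace, Submodule.orthogonal_closure, Submodule.mem_orthogonal]
    rintro _ ⟨x, hx, rfl⟩
    rw [inner_linearMap]
    refine Finset.sum_eq_zero fun n hn => Finset.sum_eq_zero fun k _ => ?_
    rw [← inner_conj_symm, inner_linearMap, Finsupp.sum, Finset.sum_eq_zero, map_zero, mul_zero]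
    intro m hmp
    refine Finset.sum_eq_zero fun l _ => ?_
    rw [← inner_conj_symm, inner_dualMap_polyMap, map_zero, mul_zero]
    rintro rfl
    exact not_mem_observed_iff.2 ((Finsupp.mem_supported _ _).1 hx hn)
      ((Finsupp.mem_supported _ _).1 hp hmp)
  refine le_antisymm (fun f hf => ?_) hle
  have h1 : f - (obsSpace S hW).starProjection f ∈ (obsSpace S hW)ᗮ :=
    Submodule.sub_starProjection_mem_orthogonal f
  have h2 : f - (obsSpace S hW).starProjection f ∈ (unkSpace S hW hm)ᗮ :=
    sub_mem hf (hle (Submodule.starProjection_apply_mem _ f))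
  suffices h3 : f - (obsSpace S hW).starProjection f = 0 by
    rw [sub_eq_zero.1 h3]
    exact Submodule.starProjection_apply_mem _ f
  -- This element is orthogonal to both subspaces. Read back as a function h, it has no coefficients
  -- on U, and hᵀ W has none at the observed points, so the pairing of h with hᵀ W, which is its
  -- squared norm, vanishes.
  set f' := f - (obsSpace S hW).starProjection f
  have hh := memL2_fromH hW hm f'
  have hf' := toH_fromH hW hm f'
  set h := fromH W f'
  have e : ∀ t, W t = (W t)ᴴ → h t ⬝ᵥ (W t *ᵥ star (h t)) = h t ⬝ᵥ star (h t ᵥ* W t) := by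
    intro t ht
    rw [Matrix.star_vecMul, ← ht]
  have hi : Integrable (fun t => h t ⬝ᵥ star (h t ᵥ* W t)) period := by
    refine (integrable_inner hW hh hh).congr ?_
    filter_upwards [hW.1] with t ht
    exact e t ht.isHermitian.eq.symm
  have hz := integral_dotProduct_star_eq_zero hS (k := h) (g := fun t => h t ᵥ* W t)
    (hh.integrable_apply hW hm) (hh.integrable_vecMul hW) (fun n hn l => ?_) (fun n hn l => ?_) hi
  · have h4 : inner ℂ (toH W h) (toH W h) = 0 := by
      rw [inner_toH hW hh hh, ← hz]
      refine integral_congr_ae ?_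
      filter_upwards [hW.1] with t ht
      exact e t ht.isHermitian.eq.symm
    rw [hf'] at h4
    exact inner_self_eq_zero.1 h4
  · rw [← inner_dualMap_unitSeq hW hm hh, hf']
    exact h2 _ (Submodule.le_topologicalClosure _
      ⟨_, unitSeq_mem_supported (not_mem_observed_iff.1 hn) l, rfl⟩)
  · rw [← inner_polyMap_unitSeq hW hh, hf']
    exact h1 _ (Submodule.le_topologicalClosure _ ⟨_, unitSeq_mem_supported hn l, rfl⟩)

/-- Membership in `L₂ˢ(W)` in terms of the Hilbert space. -/
lemma memL2s_iff {S : Set ℤ} {W : Dens T} (hW : IsSpectralDensity W) {h : ℝ → Vec T} :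
    MemL2s S W h ↔ MemL2 W h ∧ toH W h ∈ obsSpace S hW := by
  refine and_congr_right fun hh => ?_
  have hE : ∀ p : ℤ →₀ Vec T, energy W (h - trigPoly p) =
      ENNReal.ofReal (1 / (2 * Real.pi) * ‖toH W h - polyMap hW p‖ ^ 2) := fun p => by
    rw [energy_eq_norm hW (hh.sub hW (memL2_trigPoly hW p)),
      toH_sub hW hh (memL2_trigPoly hW p)]
    rfl
  have hpi : 0 < 1 / (2 * Real.pi) := by positivity
  change _ ↔ toH W h ∈ closure (_ : Set (VecL2 T))
  rw [Metric.mem_closure_iff]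
  constructor
  · intro H ε hε
    obtain ⟨p, hp, hlt⟩ := H (ENNReal.ofReal (1 / (2 * Real.pi) * ε ^ 2)) (by simpa using by positivity)
    refine ⟨_, ⟨p, hp, rfl⟩, ?_⟩
    rw [hE, ENNReal.ofReal_lt_ofReal_iff (by positivity)] at hlt
    rw [dist_eq_norm]
    exact lt_of_pow_lt_pow_left₀ 2 hε.le (lt_of_mul_lt_mul_left hlt hpi.le)
  · intro H ε hε
    obtain ⟨r, hr, hrε⟩ : ∃ r : ℝ, 0 < r ∧ ENNReal.ofReal r ≤ ε := by
      rcases eq_or_ne ε ∞ with rfl | hne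
      · exact ⟨1, one_pos, le_top⟩
      · exact ⟨ε.toReal, ENNReal.toReal_pos hε.ne' hne, ENNReal.ofReal_toReal_le⟩
    obtain ⟨_, ⟨p, hp, rfl⟩, hd⟩ := H (Real.sqrt (2 * Real.pi * r)) (by positivity)
    refine ⟨p, hp, lt_of_lt_of_le ?_ hrε⟩
    rw [hE, ENNReal.ofReal_lt_ofReal_iff hr]
    rw [dist_eq_norm] at hd
    have h1 : ‖toH W h - polyMap hW p‖ ^ 2 < 2 * Real.pi * r := by
      rw [← Real.sq_sqrt (show 0 ≤ 2 * Real.pi * r by positivity)]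
      exact pow_lt_pow_left₀ hd (norm_nonneg _) two_ne_zero
    rw [one_div, inv_mul_lt_iff₀ (by positivity)]
    exact h1

/-! ### The function `A` -/

lemma norm_le_sum_norm (v : Vec T) : ‖v‖ ≤ ∑ k, ‖v k‖ :=
  (pi_norm_le_iff_of_nonneg (by positivity)).2 fun k =>
    Finset.single_le_sum (f := fun k => ‖v k‖) (fun _ _ => norm_nonneg _) (Finset.mem_univ k)

lemma summable_norm {a : ℤ → Vec T} (ha : Summable fun j => ∑ k, ‖a j k‖) :
    Summable fun j => ‖a j‖ :=
  ha.of_nonneg_of_le (fun _ => norm_nonneg _) fun _ => norm_le_sum_norm _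

lemma summable_norm_apply {a : ℤ → Vec T} (ha : Summable fun j => ∑ k, ‖a j k‖) (k : Fin T) :
    Summable fun j => ‖a j k‖ :=
  (summable_norm ha).of_nonneg_of_le (fun _ => norm_nonneg _) fun _ => norm_le_pi_norm _ _

lemma norm_character_smul (n : ℤ) (t : ℝ) (v : Vec T) : ‖character n t • v‖ = ‖v‖ := by
  rw [norm_smul, norm_character, one_mul]

lemma summable_symbolA {a : ℤ → Vec T} (ha : Summable fun j => ∑ k, ‖a j k‖) (t : ℝ) :
    Summable fun j => character (-j) t • a j :=
  Summable.of_norm (by simpa only [norm_character_smul] using summable_norm ha)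

lemma continuous_symbolA {a : ℤ → Vec T} (ha : Summable fun j => ∑ k, ‖a j k‖) :
    Continuous (symbolA a) :=
  continuous_tsum (fun j => (continuous_character (-j)).smul continuous_const) (summable_norm ha)
    fun _ _ => (norm_character_smul _ _ _).le

lemma norm_symbolA_le {a : ℤ → Vec T} (ha : Summable fun j => ∑ k, ‖a j k‖) (t : ℝ) :
    ‖symbolA a t‖ ≤ ∑' j, ‖a j‖ := by
  refine (norm_tsum_le_tsum_norm ?_).trans_eq ?_
  · simpa only [norm_character_smul] using summable_norm ha
  · simp only [norm_character_smul]

lemma symbolA_apply {a : ℤ → Vec T} (ha : Summable fun j => ∑ k, ‖a j k‖) (t : ℝ) (i : Fin T) :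
    symbolA a t i = ∑' j, character (-j) t * a j i :=
  tsum_apply (summable_symbolA ha t)

lemma aestronglyMeasurable_symbolA {a : ℤ → Vec T} (ha : Summable fun j => ∑ k, ‖a j k‖) :
    AEStronglyMeasurable (symbolA a) period :=
  (continuous_symbolA ha).aestronglyMeasurable

lemma hasSum_of_eq {β : Type*} {f f' : β → ℂ} {s s' : ℂ} (h : HasSum f s)
    (hf : ∀ b, f' b = f b) (hs : s' = s) : HasSum f' s' := by
  rw [hs, funext hf]
  exact h

/-- The series of A is integrated termwise, which absolute summability of the coefficients permits.
-/
lemma hasSum_integral_symbolA {a : ℤ → Vec T} (ha : Summable fun j => ∑ k, ‖a j k‖)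
    {φ : ℝ → ℂ} (hφ : Integrable φ period) (i : Fin T) (k : ℤ) :
    HasSum (fun j => a j i * ∫ t, φ t * character (-(k + j)) t ∂period)
      (∫ t, symbolA a t i * φ t * character (-k) t ∂period) := by
  have h := hasSum_integral_of_summable_integral_norm
    (F := fun (j : ℤ) t => a j i * (φ t * character (-(k + j)) t)) (μ := period)
    (fun j => (integrable_mul_character hφ _).const_mul _) ?_
  · refine hasSum_of_eq h (fun j => ?_) ?_
    · rw [integral_const_mul]
    · congr 1
      funext t
      rw [symbolA_apply ha, ← tsum_mul_right, ← tsum_mul_right]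
      refine tsum_congr fun j => ?_
      rw [neg_add, character_add]
      ring
  · simp only [norm_mul, norm_character, mul_one, integral_const_mul]
    exact (summable_norm_apply ha i).mul_right _

lemma hasSum_integral_symbolA_mul_star {a : ℤ → Vec T} (ha : Summable fun j => ∑ k, ‖a j k‖)
    {φ : ℝ → ℂ} (hφ : Integrable φ period) (i l : Fin T) :
    HasSum (fun kj : ℤ × ℤ => a kj.1 i * star (a kj.2 l) *
        ∫ t, φ t * character (-(kj.1 - kj.2)) t ∂period)
      (∫ t, symbolA a t i * φ t * star (symbolA a t l) ∂period) := by
  have hs : Summable fun kj : ℤ × ℤ => ‖a kj.1 i‖ * ‖a kj.2 l‖ :=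
    (summable_norm_apply ha i).mul_of_nonneg (summable_norm_apply ha l)
      (fun _ => norm_nonneg _) (fun _ => norm_nonneg _)
  have h := hasSum_integral_of_summable_integral_norm
    (F := fun (kj : ℤ × ℤ) t => a kj.1 i * star (a kj.2 l) *
      (φ t * character (-(kj.1 - kj.2)) t)) (μ := period)
    (fun j => (integrable_mul_character hφ _).const_mul _) ?_
  · refine hasSum_of_eq h (fun j => ?_) ?_
    · rw [integral_const_mul]
    · congr 1
      funext t
      have h1 : ∀ i, Summable fun j => ‖character (-j) t * a j i‖ := fun i => by
        simpa only [norm_mul, norm_character, one_mul] using summable_norm_apply ha i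
      have h2 : Summable fun j => ‖star (character (-j) t * a j l)‖ := by
        simpa only [norm_star] using h1 l
      have e : ∀ kj : ℤ × ℤ, a kj.1 i * star (a kj.2 l) * (φ t * character (-(kj.1 - kj.2)) t) =
          φ t * ((character (-kj.1) t * a kj.1 i) * star (character (-kj.2) t * a kj.2 l)) := by
        intro kj
        rw [star_mul', star_character, neg_neg, neg_sub, sub_eq_add_neg, character_add]
        ring
      rw [symbolA_apply ha, symbolA_apply ha, tsum_star, mul_right_comm, mul_comm _ (φ t),
        tsum_mul_tsum_of_summable_norm (h1 i) h2, ← tsum_mul_left]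
      exact tsum_congr fun kj => (e kj).symm
  · simp only [norm_mul, norm_character, mul_one, norm_star, integral_const_mul]
    exact hs.mul_right _

/-! ### The signal part of the optimal estimate -/

section Pointwise

variable {A B : Matrix (Fin T) (Fin T) ℂ}

/-- The parallel sum of A and B, in the form in which it is left over after completing the square.
-/
lemma mul_inv_mul_eq (hu : IsUnit (A + B).det) :
    A * (A + B)⁻¹ * B = A - A * (A + B)⁻¹ * A := by
  have : A * (A + B)⁻¹ * (A + B) = A := by
    rw [Matrix.mul_assoc, Matrix.nonsing_inv_mul _ hu, Matrix.mul_one]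
  rw [eq_sub_iff_add_eq, ← Matrix.mul_add, add_comm B A, this]

lemma form_wiener (hA : A.PosSemidef) (hB : B.PosSemidef) (hu : IsUnit (A + B).det)
    (v w : Vec T) : (v ᵥ* (A * (A + B)⁻¹)) ⬝ᵥ ((A + B) *ᵥ star (w ᵥ* (A * (A + B)⁻¹))) =
      v ⬝ᵥ ((A * (A + B)⁻¹ * A) *ᵥ star w) := by
  rw [← Matrix.vecMul_vecMul w, form_dual (hA.add hB) hu, Matrix.star_vecMul,
    hA.isHermitian.eq, ← Matrix.dotProduct_mulVec, Matrix.mulVec_mulVec]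

/-- Completing the square. -/
lemma form_completed_square (hA : A.PosSemidef) (hB : B.PosSemidef) (hu : IsUnit (A + B).det)
    (v h : Vec T) : ((v - h) ⬝ᵥ (A *ᵥ star (v - h))) + h ⬝ᵥ (B *ᵥ star h) =
      (h - v ᵥ* (A * (A + B)⁻¹)) ⬝ᵥ ((A + B) *ᵥ star (h - v ᵥ* (A * (A + B)⁻¹))) +
        v ⬝ᵥ ((A * (A + B)⁻¹ * B) *ᵥ star v) := by
  have h1 := form_wiener hA hB hu v v
  have h2 : h ⬝ᵥ ((A + B) *ᵥ star (v ᵥ* (A * (A + B)⁻¹))) = h ⬝ᵥ (A *ᵥ star v) := by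
    rw [← Matrix.vecMul_vecMul, form_dual (hA.add hB) hu, Matrix.star_vecMul, hA.isHermitian.eq]
  have h3 : (v ᵥ* (A * (A + B)⁻¹)) ⬝ᵥ ((A + B) *ᵥ star h) = v ⬝ᵥ (A *ᵥ star h) := by
    rw [← Matrix.dotProduct_mulVec, Matrix.mulVec_mulVec, Matrix.mul_assoc,
      Matrix.nonsing_inv_mul _ hu, Matrix.mul_one]
  rw [mul_inv_mul_eq hu]
  simp only [star_sub, Matrix.mulVec_sub, dotProduct_sub, sub_dotProduct, h1, h2, h3,
    Matrix.sub_mulVec]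
  simp only [Matrix.add_mulVec, dotProduct_add]
  ring

/-- At the Wiener filter the square vanishes, and what remains equals a sum of two nonnegative
forms. -/
lemma form_parallel_nonneg (hA : A.PosSemidef) (hB : B.PosSemidef) (hu : IsUnit (A + B).det)
    (v : Vec T) : 0 ≤ (v ⬝ᵥ ((A * (A + B)⁻¹ * B) *ᵥ star v)).re := by
  have h := form_completed_square hA hB hu v (v ᵥ* (A * (A + B)⁻¹))
  rw [sub_self, zero_dotProduct, zero_add] at h
  rw [← h, Complex.add_re]
  exact add_nonneg (form_re_nonneg hA _) (form_re_nonneg hB _)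

/-- The difference of the two sides is the form of the parallel sum. The inequality puts the Wiener
filter in L₂(F + G) and, further on, gives monotonicity of the inverse. -/
lemma form_wiener_le (hA : A.PosSemidef) (hB : B.PosSemidef) (hu : IsUnit (A + B).det)
    (v : Vec T) : ((v ᵥ* (A * (A + B)⁻¹)) ⬝ᵥ ((A + B) *ᵥ star (v ᵥ* (A * (A + B)⁻¹)))).re ≤
      (v ⬝ᵥ (A *ᵥ star v)).re := by
  have h := form_parallel_nonneg hA hB hu v
  rw [mul_inv_mul_eq hu, Matrix.sub_mulVec, dotProduct_sub, ← form_wiener hA hB hu,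
    Complex.sub_re] at h
  linarith

end Pointwise

/-! ### The Wiener filter as a function, and the Fourier meaning of R and Q -/

section Minimal

variable {F G : Dens T}

lemma aestronglyMeasurable_wiener (hF : IsSpectralDensity F) (hG : IsSpectralDensity G)
    (k l : Fin T) : AEStronglyMeasurable (fun t => (F t * (F t + G t)⁻¹) k l) period :=
  aestronglyMeasurable_matMul hF.aestronglyMeasurable
    (aestronglyMeasurable_inv (hF.add hG).aestronglyMeasurable) k l

lemma memL2_wiener (hF : IsSpectralDensity F) (hG : IsSpectralDensity G)
    (hm : IsMinimal (F + G)) {v : ℝ → Vec T} (hv : AEStronglyMeasurable v period) {C : ℝ}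
    (hC : ∀ t, ‖v t‖ ≤ C) : MemL2 (F + G) (fun t => v t ᵥ* (F t * (F t + G t)⁻¹)) := by
  refine ⟨aestronglyMeasurable_vecMul hv (aestronglyMeasurable_wiener hF hG),
    lt_of_le_of_lt ?_ (memL2_of_bounded hF hv hC).2⟩
  unfold energy
  gcongr ENNReal.ofReal (1 / (2 * Real.pi)) * ?_
  refine lintegral_mono_ae ?_
  filter_upwards [hF.1, hG.1, hm.1] with t h1 h2 h3
  exact ENNReal.ofReal_le_ofReal (form_wiener_le h1 h2 h3 _)

lemma integrable_wiener (hF : IsSpectralDensity F) (hG : IsSpectralDensity G)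
    (hm : IsMinimal (F + G)) (k l : Fin T) :
    Integrable (fun t => (F t * (F t + G t)⁻¹) k l) period := by
  have h := (memL2_wiener hF hG hm (v := fun _ => Pi.single k 1) aestronglyMeasurable_const
    (C := ‖(Pi.single k 1 : Vec T)‖) fun _ => le_rfl).integrable_apply (hF.add hG) hm l
  simpa [Matrix.single_vecMul, Matrix.row] using h

/-- The matrix equals F - F (F + G)⁻¹ F, and the entries of the last term are pointwise forms of two
Wiener filters of unit vectors, both in L₂(F + G). -/
lemma integrable_parallel (hF : IsSpectralDensity F) (hG : IsSpectralDensity G)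
    (hm : IsMinimal (F + G)) (k l : Fin T) :
    Integrable (fun t => (F t * (F t + G t)⁻¹ * G t) k l) period := by
  have hk := fun k : Fin T => memL2_wiener hF hG hm (v := fun _ => Pi.single k 1)
    aestronglyMeasurable_const (C := ‖(Pi.single k 1 : Vec T)‖) fun _ => le_rfl
  refine ((hF.2 k l).sub (integrable_inner (hF.add hG) (hk k) (hk l))).congr ?_
  filter_upwards [hF.1, hG.1, hm.1] with t h1 h2 h3
  have e := form_wiener h1 h2 h3 (Pi.single k 1) (Pi.single l 1)
  simp only [Pi.sub_apply, Pi.add_apply]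
  rw [mul_inv_mul_eq h3, e]
  simp [Pi.star_single]

/-- The function `Aᵀ F (F + G)⁻¹`. -/
def wiener (a : ℤ → Vec T) (F G : Dens T) (t : ℝ) : Vec T :=
  symbolA a t ᵥ* (F t * (F t + G t)⁻¹)

lemma memL2_wiener_symbolA {a : ℤ → Vec T} (ha : Summable fun j => ∑ k, ‖a j k‖)
    (hF : IsSpectralDensity F) (hG : IsSpectralDensity G) (hm : IsMinimal (F + G)) :
    MemL2 (F + G) (wiener a F G) :=
  memL2_wiener hF hG hm (aestronglyMeasurable_symbolA ha) (norm_symbolA_le ha)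

/-- The sequence Ra consists of the Fourier coefficients of the Wiener filter, so it is the
right-hand side of the normal equations for projecting the filter. -/
lemma applyR_apply {a : ℤ → Vec T} (ha : Summable fun j => ∑ k, ‖a j k‖)
    (hF : IsSpectralDensity F) (hG : IsSpectralDensity G) (hm : IsMinimal (F + G))
    (k : ℤ) (l : Fin T) :
    applyR F G a k l = (1 / (2 * Real.pi) : ℂ) *
      inner ℂ (dualMap (hF.add hG) hm (unitSeq k l)) (toH (F + G) (wiener a F G)) := by
  rw [inner_dualMap_unitSeq (hF.add hG) hm (memL2_wiener_symbolA ha hF hG hm)]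
  have h1 : ∀ l, HasSum (fun j => (a j ᵥ* coeffR F G k j) l) ((1 / (2 * Real.pi) : ℂ) *
      ∫ t, wiener a F G t l * character (-k) t ∂period) := by
    intro l
    have hφ := fun i => integrable_wiener hF hG hm i l
    have h2 := hasSum_sum (s := Finset.univ) fun i _ =>
      (hasSum_integral_symbolA ha (hφ i) i k).mul_left (1 / (2 * Real.pi) : ℂ)
    refine hasSum_of_eq h2 (fun j => ?_) ?_
    · simp only [Matrix.vecMul, dotProduct, coeffR, fourierMat, Matrix.of_apply]
      exact Finset.sum_congr rfl fun i _ => by ring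
    · rw [← Finset.mul_sum, ← integral_finsetSum]
      · congr 2
        funext t
        simp only [wiener, Matrix.vecMul, dotProduct, Finset.sum_mul]
      · intro i _
        refine integrable_mul_character ?_ _
        exact (hφ i).bdd_mul (c := ∑' j, ‖a j‖)
          (aestronglyMeasurable_apply (aestronglyMeasurable_symbolA ha) i)
          (ae_of_all _ fun t => (norm_le_pi_norm _ _).trans (norm_symbolA_le ha t))
  have h3 : HasSum (fun j => a j ᵥ* coeffR F G k j) (fun l => (1 / (2 * Real.pi) : ℂ) *
      ∫ t, wiener a F G t l * character (-k) t ∂period) := Pi.hasSum.2 h1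
  rw [applyR, h3.tsum_eq]

lemma formQ_eq {a : ℤ → Vec T} (ha : Summable fun j => ∑ k, ‖a j k‖)
    (hF : IsSpectralDensity F) (hG : IsSpectralDensity G) (hm : IsMinimal (F + G)) :
    formQ F G a = (1 / (2 * Real.pi) : ℂ) * ∫ t, symbolA a t ⬝ᵥ
      ((F t * (F t + G t)⁻¹ * G t) *ᵥ star (symbolA a t)) ∂period := by
  have hφ := integrable_parallel hF hG hm
  have h2 := hasSum_sum (s := Finset.univ) fun i (_ : i ∈ Finset.univ) =>
    hasSum_sum (s := Finset.univ) fun l (_ : l ∈ Finset.univ) =>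
    (hasSum_integral_symbolA_mul_star ha (hφ i l) i l).mul_left (1 / (2 * Real.pi) : ℂ)
  have hint : ∀ i l, Integrable (fun t => symbolA a t i * (F t * (F t + G t)⁻¹ * G t) i l *
      star (symbolA a t l)) period := by
    intro i l
    refine Integrable.mul_bdd (c := ∑' j, ‖a j‖) ?_ (continuous_star.comp_aestronglyMeasurable
      (aestronglyMeasurable_apply (aestronglyMeasurable_symbolA ha) l)) (ae_of_all _ fun t => ?_)
    · exact (hφ i l).bdd_mul (c := ∑' j, ‖a j‖)
        (aestronglyMeasurable_apply (aestronglyMeasurable_symbolA ha) i)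
        (ae_of_all _ fun t => (norm_le_pi_norm _ _).trans (norm_symbolA_le ha t))
    · rw [norm_star]
      exact (norm_le_pi_norm _ _).trans (norm_symbolA_le ha t)
  rw [formQ]
  convert h2.tsum_eq using 1
  · refine tsum_congr fun kj => ?_
    simp only [Matrix.mulVec, dotProduct, coeffQ, fourierMat, Matrix.of_apply, Finset.mul_sum,
      Pi.star_apply]
    exact Finset.sum_congr rfl fun i _ => Finset.sum_congr rfl fun l _ => by ring
  · simp only [← Finset.mul_sum]
    congr 1
    simp only [← integral_finsetSum Finset.univ fun l _ => hint _ l]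
    rw [← integral_finsetSum Finset.univ fun i _ => integrable_finsetSum _ fun l _ => hint i l]
    congr 1
    funext t
    simp only [Matrix.mulVec, dotProduct, Finset.mul_sum, Pi.star_apply, mul_assoc]

end Minimal

/-! ### The operator `B` and its inverse -/

section Inverse

variable {F G : Dens T} {S : Set ℤ} {a : ℤ → Vec T}

lemma pairing_eq (hF : IsSpectralDensity F) (hG : IsSpectralDensity G)
    (hm : IsMinimal (F + G))
    {g : ℤ → Vec T} {z : VecL2 T}
    (hg : ∀ k l, g k l = (1 / (2 * Real.pi) : ℂ) *
      inner ℂ (dualMap (hF.add hG) hm (unitSeq k l)) z) (y : ℤ →₀ Vec T) :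
    pairing g y = (1 / (2 * Real.pi) : ℂ) * inner ℂ (dualMap (hF.add hG) hm y) z := by
  rw [inner_linearMap, pairing, Finsupp.sum, Finsupp.sum, Finset.mul_sum]
  refine Finset.sum_congr rfl fun k _ => ?_
  rw [dotProduct, Finset.mul_sum]
  refine Finset.sum_congr rfl fun l _ => ?_
  rw [hg, Pi.star_apply]
  ring

lemma inner_dualMap_dualMap_unitSeq (hF : IsSpectralDensity F) (hG : IsSpectralDensity G)
    (hm : IsMinimal (F + G))
    (k j : ℤ) (l i : Fin T) :
    inner ℂ (dualMap (hF.add hG) hm (unitSeq k l)) (dualMap (hF.add hG) hm (unitSeq j i)) =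
      ∫ t, (F t + G t)⁻¹ i l * character (-(k - j)) t ∂period := by
  refine (inner_dualMap_unitSeq (hF.add hG) hm
    (memL2_dual_trigPoly (hF.add hG) hm (unitSeq j i)) k l).trans ?_
  congr 1
  funext t
  rw [unitSeq, trigPoly_single, Matrix.smul_vecMul, neg_sub, sub_eq_add_neg, character_add]
  simp [Matrix.single_vecMul]
  ring

/-- B is the Gram operator of `dualMap`. Hence the form ⟨Bx, x⟩ is, up to the factor 1/2π, the
squared norm of xᵀ (F + G)⁻¹. -/
lemma applyB_apply (hF : IsSpectralDensity F) (hG : IsSpectralDensity G)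
    (hm : IsMinimal (F + G))
    (x : ℤ →₀ Vec T) (k : ℤ) (l : Fin T) :
    applyB F G x k l = (1 / (2 * Real.pi) : ℂ) *
      inner ℂ (dualMap (hF.add hG) hm (unitSeq k l)) (dualMap (hF.add hG) hm x) := by
  rw [← inner_conj_symm, inner_linearMap, applyB, Finsupp.sum, Finsupp.sum, Finset.sum_apply,
    map_sum, Finset.mul_sum]
  refine Finset.sum_congr rfl fun j _ => ?_
  rw [map_sum, Finset.mul_sum]
  simp only [Matrix.vecMul, dotProduct]
  refine Finset.sum_congr rfl fun i _ => ?_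
  rw [map_mul, inner_conj_symm, inner_dualMap_dualMap_unitSeq hF hG hm, coeffB, fourierMat,
    Matrix.of_apply, ← RCLike.star_def, star_star]
  ring

lemma coeff_trigPoly (p : ℤ →₀ Vec T) (k : ℤ) (l : Fin T) :
    p k l = (1 / (2 * Real.pi) : ℂ) * ∫ t, trigPoly p t l * character (-k) t ∂period := by
  have e : ∀ t, trigPoly p t l * character (-k) t =
      ∑ n ∈ p.support, p n l * character (n - k) t := by
    intro t
    rw [trigPoly, Finsupp.sum, Finset.sum_apply, Finset.sum_mul]
    refine Finset.sum_congr rfl fun n _ => ?_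
    rw [sub_eq_add_neg, character_add, Pi.smul_apply, smul_eq_mul]
    ring
  simp only [e]
  rw [integral_finsetSum _ fun n _ => (integrable_character _).const_mul _]
  simp only [integral_const_mul, Finset.mul_sum, mul_left_comm _ (p _ l), integral_character,
    sub_eq_zero (b := k)]
  by_cases hk : p k = 0 <;> simp [hk]

/-- Multiplying xᵀ (F + G)⁻¹ by F + G recovers x. So the coordinates of x are continuous functionals
of its image in L₂(F + G), and convergence there implies coordinatewise convergence. -/
lemma apply_eq_inner (hF : IsSpectralDensity F) (hG : IsSpectralDensity G)
    (hm : IsMinimal (F + G))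
    (x : ℤ →₀ Vec T) (k : ℤ) (l : Fin T) :
    x k l = (1 / (2 * Real.pi) : ℂ) *
      inner ℂ (polyMap (hF.add hG) (unitSeq k l)) (dualMap (hF.add hG) hm x) := by
  rw [coeff_trigPoly]
  congr 1
  refine Eq.symm ((inner_polyMap_unitSeq (hF.add hG)
    (memL2_dual_trigPoly (hF.add hG) hm x) k l).trans (integral_congr_ae ?_))
  filter_upwards [hm.1] with t ht
  rw [Matrix.vecMul_vecMul, Matrix.nonsing_inv_mul _ ht, Matrix.vecMul_one]

/-- The element of `L₂(F + G)` which corresponds to `B⁻¹ R a`. -/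
def invProj (hF : IsSpectralDensity F) (hG : IsSpectralDensity G)
    (hm : IsMinimal (F + G))
    (S : Set ℤ) (a : ℤ → Vec T) : VecL2 T :=
  (unkSpace S (hF.add hG) hm).starProjection (toH (F + G) (wiener a F G))

/-- Being Cauchy for the form means being Cauchy in L₂(F + G). The limit lies in the closed span
over U and has the same inner products with the generators as the Wiener filter, which characterizes
the projection. -/
lemma tendsto_of_isInverseApprox (hF : IsSpectralDensity F) (hG : IsSpectralDensity G)
    (hm : IsMinimal (F + G)) (ha : Summable fun j => ∑ k, ‖a j k‖)
    {x : ℕ → ℤ →₀ Vec T}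
    (hx : IsInverseApprox S F G (applyR F G a) x) :
    Tendsto (fun m => dualMap (hF.add hG) hm (x m)) atTop (𝓝 (invProj hF hG hm S a)) := by
  obtain ⟨hsupp, hcau, hlim⟩ := hx
  have hpi : (0 : ℝ) < 1 / (2 * Real.pi) := by positivity
  have hc : CauchySeq fun m => dualMap (hF.add hG) hm (x m) := by
    refine Metric.cauchySeq_iff.2 fun ε hε => ?_
    obtain ⟨N, hN⟩ := hcau (1 / (2 * Real.pi) * ε ^ 2) (by positivity)
    refine ⟨N, fun m hm' n hn => ?_⟩
    have h := hN m hm' n hn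
    rw [pairing_eq hF hG hm (applyB_apply hF hG hm (x m - x n)), inner_self_eq_norm_sq_to_K,
      map_sub, norm_mul] at h
    have e : ‖(1 / (2 * Real.pi) : ℂ)‖ = 1 / (2 * Real.pi) := by
      rw [norm_div, norm_mul, Complex.norm_real, Real.norm_of_nonneg Real.pi_pos.le]; simp
    rw [e] at h
    have h2 := lt_of_mul_lt_mul_left h hpi.le
    rw [norm_pow, RCLike.norm_ofReal, abs_norm] at h2
    rw [dist_eq_norm]
    exact lt_of_pow_lt_pow_left₀ 2 hε.le h2
  obtain ⟨z, hz⟩ := cauchySeq_tendsto_of_complete hc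
  have hzX : z ∈ unkSpace S (hF.add hG) hm :=
    (Submodule.isClosed_topologicalClosure _).mem_of_tendsto hz (Eventually.of_forall fun m =>
      Submodule.le_topologicalClosure _ ⟨_, hsupp m, rfl⟩)
  suffices h : z = invProj hF hG hm S a by rw [← h]; exact hz
  refine (Submodule.eq_starProjection_of_mem_orthogonal hzX ?_).symm
  rw [unkSpace, Submodule.orthogonal_closure, Submodule.mem_orthogonal]
  rintro _ ⟨y, hy, rfl⟩
  have h1 : ∀ k ∈ unknown S, ∀ l, inner ℂ (dualMap (hF.add hG) hm (unitSeq k l))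
      (toH (F + G) (wiener a F G) - z) = 0 := by
    intro k hk l
    have h2 := ((continuous_apply l).tendsto _).comp (hlim k hk)
    have h3 : Tendsto (fun m => (1 / (2 * Real.pi) : ℂ) *
        inner ℂ (dualMap (hF.add hG) hm (unitSeq k l)) (dualMap (hF.add hG) hm (x m))) atTop
        (𝓝 ((1 / (2 * Real.pi) : ℂ) *
          inner ℂ (dualMap (hF.add hG) hm (unitSeq k l)) z)) :=
      (tendsto_const_nhds.inner hz).const_mul _
    simp only [← applyB_apply hF hG hm] at h3
    have h4 := tendsto_nhds_unique h2 h3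
    rw [applyR_apply ha hF hG hm] at h4
    rw [inner_sub_right, sub_eq_zero]
    exact mul_left_cancel₀ inv_two_pi_ne_zero h4
  rw [inner_linearMap]
  refine Finset.sum_eq_zero fun k hk => Finset.sum_eq_zero fun l _ => ?_
  rw [h1 k (hy hk), mul_zero]

/-- The projection lies in a closure, hence is a limit of images of finitely supported sequences.
The coordinates of B converge to Ra because the filter minus its projection is orthogonal to every
generator. -/
lemma exists_isInverseApprox (hF : IsSpectralDensity F) (hG : IsSpectralDensity G)
    (hm : IsMinimal (F + G)) (ha : Summable fun j => ∑ k, ‖a j k‖)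
    : ∃ x, IsInverseApprox S F G (applyR F G a) x := by
  have hP : invProj hF hG hm S a ∈ closure
      (((Finsupp.supported (Vec T) ℂ (unknown S)).map (dualMap (hF.add hG) hm) :
        Submodule ℂ (VecL2 T)) : Set (VecL2 T)) :=
    Submodule.starProjection_apply_mem (unkSpace S (hF.add hG) hm) _
  obtain ⟨y, hy, hlim⟩ := mem_closure_iff_seq_limit.1 hP
  choose x hx hxy using hy
  have hlim' : Tendsto (fun m => dualMap (hF.add hG) hm (x m)) atTop
      (𝓝 (invProj hF hG hm S a)) := by
    simpa only [hxy] using hlim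
  have hpi : (0 : ℝ) < 1 / (2 * Real.pi) := by positivity
  refine ⟨x, hx, fun ε hε => ?_, fun k hk => tendsto_pi_nhds.2 fun l => ?_⟩
  · obtain ⟨N, hN⟩ := Metric.cauchySeq_iff.1 hlim'.cauchySeq (Real.sqrt (2 * Real.pi * ε))
      (by positivity)
    refine ⟨N, fun m hm' n hn => ?_⟩
    have h := hN m hm' n hn
    rw [dist_eq_norm] at h
    have e : ‖(1 / (2 * Real.pi) : ℂ)‖ = 1 / (2 * Real.pi) := by
      rw [norm_div, norm_mul, Complex.norm_real, Real.norm_of_nonneg Real.pi_pos.le]; simp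
    rw [pairing_eq hF hG hm (applyB_apply hF hG hm (x m - x n)), inner_self_eq_norm_sq_to_K,
      map_sub, norm_mul, e, norm_pow, RCLike.norm_ofReal, abs_norm,
      one_div, inv_mul_lt_iff₀ (by positivity),
      ← Real.sq_sqrt (show 0 ≤ 2 * Real.pi * ε by positivity)]
    exact pow_lt_pow_left₀ h (norm_nonneg _) two_ne_zero
  · simp only [applyB_apply hF hG hm, applyR_apply ha hF hG hm]
    have h0 : inner ℂ (dualMap (hF.add hG) hm (unitSeq k l)) (toH (F + G) (wiener a F G)) =
        inner ℂ (dualMap (hF.add hG) hm (unitSeq k l)) (invProj hF hG hm S a) := by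
      rw [← sub_eq_zero, ← inner_sub_right]
      exact Submodule.sub_starProjection_mem_orthogonal (K := unkSpace S (hF.add hG) hm) _ _
        (Submodule.le_topologicalClosure _ ⟨_, unitSeq_mem_supported hk l, rfl⟩)
    rw [h0]
    exact (tendsto_const_nhds.inner hlim').const_mul _

/-- The sequence of Fourier coefficients of `C`. -/
def invCoeff (hF : IsSpectralDensity F) (hG : IsSpectralDensity G)
    (hm : IsMinimal (F + G))
    (S : Set ℤ) (a : ℤ → Vec T) (k : ℤ) (l : Fin T) : ℂ :=
  (1 / (2 * Real.pi) : ℂ) *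
    inner ℂ (polyMap (hF.add hG) (unitSeq k l)) (invProj hF hG hm S a)

lemma tendsto_apply_of_isInverseApprox (hF : IsSpectralDensity F) (hG : IsSpectralDensity G)
    (hm : IsMinimal (F + G)) (ha : Summable fun j => ∑ k, ‖a j k‖)
    {x : ℕ → ℤ →₀ Vec T}
    (hx : IsInverseApprox S F G (applyR F G a) x) (k : ℤ) :
    Tendsto (fun m => x m k) atTop (𝓝 (invCoeff hF hG hm S a k)) := by
  refine tendsto_pi_nhds.2 fun l => ?_
  simp only [apply_eq_inner hF hG hm]
  exact (tendsto_const_nhds.inner (tendsto_of_isInverseApprox hF hG hm ha hx)).const_mul _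

lemma isInverse_iff (hF : IsSpectralDensity F) (hG : IsSpectralDensity G)
    (hm : IsMinimal (F + G)) (ha : Summable fun j => ∑ k, ‖a j k‖)
    {c : ℤ → Vec T} :
    IsInverse S F G (applyR F G a) c ↔ c = invCoeff hF hG hm S a := by
  constructor
  · rintro ⟨x, hx, hc⟩
    funext k
    exact tendsto_nhds_unique (hc k) (tendsto_apply_of_isInverseApprox hF hG hm ha hx k)
  · rintro rfl
    obtain ⟨x, hx⟩ := exists_isInverseApprox (S := S) hF hG hm ha
    exact ⟨x, hx, tendsto_apply_of_isInverseApprox hF hG hm ha hx⟩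

/-- The limit is the inner product of the Wiener filter with its own projection, that is, the
squared norm of the projection. -/
lemma tendsto_pairing_of_isInverseApprox (hF : IsSpectralDensity F) (hG : IsSpectralDensity G)
    (hm : IsMinimal (F + G)) (ha : Summable fun j => ∑ k, ‖a j k‖)
    {x : ℕ → ℤ →₀ Vec T}
    (hx : IsInverseApprox S F G (applyR F G a) x) :
    Tendsto (fun m => pairing (applyR F G a) (x m)) atTop
      (𝓝 ((1 / (2 * Real.pi) * ‖invProj hF hG hm S a‖ ^ 2 : ℝ) : ℂ)) := by
  simp only [pairing_eq hF hG hm (applyR_apply ha hF hG hm)]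
  have h1 : inner ℂ (invProj hF hG hm S a) (toH (F + G) (wiener a F G)) =
      (‖invProj hF hG hm S a‖ : ℂ) ^ 2 := by
    have h2 : inner ℂ (invProj hF hG hm S a) (toH (F + G) (wiener a F G) -
        invProj hF hG hm S a) = 0 :=
      Submodule.sub_starProjection_mem_orthogonal (K := unkSpace S (hF.add hG) hm) _ _
        (Submodule.starProjection_apply_mem _ _)
    rw [inner_sub_right, sub_eq_zero] at h2
    rw [h2, inner_self_eq_norm_sq_to_K]
    rfl
  have h3 := ((tendsto_of_isInverseApprox hF hG hm ha hx).inner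
    (tendsto_const_nhds (x := toH (F + G) (wiener a F G)))).const_mul (1 / (2 * Real.pi) : ℂ)
  rw [h1] at h3
  convert h3 using 2
  push_cast
  rfl

lemma isInverseForm_iff (hF : IsSpectralDensity F) (hG : IsSpectralDensity G)
    (hm : IsMinimal (F + G)) (ha : Summable fun j => ∑ k, ‖a j k‖)
    {v : ℝ} : IsInverseForm S F G (applyR F G a) v ↔
    v = 1 / (2 * Real.pi) * ‖invProj hF hG hm S a‖ ^ 2 := by
  constructor
  · rintro ⟨x, hx, hv⟩
    exact_mod_cast tendsto_nhds_unique hv (tendsto_pairing_of_isInverseApprox hF hG hm ha hx)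
  · rintro rfl
    obtain ⟨x, hx⟩ := exists_isInverseApprox (S := S) hF hG hm ha
    exact ⟨x, hx, tendsto_pairing_of_isInverseApprox hF hG hm ha hx⟩

lemma solutionC_eq (hF : IsSpectralDensity F) (hG : IsSpectralDensity G)
    (hm : IsMinimal (F + G)) (ha : Summable fun j => ∑ k, ‖a j k‖)
    : solutionC S a F G = invCoeff hF hG hm S a :=
  (isInverse_iff hF hG hm ha).1 (Classical.epsilon_spec (p := IsInverse S F G (applyR F G a))
    ⟨_, (isInverse_iff hF hG hm ha).2 rfl⟩)

lemma formInvB_eq (hF : IsSpectralDensity F) (hG : IsSpectralDensity G)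
    (hm : IsMinimal (F + G)) (ha : Summable fun j => ∑ k, ‖a j k‖)
    : formInvB S a F G = 1 / (2 * Real.pi) * ‖invProj hF hG hm S a‖ ^ 2 :=
  (isInverseForm_iff hF hG hm ha).1
    (Classical.epsilon_spec (p := IsInverseForm S F G (applyR F G a))
      ⟨_, (isInverseForm_iff hF hG hm ha).2 rfl⟩)

lemma ae_eq_of_isFourierSum {c : ℤ → Vec T} {C C' : ℝ → Vec T} (h : IsFourierSum c C)
    (h' : IsFourierSum c C') : C =ᵐ[period] C' := by
  have hl : ∀ l, (fun t => C t l - C' t l) =ᵐ[period] 0 := fun l => by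
    refine ae_eq_zero_of_coeff_eq_zero ((h l).1.sub (h' l).1) fun n => ?_
    have e := ((h l).2 n).trans ((h' l).2 n).symm
    simp only [sub_mul]
    rw [integral_sub (integrable_mul_character (h l).1 _) (integrable_mul_character (h' l).1 _),
      mul_left_cancel₀ inv_two_pi_ne_zero e, sub_self]
  filter_upwards [ae_all_iff.2 hl] with t ht
  funext l
  exact sub_eq_zero.1 (ht l)

/-- Identifies C with the projection multiplied by F + G. -/
lemma isFourierSum_fromH (hF : IsSpectralDensity F) (hG : IsSpectralDensity G)
    (hm : IsMinimal (F + G)) (ha : Summable fun j => ∑ k, ‖a j k‖)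
    : IsFourierSum (solutionC S a F G)
    (fun t => fromH (F + G) (invProj hF hG hm S a) t ᵥ* (F t + G t)) := by
  intro l
  have hh := memL2_fromH (hF.add hG) hm (invProj hF hG hm S a)
  refine ⟨hh.integrable_vecMul (hF.add hG) l, fun k => ?_⟩
  rw [solutionC_eq hF hG hm ha, invCoeff, ← toH_fromH (hF.add hG) hm (invProj hF hG hm S a),
    inner_polyMap_unitSeq (hF.add hG) hh, toH_fromH (hF.add hG) hm]
  rfl

/-- The sequence `B⁻¹ R a`, its Fourier sum and the quadratic form exist and are unique. -/
theorem isWellDefined (hF : IsSpectralDensity F) (hG : IsSpectralDensity G)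
    (hm : IsMinimal (F + G)) (ha : Summable fun j => ∑ k, ‖a j k‖)
    : IsWellDefined S a F G :=
  ⟨⟨_, (isInverse_iff hF hG hm ha).2 rfl, fun _ h => (isInverse_iff hF hG hm ha).1 h⟩,
    ⟨_, isFourierSum_fromH hF hG hm ha⟩, fun _ _ h h' => ae_eq_of_isFourierSum h h',
    ⟨_, (isInverseForm_iff hF hG hm ha).2 rfl, fun _ h => (isInverseForm_iff hF hG hm ha).1 h⟩⟩

lemma characteristic_ae_eq (hF : IsSpectralDensity F) (hG : IsSpectralDensity G)
    (hm : IsMinimal (F + G)) (ha : Summable fun j => ∑ k, ‖a j k‖)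
    : characteristic S a F G =ᵐ[period]
    wiener a F G - fromH (F + G) (invProj hF hG hm S a) := by
  have h1 : symbolC S a F G =ᵐ[period]
      fun t => fromH (F + G) (invProj hF hG hm S a) t ᵥ* (F t + G t) :=
    ae_eq_of_isFourierSum (Classical.epsilon_spec
      (p := IsFourierSum (solutionC S a F G)) ⟨_, isFourierSum_fromH hF hG hm ha⟩)
      (isFourierSum_fromH hF hG hm ha)
  filter_upwards [h1, hm.1] with t h2 h3
  have h3' : IsUnit (F t + G t).det := h3
  rw [characteristic, h2, Matrix.vecMul_vecMul, Matrix.mul_nonsing_inv _ h3', Matrix.vecMul_one]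
  rfl

lemma memL2_characteristic (hF : IsSpectralDensity F) (hG : IsSpectralDensity G)
    (hm : IsMinimal (F + G)) (ha : Summable fun j => ∑ k, ‖a j k‖)
    : MemL2 (F + G) (characteristic S a F G) :=
  ((memL2_wiener_symbolA ha hF hG hm).sub (hF.add hG) (memL2_fromH (hF.add hG) hm _)).congr
    (characteristic_ae_eq hF hG hm ha).symm

lemma toH_characteristic (hF : IsSpectralDensity F) (hG : IsSpectralDensity G)
    (hm : IsMinimal (F + G)) (ha : Summable fun j => ∑ k, ‖a j k‖)
    : toH (F + G) (characteristic S a F G) =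
    toH (F + G) (wiener a F G) - invProj hF hG hm S a := by
  rw [toH_congr (hF.add hG) (memL2_characteristic hF hG hm ha)
    (characteristic_ae_eq hF hG hm ha), toH_sub (hF.add hG) (memL2_wiener_symbolA ha hF hG hm)
    (memL2_fromH (hF.add hG) hm _), toH_fromH (hF.add hG) hm]

/-- Formula (4) is the Wiener filter minus its projection, hence orthogonal to the span over U; the
complement of that span is the observed space. -/
lemma memL2s_characteristic (hF : IsSpectralDensity F) (hG : IsSpectralDensity G)
    (hm : IsMinimal (F + G)) (ha : Summable fun j => ∑ k, ‖a j k‖)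
    (hS : S.Finite) :
    MemL2s S (F + G) (characteristic S a F G) := by
  rw [memL2s_iff (hF.add hG)]
  refine ⟨memL2_characteristic hF hG hm ha, ?_⟩
  rw [toH_characteristic hF hG hm ha, ← orthogonal_unkSpace hS (hF.add hG) hm]
  exact Submodule.sub_starProjection_mem_orthogonal _

/-! ### The mean square error -/

lemma formQ_re_eq (hF : IsSpectralDensity F) (hG : IsSpectralDensity G)
    (hm : IsMinimal (F + G)) (ha : Summable fun j => ∑ k, ‖a j k‖)
    : (formQ F G a).re = 1 / (2 * Real.pi) * ∫ t, (symbolA a t ⬝ᵥ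
      ((F t * (F t + G t)⁻¹ * G t) *ᵥ star (symbolA a t))).re ∂period := by
  have hint : Integrable (fun t => symbolA a t ⬝ᵥ
      ((F t * (F t + G t)⁻¹ * G t) *ᵥ star (symbolA a t))) period :=
    integrable_form (W := fun t => F t * (F t + G t)⁻¹ * G t) (integrable_parallel hF hG hm)
      (aestronglyMeasurable_symbolA ha) (aestronglyMeasurable_symbolA ha) (norm_symbolA_le ha)
      (norm_symbolA_le ha)
  have e := integral_re hint
  simp only [RCLike.re_to_complex] at e
  rw [formQ_eq ha hF hG hm, e]
  have : (1 / (2 * Real.pi) : ℂ) = ((1 / (2 * Real.pi) : ℝ) : ℂ) := by push_cast; rfl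
  rw [this, Complex.re_ofReal_mul]

lemma formQ_re_nonneg (hF : IsSpectralDensity F) (hG : IsSpectralDensity G)
    (hm : IsMinimal (F + G)) (ha : Summable fun j => ∑ k, ‖a j k‖)
    : 0 ≤ (formQ F G a).re := by
  rw [formQ_re_eq hF hG hm ha]
  refine mul_nonneg (by positivity) (integral_nonneg_of_ae ?_)
  filter_upwards [hF.1, hG.1, hm.1] with t h1 h2 h3
  exact form_parallel_nonneg h1 h2 h3 _

lemma meanSquareError_eq (hF : IsSpectralDensity F) (hG : IsSpectralDensity G)
    (hm : IsMinimal (F + G)) (ha : Summable fun j => ∑ k, ‖a j k‖)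
    {h : ℝ → Vec T} (hh : AEStronglyMeasurable h period) :
    meanSquareError a h F G =
      energy (F + G) (h - wiener a F G) + ENNReal.ofReal (formQ F G a).re := by
  have hint : Integrable (fun t => symbolA a t ⬝ᵥ
      ((F t * (F t + G t)⁻¹ * G t) *ᵥ star (symbolA a t))) period :=
    integrable_form (W := fun t => F t * (F t + G t)⁻¹ * G t) (integrable_parallel hF hG hm)
      (aestronglyMeasurable_symbolA ha) (aestronglyMeasurable_symbolA ha) (norm_symbolA_le ha)
      (norm_symbolA_le ha)
  have hw := memL2_wiener_symbolA ha hF hG hm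
  have e0 := ofReal_integral_eq_lintegral_ofReal hint.re (by
    filter_upwards [hF.1, hG.1, hm.1] with t h1 h2 h3
    exact form_parallel_nonneg h1 h2 h3 _)
  simp only [RCLike.re_to_complex] at e0
  rw [formQ_re_eq hF hG hm ha, ENNReal.ofReal_mul (by positivity), e0]
  unfold meanSquareError energy
  rw [← mul_add, ← mul_add, ← lintegral_add_left'
    (aemeasurable_form hF ((aestronglyMeasurable_symbolA ha).sub hh)), ← lintegral_add_left'
    (aemeasurable_form (hF.add hG) (hh.sub hw.1))]
  congr 1
  refine lintegral_congr_ae ?_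
  filter_upwards [hF.1, hG.1, hm.1] with t h1 h2 h3
  have e := congrArg Complex.re (form_completed_square h1 h2 h3 (symbolA a t) (h t))
  rw [Complex.add_re, Complex.add_re] at e
  rw [← ENNReal.ofReal_add (form_re_nonneg h1 _) (form_re_nonneg h2 _), ← ENNReal.ofReal_add]
  · exact congrArg ENNReal.ofReal e
  · exact form_re_nonneg (h1.add h2) _
  · exact form_parallel_nonneg h1 h2 h3 _

/-- The distance from h(F, G) to the Wiener filter is the norm of the projection, whose square is
⟨Ra, B⁻¹Ra⟩ up to normalization. So the extremal problem maximizes the optimal error. -/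
lemma meanSquareError_characteristic (hF : IsSpectralDensity F) (hG : IsSpectralDensity G)
    (hm : IsMinimal (F + G)) (ha : Summable fun j => ∑ k, ‖a j k‖)
    :
    meanSquareError a (characteristic S a F G) F G = ENNReal.ofReal (objective S a F G) := by
  have hc := memL2_characteristic (S := S) hF hG hm ha
  have hw := memL2_wiener_symbolA ha hF hG hm
  rw [meanSquareError_eq hF hG hm ha hc.1, energy_eq_norm (hF.add hG) (hc.sub (hF.add hG) hw),
    toH_sub (hF.add hG) hc hw, toH_characteristic hF hG hm ha, objective,
    formInvB_eq hF hG hm ha, sub_sub_cancel_left, norm_neg,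
    ENNReal.ofReal_add (by positivity) (formQ_re_nonneg hF hG hm ha)]

/-- The excess of the mean square error over its minimum. -/
lemma meanSquareError_eq_add (hF : IsSpectralDensity F) (hG : IsSpectralDensity G)
    (hm : IsMinimal (F + G)) (ha : Summable fun j => ∑ k, ‖a j k‖)
    (hS : S.Finite) {h : ℝ → Vec T} (hh : MemL2s S (F + G) h) :
    meanSquareError a h F G = meanSquareError a (characteristic S a F G) F G +
      energy (F + G) (h - characteristic S a F G) := by
  have hc := memL2_characteristic (S := S) hF hG hm ha
  have hw := memL2_wiener_symbolA ha hF hG hm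
  have hhY := ((memL2s_iff (hF.add hG)).1 hh).2
  have hcY := ((memL2s_iff (hF.add hG)).1 (memL2s_characteristic hF hG hm ha hS)).2
  rw [meanSquareError_eq hF hG hm ha hc.1, meanSquareError_eq hF hG hm ha hh.1.1,
    energy_eq_norm (hF.add hG) (hc.sub (hF.add hG) hw),
    energy_eq_norm (hF.add hG) (hh.1.sub (hF.add hG) hw),
    energy_eq_norm (hF.add hG) (hh.1.sub (hF.add hG) hc), add_right_comm]
  congr 1
  rw [← ENNReal.ofReal_add (by positivity) (by positivity), ← mul_add,
    toH_sub (hF.add hG) hc hw, toH_sub (hF.add hG) hh.1 hw, toH_sub (hF.add hG) hh.1 hc]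
  congr 2
  -- Pythagoras: the first difference lies in the span over U, the second in the observed space.
  have horth : inner ℂ (toH (F + G) (characteristic S a F G) - toH (F + G) (wiener a F G))
      (toH (F + G) h - toH (F + G) (characteristic S a F G)) = 0 := by
    have h1 : toH (F + G) (characteristic S a F G) - toH (F + G) (wiener a F G) =
        - invProj hF hG hm S a := by rw [toH_characteristic hF hG hm ha, sub_sub_cancel_left]
    rw [h1, inner_neg_left, neg_eq_zero]
    have h2 := sub_mem hhY hcY
    rw [← orthogonal_unkSpace hS (hF.add hG) hm] at h2
    exact h2 _ (Submodule.starProjection_apply_mem _ _)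
  have h3 := norm_add_sq_eq_norm_sq_add_norm_sq_of_inner_eq_zero _ _ horth
  rw [sub_add_sub_cancel' ] at h3
  simpa [sq] using h3

theorem isOptimal_characteristic (hF : IsSpectralDensity F) (hG : IsSpectralDensity G)
    (hm : IsMinimal (F + G)) (ha : Summable fun j => ∑ k, ‖a j k‖)
    (hS : S.Finite) : IsOptimal S a F G (characteristic S a F G) :=
  ⟨memL2s_characteristic hF hG hm ha hS, fun h hh => by
    rw [meanSquareError_eq_add hF hG hm ha hS hh]
    exact le_self_add⟩

lemma optimalError_eq (hF : IsSpectralDensity F) (hG : IsSpectralDensity G)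
    (hm : IsMinimal (F + G)) (ha : Summable fun j => ∑ k, ‖a j k‖)
    (hS : S.Finite) :
    optimalError S a F G = meanSquareError a (characteristic S a F G) F G :=
  le_antisymm (iInf₂_le _ (memL2s_characteristic hF hG hm ha hS))
    (le_iInf₂ (isOptimal_characteristic hF hG hm ha hS).2)

end Inverse

lemma energy_neg (W : Dens T) (f : ℝ → Vec T) : energy W (-f) = energy W f := by
  simp [energy, Matrix.mulVec_neg]

lemma trigPoly_neg (p : ℤ →₀ Vec T) : trigPoly (-p) = -trigPoly p := by
  have := trigPoly_smul (-1) p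
  simpa using this

lemma trigPoly_sub (p q : ℤ →₀ Vec T) : trigPoly (p - q) = trigPoly p - trigPoly q := by
  rw [sub_eq_add_neg, trigPoly_add, trigPoly_neg, sub_eq_add_neg]

/-! ### Linear combinations of the values of a stationary sequence -/

section Sequences

variable {Ω : Type u} {ζ : ℤ → Ω → Vec T}

/-- The finite combination `∑ p(n)ᵀ ζ(n)`. -/
def combination (ζ : ℤ → Ω → Vec T) (p : ℤ →₀ Vec T) (ω : Ω) : ℂ :=
  p.sum fun n v => v ⬝ᵥ ζ n ω

lemma combination_add (p q : ℤ →₀ Vec T) :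
    combination ζ (p + q) = combination ζ p + combination ζ q := by
  funext ω
  exact Finsupp.sum_add_index' (fun _ => zero_dotProduct _) fun _ _ _ => add_dotProduct _ _ _

lemma combination_smul (c : ℂ) (p : ℤ →₀ Vec T) :
    combination ζ (c • p) = c • combination ζ p := by
  funext ω
  simp only [combination, Pi.smul_apply]
  rw [Finsupp.sum_smul_index' (h := fun n v => v ⬝ᵥ ζ n ω) (fun _ => zero_dotProduct _),
    Finsupp.smul_sum]
  exact Finsupp.sum_congr fun n _ => smul_dotProduct _ _ _

lemma combination_unitSeq (n : ℤ) (k : Fin T) :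
    combination ζ (unitSeq n k) = fun ω => ζ n ω k := by
  funext ω
  simp [combination, unitSeq]

variable [MeasurableSpace Ω] {P : Measure Ω}

lemma memLp_combination (hζ : ∀ j k, MemLp (fun ω => ζ j ω k) 2 P) (p : ℤ →₀ Vec T) :
    MemLp (combination ζ p) 2 P := by
  unfold combination Finsupp.sum dotProduct
  exact memLp_finsetSum _ fun n _ => memLp_finsetSum _ fun k _ => (hζ n k).const_mul _

/-- The finite combinations `∑ p(n)ᵀ ζ(n)` as elements of `L₂(Ω)`. -/
def combinationMap (hζ : ∀ j k, MemLp (fun ω => ζ j ω k) 2 P) :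
    (ℤ →₀ Vec T) →ₗ[ℂ] Lp ℂ 2 P where
  toFun p := (memLp_combination hζ p).toLp (combination ζ p)
  map_add' p q := by
    rw [← MemLp.toLp_add]
    simp only [combination_add]
  map_smul' c p := by
    rw [RingHom.id_apply, ← MemLp.toLp_const_smul]
    simp only [combination_smul]

lemma inner_combinationMap_unitSeq {ζ' : ℤ → Ω → Vec T}
    (hζ : ∀ j k, MemLp (fun ω => ζ j ω k) 2 P) (hζ' : ∀ j k, MemLp (fun ω => ζ' j ω k) 2 P)
    (n m : ℤ) (l k : Fin T) :
    inner ℂ (combinationMap hζ (unitSeq n l)) (combinationMap hζ' (unitSeq m k)) =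
      ∫ ω, ζ' m ω k * star (ζ n ω l) ∂P := by
  rw [MeasureTheory.L2.inner_def]
  refine integral_congr_ae ?_
  filter_upwards [(memLp_combination hζ (unitSeq n l)).coeFn_toLp,
    (memLp_combination hζ' (unitSeq m k)).coeFn_toLp] with ω h1 h2
  simp only [combinationMap, LinearMap.coe_mk, AddHom.coe_mk]
  rw [h1, h2, combination_unitSeq, combination_unitSeq]
  simp [RCLike.inner_apply]

/-- Proportional Gram matrices on unit sequences give proportional inner products throughout. -/
lemma inner_linearMap_eq {H K : Type*} [NormedAddCommGroup H] [InnerProductSpace ℂ H]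
    [NormedAddCommGroup K] [InnerProductSpace ℂ K]
    (L L' : (ℤ →₀ Vec T) →ₗ[ℂ] H) (M M' : (ℤ →₀ Vec T) →ₗ[ℂ] K) (c : ℝ)
    (h : ∀ n l m k, inner ℂ (L (unitSeq n l)) (L' (unitSeq m k)) =
      (c : ℂ) * inner ℂ (M (unitSeq n l)) (M' (unitSeq m k))) (p q : ℤ →₀ Vec T) :
    inner ℂ (L p) (L' q) = (c : ℂ) * inner ℂ (M p) (M' q) := by
  have h1 : ∀ n l, inner ℂ (L (unitSeq n l)) (L' q) =
      (c : ℂ) * inner ℂ (M (unitSeq n l)) (M' q) := fun n l => by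
    rw [← inner_conj_symm, ← inner_conj_symm (M _), inner_linearMap, inner_linearMap M',
      Finsupp.sum, Finsupp.sum, map_sum, map_sum, Finset.mul_sum]
    refine Finset.sum_congr rfl fun m _ => ?_
    rw [map_sum, map_sum, Finset.mul_sum]
    refine Finset.sum_congr rfl fun k _ => ?_
    rw [map_mul, map_mul, inner_conj_symm, inner_conj_symm, h]
    ring
  rw [inner_linearMap, inner_linearMap M, Finsupp.sum, Finsupp.sum, Finset.mul_sum]
  refine Finset.sum_congr rfl fun n _ => ?_
  rw [Finset.mul_sum]
  refine Finset.sum_congr rfl fun l _ => ?_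
  rw [h1]
  ring

/-- The spectral isometry on finite combinations: the correlations of the sequence and the inner
products of the characters in L₂(F) agree up to the factor 1/2π. -/
lemma norm_combinationMap_sq {F : Dens T} (hF : IsSpectralDensity F)
    (hζ : ∀ j k, MemLp (fun ω => ζ j ω k) 2 P)
    (hcorr : ∀ (j n : ℤ) k l, ∫ ω, ζ (j + n) ω k * star (ζ j ω l) ∂P =
      (1 / (2 * Real.pi) : ℂ) * ∫ t, character n t * F t k l ∂period) (p : ℤ →₀ Vec T) :
    ENNReal.ofReal (‖combinationMap hζ p‖ ^ 2) = energy F (trigPoly p) := by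
  have h := inner_linearMap_eq (combinationMap hζ) (combinationMap hζ) (polyMap hF) (polyMap hF)
    (1 / (2 * Real.pi)) (fun n l m k => ?_) p p
  · rw [inner_self_eq_norm_sq_to_K, inner_self_eq_norm_sq_to_K] at h
    have h' : ‖combinationMap hζ p‖ ^ 2 = 1 / (2 * Real.pi) * ‖polyMap hF p‖ ^ 2 := by
      have h2 : ((‖combinationMap hζ p‖ ^ 2 : ℝ) : ℂ) =
          ((1 / (2 * Real.pi) * ‖polyMap hF p‖ ^ 2 : ℝ) : ℂ) := by
        rw [Complex.ofReal_mul, Complex.ofReal_pow, Complex.ofReal_pow]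
        exact h
      exact Complex.ofReal_injective h2
    rw [h', energy_eq_norm hF (memL2_trigPoly hF p)]
    rfl
  · have e := inner_polyMap_unitSeq hF (memL2_trigPoly hF (unitSeq m k)) n l
    refine (inner_combinationMap_unitSeq hζ hζ n m l k).trans ?_
    have e2 := hcorr n (m - n) k l
    rw [add_sub_cancel] at e2
    rw [e2]
    push_cast
    congr 1
    refine Eq.trans ?_ e.symm
    congr 1
    funext t
    rw [unitSeq, trigPoly_single, Matrix.smul_vecMul, sub_eq_add_neg, character_add]
    simp [Matrix.single_vecMul]
    ring

lemma lintegral_enorm_sq {f : Ω → ℂ} (hf : MemLp f 2 P) :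
    ∫⁻ ω, ‖f ω‖ₑ ^ 2 ∂P = ENNReal.ofReal (‖hf.toLp f‖ ^ 2) := by
  rw [← eLpNorm_two_sq, Lp.norm_toLp, ENNReal.ofReal_pow ENNReal.toReal_nonneg,
    ENNReal.ofReal_toReal hf.2.ne]

end Sequences

/-! ### Linear estimates and their mean square errors -/

section Estimates

variable {Ω : Type u} [MeasurableSpace Ω] {P : Measure Ω} {ξ η : ℤ → Ω → Vec T} {F G : Dens T}
  {S : Set ℤ} {a : ℤ → Vec T}

/-- Two separate polynomials are needed because the functional to be estimated involves the signal
only, so the error has different signal and noise symbols. -/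
lemma IsUncorrelatedPair.norm_add_sq (h : IsUncorrelatedPair P ξ η F G)
    (hF : IsSpectralDensity F) (hG : IsSpectralDensity G) (p q : ℤ →₀ Vec T) :
    ENNReal.ofReal (‖combinationMap h.memLp_signal p + combinationMap h.memLp_noise q‖ ^ 2) =
      energy F (trigPoly p) + energy G (trigPoly q) := by
  have h0 : inner ℂ (combinationMap h.memLp_noise q) (combinationMap h.memLp_signal p) = 0 := by
    -- With the factor 0 the comparison of Gram matrices is a statement of orthogonality.
    have e := inner_linearMap_eq (combinationMap h.memLp_noise) (combinationMap h.memLp_signal)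
      (combinationMap h.memLp_noise) (combinationMap h.memLp_signal) 0 (fun n l m k => ?_) q p
    · simpa using e
    · rw [inner_combinationMap_unitSeq, h.uncorrelated]
      simp
  have h1 := norm_add_sq_eq_norm_sq_add_norm_sq_of_inner_eq_zero _ _ h0
  rw [add_comm (combinationMap h.memLp_noise q)] at h1
  rw [sq, h1, add_comm, ← sq, ← sq, ENNReal.ofReal_add (sq_nonneg _) (sq_nonneg _),
    norm_combinationMap_sq hF _ h.corr_signal, norm_combinationMap_sq hG _ h.corr_noise]

lemma IsUncorrelatedPair.lintegral_sub (h : IsUncorrelatedPair P ξ η F G) {Y : Ω → ℂ}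
    (hY : MemLp Y 2 P) (p : ℤ →₀ Vec T) :
    ∫⁻ ω, ‖Y ω - p.sum fun n v => v ⬝ᵥ (ξ n ω + η n ω)‖ₑ ^ 2 ∂P =
      ENNReal.ofReal (‖hY.toLp Y - (combinationMap h.memLp_signal p +
        combinationMap h.memLp_noise p)‖ ^ 2) := by
  have e : (fun ω => Y ω - p.sum fun n v => v ⬝ᵥ (ξ n ω + η n ω)) =
      Y - (combination ξ p + combination η p) := by
    funext ω
    simp only [combination, Pi.sub_apply, Pi.add_apply, dotProduct_add, Finsupp.sum_add]
  have hs := (memLp_combination h.memLp_signal p).add (memLp_combination h.memLp_noise p)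
  rw [lintegral_enorm_sq (f := fun ω => Y ω - p.sum fun n v => v ⬝ᵥ (ξ n ω + η n ω))
    (e ▸ hY.sub hs)]
  simp only [e]
  rw [MemLp.toLp_sub hY hs, MemLp.toLp_add (memLp_combination h.memLp_signal p)
    (memLp_combination h.memLp_noise p)]
  rfl

/-- Polynomials converging to x in L₂(F + G) are sent by the isometry to a Cauchy sequence of random
variables, whose limit is the estimate. -/
lemma exists_isEstimate (h : IsUncorrelatedPair P ξ η F G)
    (hF : IsSpectralDensity F) (hG : IsSpectralDensity G) {x : ℝ → Vec T}
    (hx : MemL2s S (F + G) x) : ∃ Y, IsEstimate P S ξ η F G x Y := by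
  have hpos : ∀ m : ℕ, 0 < ENNReal.ofReal (1 / ((m : ℝ) + 1)) := fun m =>
    ENNReal.ofReal_pos.2 Nat.one_div_pos_of_nat
  choose p hp hpx using fun m : ℕ => hx.2 _ (hpos m)
  have hlim : Tendsto (fun m => energy (F + G) (x - trigPoly (p m))) atTop (𝓝 0) := by
    refine tendsto_of_tendsto_of_tendsto_of_le_of_le tendsto_const_nhds ?_
      (fun _ => zero_le) fun m => (hpx m).le
    simpa using ENNReal.tendsto_ofReal (tendsto_one_div_add_atTop_nhds_zero_nat (𝕜 := ℝ))
  set u : ℕ → Lp ℂ 2 P := fun m =>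
    combinationMap h.memLp_signal (p m) + combinationMap h.memLp_noise (p m) with hu
  have hcau : CauchySeq u := by
    refine Metric.cauchySeq_iff.2 fun ε hε => ?_
    have hev := hlim.eventually_lt_const
      (show (0 : ℝ≥0∞) < ENNReal.ofReal (ε ^ 2 / 4) by rw [ENNReal.ofReal_pos]; positivity)
    obtain ⟨N, hN⟩ := eventually_atTop.1 hev
    refine ⟨N, fun m hm n hn => ?_⟩
    have e1 : u m - u n = combinationMap h.memLp_signal (p m - p n) +
        combinationMap h.memLp_noise (p m - p n) := by
      simp only [hu, map_sub]
      abel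
    have e2 : trigPoly (p m - p n) = (x - trigPoly (p n)) + -(x - trigPoly (p m)) := by
      rw [trigPoly_sub]
      abel
    have hms : ∀ m, AEStronglyMeasurable (x - trigPoly (p m)) period := fun m =>
      hx.1.1.sub (continuous_trigPoly _).aestronglyMeasurable
    have h1 : ENNReal.ofReal (‖u m - u n‖ ^ 2) < ENNReal.ofReal (ε ^ 2) := by
      rw [e1, h.norm_add_sq hF hG,
        ← energy_add_density hF hG (continuous_trigPoly _).aestronglyMeasurable, e2]
      refine (energy_add_le (hF.add hG) (hms n) (hms m).neg).trans_lt ?_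
      rw [energy_neg]
      calc 2 * (energy (F + G) (x - trigPoly (p n)) + energy (F + G) (x - trigPoly (p m)))
          < 2 * (ENNReal.ofReal (ε ^ 2 / 4) + ENNReal.ofReal (ε ^ 2 / 4)) :=
            (ENNReal.mul_lt_mul_iff_right two_ne_zero ENNReal.ofNat_ne_top).2
              (ENNReal.add_lt_add (hN n hn) (hN m hm))
        _ = ENNReal.ofReal (ε ^ 2) := by
            rw [← ENNReal.ofReal_add (by positivity) (by positivity), ← ENNReal.ofReal_ofNat 2,
              ← ENNReal.ofReal_mul (by norm_num)]
            congr 1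
            ring
    rw [dist_eq_norm]
    exact lt_of_pow_lt_pow_left₀ 2 hε.le ((ENNReal.ofReal_lt_ofReal_iff (by positivity)).1 h1)
  obtain ⟨Y, hY⟩ := cauchySeq_tendsto_of_complete hcau
  refine ⟨Y, Lp.memLp Y, p, hp, hlim, ?_⟩
  simp only [h.lintegral_sub (Lp.memLp Y), Lp.toLp_coeFn]
  have h1 : Tendsto (fun m => ‖Y - u m‖ ^ 2) atTop (𝓝 0) := by
    have := ((tendsto_const_nhds (x := Y)).sub hY).norm.pow 2
    simpa using this
  simpa using ENNReal.tendsto_ofReal h1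

/-- The functional `Aξ` is the mean square sum of its series. -/
lemma exists_hasSum_functionalA [IsProbabilityMeasure P] (h : IsUncorrelatedPair P ξ η F G)
    (ha : Summable fun j => ∑ k, ‖a j k‖) :
    ∃ hA : MemLp (functionalA a ξ) 2 P,
      HasSum (fun j => combinationMap h.memLp_signal (Finsupp.single (-j) (a j)))
        (hA.toLp (functionalA a ξ)) := by
  set X : ℤ → Lp ℂ 2 P := fun j => combinationMap h.memLp_signal (Finsupp.single (-j) (a j))
    with hX
  have hXcoe : ∀ j, X j =ᵐ[P] fun ω => a j ⬝ᵥ ξ (-j) ω := fun j => by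
    refine (memLp_combination h.memLp_signal (Finsupp.single (-j) (a j))).coeFn_toLp.trans
      (ae_of_all _ fun ω => ?_)
    simp [combination]
  -- Stationarity: the variances do not depend on the time, so summability of a makes the series
  -- converge absolutely in L₂(Ω).
  have hnorm : ∀ n k, ‖combinationMap h.memLp_signal (unitSeq n k)‖ =
      ‖combinationMap h.memLp_signal (unitSeq 0 k)‖ := fun n k => by
    have e : ∀ m, ((‖combinationMap h.memLp_signal (unitSeq m k)‖ : ℂ)) ^ 2 =
        (1 / (2 * Real.pi) : ℂ) * ∫ t, character 0 t * F t k k ∂period := fun m => by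
      have e1 := inner_combinationMap_unitSeq h.memLp_signal h.memLp_signal m m k k
      have e2 := h.corr_signal m 0 k k
      rw [add_zero] at e2
      rw [e2, inner_self_eq_norm_sq_to_K] at e1
      exact e1
    have e3 := (e n).trans (e 0).symm
    have e4 : ‖combinationMap h.memLp_signal (unitSeq n k)‖ ^ 2 =
      ‖combinationMap h.memLp_signal (unitSeq 0 k)‖ ^ 2 := by exact_mod_cast e3
    exact (sq_eq_sq₀ (norm_nonneg _) (norm_nonneg _)).1 e4
  set c : ℝ := ∑ k, ‖combinationMap h.memLp_signal (unitSeq 0 k)‖ with hc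
  have hXnorm : ∀ j, ‖X j‖ ≤ ‖a j‖ * c := fun j => by
    have e : Finsupp.single (-j) (a j) = ∑ l, a j l • unitSeq (-j) l := by
      simp only [unitSeq, Finsupp.smul_single]
      rw [← Finsupp.single_finsetSum]
      congr 1
      ext i
      simp [Finset.sum_apply, Pi.single_apply]
    rw [hX]
    simp only
    rw [e, map_sum, hc, Finset.mul_sum]
    refine (norm_sum_le _ _).trans (Finset.sum_le_sum fun l _ => ?_)
    rw [map_smul, norm_smul, hnorm]
    gcongr
    exact norm_le_pi_norm _ _
  have hXs : Summable fun j => ‖X j‖ :=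
    ((summable_norm ha).mul_right c).of_nonneg_of_le (fun _ => norm_nonneg _) hXnorm
  obtain ⟨s, hs⟩ := exists_seq_tendsto (atTop : Filter (Finset ℤ))
  have hlim : Tendsto (fun m => ∑ j ∈ s m, X j) atTop (𝓝 (∑' j, X j)) :=
    hXs.of_norm.hasSum.comp hs
  obtain ⟨φ, hφ, hae⟩ := (tendstoInMeasure_of_tendsto_Lp hlim).exists_seq_tendsto_ae
  -- The functional is a pointwise series, so convergence almost surely is needed too. On a
  -- probability space the L₁ norms are at most the L₂ norms, hence the sum of the moduli has finite
  -- expectation.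
  have hpt : ∀ᵐ ω ∂P, Summable fun j => a j ⬝ᵥ ξ (-j) ω := by
    have hfin : ∫⁻ ω, ∑' j, ‖X j ω‖ₑ ∂P ≠ ∞ := by
      rw [lintegral_tsum fun j => (Lp.aestronglyMeasurable _).enorm]
      refine ne_top_of_le_ne_top hXs.tsum_ofReal_ne_top (ENNReal.tsum_le_tsum fun j => ?_)
      rw [← eLpNorm_one_eq_lintegral_enorm]
      refine (eLpNorm_le_eLpNorm_of_exponent_le (q := 2) (by norm_num)
        (Lp.aestronglyMeasurable _)).trans_eq ?_
      rw [Lp.norm_def, ENNReal.ofReal_toReal (Lp.eLpNorm_ne_top _)]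
    have hmeas : AEMeasurable (fun ω => ∑' j, ‖X j ω‖ₑ) P :=
      AEMeasurable.tsum fun j => (Lp.aestronglyMeasurable _).enorm
    filter_upwards [ae_lt_top' hmeas hfin, ae_all_iff.2 hXcoe] with ω h1 h2
    simp only [← h2]
    refine Summable.of_norm ?_
    have := ENNReal.summable_toReal h1.ne
    simpa using this
  -- The two limits of the same partial sums agree along a subsequence that converges almost surely.
  have hA : functionalA a ξ =ᵐ[P] (∑' j, X j : Lp ℂ 2 P) := by
    have hco : ∀ᵐ ω ∂P, ∀ m, (∑ j ∈ s m, X j : Lp ℂ 2 P) ω = ∑ j ∈ s m, X j ω :=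
      ae_all_iff.2 fun m => by
        filter_upwards [Lp.coeFn_finsetSum (s m) X] with ω h1
        rw [h1, Finset.sum_apply]
    filter_upwards [hpt, hae, hco, ae_all_iff.2 hXcoe] with ω h1 h2 h3 h4
    refine tendsto_nhds_unique ((h1.hasSum.comp hs).comp hφ.tendsto_atTop) (h2.congr fun m => ?_)
    rw [h3]
    simp only [Function.comp_apply, h4]
  have hmem : MemLp (functionalA a ξ) 2 P := (Lp.memLp (∑' j, X j : Lp ℂ 2 P)).ae_eq hA.symm
  refine ⟨hmem, ?_⟩
  have : hmem.toLp (functionalA a ξ) = ∑' j, X j := by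
    rw [← Lp.toLp_coeFn (∑' j, X j : Lp ℂ 2 P) (Lp.memLp _)]
    exact MemLp.toLp_congr _ _ hA
  rw [this]
  exact hXs.of_norm.hasSum

/-- Partial sums of A converge pointwise and are bounded by the sum of the norms of a, so dominated
convergence applies with a multiple of the entries of F. -/
lemma tendsto_energy_symbolA_sub (hF : IsSpectralDensity F) (ha : Summable fun j => ∑ k, ‖a j k‖)
    {s : ℕ → Finset ℤ} (hs : Tendsto s atTop atTop) :
    Tendsto (fun m => energy F (symbolA a - trigPoly (∑ j ∈ s m, Finsupp.single (-j) (a j))))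
      atTop (𝓝 0) := by
  have hq : ∀ m, trigPoly (∑ j ∈ s m, Finsupp.single (-j) (a j)) =
      fun t => ∑ j ∈ s m, character (-j) t • a j := fun m => by
    induction s m using Finset.cons_induction with
    | empty => funext t; simp [trigPoly]
    | cons j r hj ih =>
      rw [Finset.sum_cons, trigPoly_add, ih]
      funext t
      rw [Finset.sum_cons, Pi.add_apply, trigPoly_single]
  set c : ℝ := ∑' j, ‖a j‖ with hc
  have hbound : ∀ m t k, ‖(symbolA a - trigPoly (∑ j ∈ s m, Finsupp.single (-j) (a j))) t k‖ ≤
      2 * c := fun m t k => by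
    refine (norm_le_pi_norm _ k).trans ?_
    rw [Pi.sub_apply, two_mul, hq]
    refine (norm_sub_le _ _).trans (add_le_add (norm_symbolA_le ha t) ?_)
    refine (norm_sum_le _ _).trans ?_
    simp only [norm_character_smul]
    exact (summable_norm ha).sum_le_tsum _ fun _ _ => norm_nonneg _
  have hc0 : 0 ≤ c := tsum_nonneg fun _ => norm_nonneg _
  unfold energy
  rw [← mul_zero (ENNReal.ofReal (1 / (2 * Real.pi)))]
  refine ENNReal.Tendsto.const_mul ?_ (Or.inr ENNReal.ofReal_ne_top)
  rw [← lintegral_zero (μ := period)]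
  have hFi : Integrable (fun t => ∑ k, 2 * c * ∑ l, ‖F t k l‖ * (2 * c)) period :=
    integrable_finsetSum _ fun k _ => (integrable_finsetSum _ fun l _ =>
      (hF.2 k l).norm.mul_const _).const_mul _
  refine tendsto_lintegral_of_dominated_convergence'
    (fun t => ENNReal.ofReal (∑ k, 2 * c * ∑ l, ‖F t k l‖ * (2 * c)))
    (fun m => aemeasurable_form hF ((aestronglyMeasurable_symbolA ha).sub
      (continuous_trigPoly _).aestronglyMeasurable)) (fun m => ae_of_all _ fun t => ?_)
    hFi.lintegral_lt_top.ne (ae_of_all _ fun t => ?_)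
  · refine ENNReal.ofReal_le_ofReal ((Complex.re_le_norm _).trans ?_)
    simp only [dotProduct, Matrix.mulVec]
    refine (norm_sum_le _ _).trans (Finset.sum_le_sum fun k _ => ?_)
    rw [norm_mul]
    refine mul_le_mul (hbound m t k) ?_ (norm_nonneg _) (by positivity)
    refine (norm_sum_le _ _).trans (Finset.sum_le_sum fun l _ => ?_)
    rw [norm_mul, Pi.star_apply, norm_star]
    exact mul_le_mul_of_nonneg_left (hbound m t l) (norm_nonneg _)
  · have h1 : Tendsto (fun m => (symbolA a - trigPoly (∑ j ∈ s m, Finsupp.single (-j) (a j))) t)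
        atTop (𝓝 0) := by
      have h2 : Tendsto (fun m => symbolA a t - ∑ j ∈ s m, character (-j) t • a j) atTop
          (𝓝 (symbolA a t - symbolA a t)) :=
        tendsto_const_nhds.sub ((summable_symbolA ha t).hasSum.comp hs)
      rw [sub_self] at h2
      refine h2.congr fun m => ?_
      rw [Pi.sub_apply, hq]
    have hcont : Continuous fun v : Vec T => ENNReal.ofReal (v ⬝ᵥ (F t *ᵥ star v)).re := by
      refine ENNReal.continuous_ofReal.comp (Complex.continuous_re.comp ?_)
      exact Continuous.dotProduct continuous_id
        (Continuous.matrix_mulVec continuous_const continuous_star)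
    have h3 := (hcont.tendsto 0).comp h1
    rw [zero_dotProduct, Complex.zero_re, ENNReal.ofReal_zero] at h3
    exact h3

/-- The error formula for linear estimates. -/
theorem errorFormula (hF : IsSpectralDensity F) (hG : IsSpectralDensity G)
    (ha : Summable fun j => ∑ k, ‖a j k‖) : ErrorFormula.{u} S a F G := by
  intro Ω _ P _ ξ η h x hx
  refine ⟨exists_isEstimate h hF hG hx, ?_⟩
  rintro Y ⟨hY, p, hp, hpx, hpY⟩
  obtain ⟨hA, hsum⟩ := exists_hasSum_functionalA h ha
  obtain ⟨s, hs⟩ := exists_seq_tendsto (atTop : Filter (Finset ℤ))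
  set q : ℕ → ℤ →₀ Vec T := fun m => ∑ j ∈ s m, Finsupp.single (-j) (a j) with hq
  have hxm := hx.1.1
  have hpm : ∀ m, AEStronglyMeasurable (trigPoly (p m)) period := fun m =>
    (continuous_trigPoly _).aestronglyMeasurable
  have hqm : ∀ m, AEStronglyMeasurable (trigPoly (q m)) period := fun m =>
    (continuous_trigPoly _).aestronglyMeasurable
  have hAm := aestronglyMeasurable_symbolA (T := T) ha
  have hqA : Tendsto (fun m => combinationMap h.memLp_signal (q m)) atTop
      (𝓝 (hA.toLp (functionalA a ξ))) :=
    (hsum.comp hs).congr fun m => by simp only [hq, map_sum, Function.comp_apply]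
  have hu : Tendsto (fun m => combinationMap h.memLp_signal (p m) +
      combinationMap h.memLp_noise (p m)) atTop (𝓝 (hY.toLp Y)) := by
    simp only [h.lintegral_sub hY] at hpY
    rw [← ENNReal.ofReal_zero] at hpY
    have h1 := (ENNReal.tendsto_toReal ENNReal.ofReal_ne_top).comp hpY
    simp only [Function.comp_def, ENNReal.toReal_ofReal (sq_nonneg _), le_refl,
      ENNReal.toReal_ofReal] at h1
    have h2 : Tendsto (fun m => ‖hY.toLp Y - (combinationMap h.memLp_signal (p m) +
        combinationMap h.memLp_noise (p m))‖) atTop (𝓝 0) := by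
      have h3 := (Real.continuous_sqrt.tendsto 0).comp h1
      simpa [Function.comp_def, Real.sqrt_sq (norm_nonneg _)] using h3
    rw [tendsto_iff_norm_sub_tendsto_zero]
    simpa only [norm_sub_rev] using h2
  have hle1 : ∀ f : ℝ → Vec T, AEStronglyMeasurable f period →
      energy F f ≤ energy (F + G) f := fun f hf => by
    rw [energy_add_density hF hG hf]; exact le_self_add
  have hle2 : ∀ f : ℝ → Vec T, AEStronglyMeasurable f period →
      energy G f ≤ energy (F + G) f := fun f hf => by
    rw [energy_add_density hF hG hf]; exact le_add_self
  have hlimG : Tendsto (fun m => energy G (trigPoly (p m))) atTop (𝓝 (energy G x)) :=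
    tendsto_energy_of_sub hG hpm hxm (tendsto_of_tendsto_of_tendsto_of_le_of_le
      tendsto_const_nhds hpx (fun _ => zero_le) fun m => hle2 _ (hxm.sub (hpm m)))
  have hlimF : Tendsto (fun m => energy F (trigPoly (q m - p m))) atTop
      (𝓝 (energy F (symbolA a - x))) := by
    refine tendsto_energy_of_sub hF (fun m => (continuous_trigPoly _).aestronglyMeasurable)
      (hAm.sub hxm) ?_
    have hb : Tendsto (fun m => 2 * (energy F (symbolA a - trigPoly (q m)) +
        energy (F + G) (x - trigPoly (p m)))) atTop (𝓝 0) := by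
      have := ENNReal.Tendsto.const_mul (a := 2)
        ((tendsto_energy_symbolA_sub hF ha hs).add hpx) (Or.inr ENNReal.ofNat_ne_top)
      simpa using this
    refine tendsto_of_tendsto_of_tendsto_of_le_of_le tendsto_const_nhds hb
      (fun _ => zero_le) fun m => ?_
    have e : symbolA a - x - trigPoly (q m - p m) =
        (symbolA a - trigPoly (q m)) + -(x - trigPoly (p m)) := by
      rw [trigPoly_sub]; abel
    simp only [e]
    refine (energy_add_le hF (hAm.sub (hqm m)) (hxm.sub (hpm m)).neg).trans ?_
    rw [energy_neg]
    gcongr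
    exact hle1 _ (hxm.sub (hpm m))
  have hlim1 : Tendsto (fun m => ENNReal.ofReal (‖combinationMap h.memLp_signal (q m) -
      (combinationMap h.memLp_signal (p m) + combinationMap h.memLp_noise (p m))‖ ^ 2)) atTop
      (𝓝 (ENNReal.ofReal (‖hA.toLp (functionalA a ξ) - hY.toLp Y‖ ^ 2))) :=
    ENNReal.tendsto_ofReal ((hqA.sub hu).norm.pow 2)
  have hlim2 := hlimF.add hlimG
  have e1 : ∫⁻ ω, ‖functionalA a ξ ω - Y ω‖ₑ ^ 2 ∂P =
      ENNReal.ofReal (‖hA.toLp (functionalA a ξ) - hY.toLp Y‖ ^ 2) := by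
    rw [← MemLp.toLp_sub]
    exact lintegral_enorm_sq (hA.sub hY)
  rw [e1]
  refine tendsto_nhds_unique hlim1 (hlim2.congr fun m => ?_)
  -- The error of the approximating estimate has signal symbol q - p and noise symbol -p, which
  -- produces the two terms of Δ.
  have e2 : combinationMap h.memLp_signal (q m) - (combinationMap h.memLp_signal (p m) +
      combinationMap h.memLp_noise (p m)) = combinationMap h.memLp_signal (q m - p m) +
      combinationMap h.memLp_noise (-p m) := by
    rw [map_sub, map_neg]; abel
  rw [e2, h.norm_add_sq hF hG, trigPoly_neg, energy_neg]

end Estimates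

/-! ### Minimality of sums -/

lemma isUnit_det_add {A C : Matrix (Fin T) (Fin T) ℂ} (hA : A.PosSemidef) (hC : C.PosSemidef)
    (hu : IsUnit A.det) : IsUnit (A + C).det := by
  have h1 : A.PosDef := hA.posDef_iff_isUnit.2 ((Matrix.isUnit_iff_isUnit_det A).2 hu)
  exact (Matrix.isUnit_iff_isUnit_det _).1 (h1.add_posSemidef hC).isUnit

/-- The inequality (A + C)⁻¹ ≤ A⁻¹, obtained from `form_wiener_le` at v = xᵀ A⁻¹, for which vᵀ A (A
+ C)⁻¹ = xᵀ (A + C)⁻¹. -/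
lemma form_inv_add_le {A C : Matrix (Fin T) (Fin T) ℂ} (hA : A.PosSemidef) (hC : C.PosSemidef)
    (hu : IsUnit A.det) (x : Vec T) :
    ((x ᵥ* (A + C)⁻¹) ⬝ᵥ ((A + C) *ᵥ star (x ᵥ* (A + C)⁻¹))).re ≤
      ((x ᵥ* A⁻¹) ⬝ᵥ (A *ᵥ star (x ᵥ* A⁻¹))).re := by
  have h := form_wiener_le hA hC (isUnit_det_add hA hC hu) (x ᵥ* A⁻¹)
  rwa [Matrix.vecMul_vecMul x, ← Matrix.mul_assoc, Matrix.nonsing_inv_mul _ hu,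
    Matrix.one_mul] at h

lemma IsMinimal.add_right {V W : Dens T} (hm : IsMinimal V) (hV : IsSpectralDensity V)
    (hW : IsSpectralDensity W) : IsMinimal (V + W) := by
  have hdet : ∀ᵐ t ∂period, IsUnit ((V + W) t).det := by
    filter_upwards [hV.1, hW.1, hm.1] with t h1 h2 h3
    exact isUnit_det_add h1 h2 h3
  refine ⟨hdet, fun k l => ?_⟩
  -- The rows of the inverse lie in L₂(V + W), and the entries of the inverse are the pointwise
  -- forms of two rows.
  have hk : ∀ k : Fin T, MemL2 (V + W) (fun t => (Pi.single k 1 : Vec T) ᵥ* ((V + W) t)⁻¹) :=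
    fun k => by
    refine ⟨aestronglyMeasurable_vecMul aestronglyMeasurable_const
      (aestronglyMeasurable_inv (hV.add hW).aestronglyMeasurable), lt_of_le_of_lt ?_
      (memL2_dual_of_bounded hV hm (x := fun _ => Pi.single k 1) aestronglyMeasurable_const
        fun _ => le_rfl).2⟩
    unfold energy
    gcongr ENNReal.ofReal (1 / (2 * Real.pi)) * ?_
    refine lintegral_mono_ae ?_
    filter_upwards [hV.1, hW.1, hm.1] with t h1 h2 h3
    exact ENNReal.ofReal_le_ofReal (form_inv_add_le h1 h2 h3 _)
  refine (integrable_inner (hV.add hW) (hk k) (hk l)).congr ?_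
  filter_upwards [(hV.add hW).1, hdet] with t h1 h2
  rw [form_dual h1 h2]
  simp [Matrix.single_vecMul, Pi.star_single, Matrix.row]

lemma IsMinimal.smul {W : Dens T} (hm : IsMinimal W) {c : ℝ} (hc : c ≠ 0) :
    IsMinimal ((c : ℂ) • W) := by
  have hc' : (c : ℂ) ≠ 0 := by exact_mod_cast hc
  constructor
  · filter_upwards [hm.1] with t ht
    rw [Pi.smul_apply, Matrix.det_smul]
    exact (IsUnit.mk0 _ (pow_ne_zero _ hc')).mul ht
  · intro k l
    refine ((hm.2 k l).const_mul (c : ℂ)⁻¹).congr ?_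
    filter_upwards [hm.1] with t ht
    let := invertibleOfNonzero hc'
    change _ = ((c : ℂ) • W t)⁻¹ k l
    rw [Matrix.inv_smul (W t) (c : ℂ) ht, Matrix.smul_apply, invOf_eq_inv, smul_eq_mul]

/-! ### Convex combinations of densities -/

/-- The density `(1 - c) V + c W`. -/
def mix (c : ℝ) (V W : Dens T) : Dens T := ((1 - c : ℝ) : ℂ) • V + (c : ℂ) • W

lemma add_mix (c : ℝ) (F V W : Dens T) : F + mix c V W = mix c (F + V) (F + W) := by
  unfold mix
  push_cast
  module

lemma mix_one_sub (c : ℝ) (V W : Dens T) : mix (1 - c) V W = mix c W V := by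
  unfold mix
  rw [sub_sub_cancel, add_comm]

section Mix

variable {V W F G G' : Dens T} {S : Set ℤ} {a : ℤ → Vec T} {c : ℝ}

lemma IsSpectralDensity.mix (hV : IsSpectralDensity V) (hW : IsSpectralDensity W) (h0 : 0 ≤ c)
    (h1 : c ≤ 1) : IsSpectralDensity (mix c V W) :=
  (hV.smul (sub_nonneg.2 h1)).add (hW.smul h0)

lemma IsMinimal.mix_left (hm : IsMinimal V) (hV : IsSpectralDensity V)
    (hW : IsSpectralDensity W) (h0 : 0 ≤ c) (h1 : c < 1) : IsMinimal (mix c V W) :=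
  (hm.smul (sub_pos.2 h1).ne').add_right (hV.smul (sub_nonneg.2 h1.le)) (hW.smul h0)

lemma energy_mix (hV : IsSpectralDensity V) (hW : IsSpectralDensity W) (h0 : 0 ≤ c)
    (h1 : c ≤ 1) {h : ℝ → Vec T} (hh : AEStronglyMeasurable h period) :
    energy (mix c V W) h =
      ENNReal.ofReal (1 - c) * energy V h + ENNReal.ofReal c * energy W h := by
  rw [mix, energy_add_density (hV.smul (sub_nonneg.2 h1)) (hW.smul h0) hh,
    energy_smul_density _ (sub_nonneg.2 h1), energy_smul_density _ h0]

lemma meanSquareError_mix (hG : IsSpectralDensity G) (hG' : IsSpectralDensity G') (h0 : 0 ≤ c)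
    (h1 : c ≤ 1) {h : ℝ → Vec T} (hh : AEStronglyMeasurable h period) :
    meanSquareError a h F (mix c G G') = ENNReal.ofReal (1 - c) * meanSquareError a h F G +
      ENNReal.ofReal c * meanSquareError a h F G' := by
  unfold meanSquareError
  rw [energy_mix hG hG' h0 h1 hh]
  have e : ENNReal.ofReal (1 - c) + ENNReal.ofReal c = 1 := by
    rw [← ENNReal.ofReal_add (sub_nonneg.2 h1) h0, sub_add_cancel, ENNReal.ofReal_one]
  calc _ = (ENNReal.ofReal (1 - c) + ENNReal.ofReal c) * energy F (symbolA a - h) +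
        (ENNReal.ofReal (1 - c) * energy G h + ENNReal.ofReal c * energy G' h) := by
          rw [e, one_mul]
    _ = _ := by ring

/-- `L₂ˢ(W)` is contained in `L₂ˢ(V)` if `V` is dominated by `W`. -/
lemma MemL2s.of_le {C : ℝ≥0∞} (hC : C ≠ ∞)
    (hVW : ∀ f : ℝ → Vec T, AEStronglyMeasurable f period → energy V f ≤ C * energy W f)
    {h : ℝ → Vec T} (hh : MemL2s S W h) : MemL2s S V h := by
  refine ⟨⟨hh.1.1, (hVW h hh.1.1).trans_lt (ENNReal.mul_lt_top hC.lt_top hh.1.2)⟩,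
    fun ε hε => ?_⟩
  obtain ⟨p, hp, hlt⟩ := hh.2 (ε / (C + 1)) (ENNReal.div_pos hε.ne' (by simpa using hC))
  refine ⟨p, hp, ?_⟩
  have h1 := hVW (h - trigPoly p) (hh.1.1.sub (continuous_trigPoly p).aestronglyMeasurable)
  refine h1.trans_lt ?_
  have h2 : C * energy W (h - trigPoly p) ≤ (C + 1) * energy W (h - trigPoly p) := by
    gcongr
    exact le_self_add
  refine h2.trans_lt ?_
  rw [ENNReal.lt_div_iff_mul_lt (Or.inl (by simp)) (Or.inl (by simpa using hC))] at hlt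
  rwa [mul_comm]

lemma MemL2s.congr {h k : ℝ → Vec T} (hh : MemL2s S W h) (hhk : h =ᵐ[period] k) :
    MemL2s S W k := by
  refine ⟨hh.1.congr hhk, fun ε hε => ?_⟩
  obtain ⟨p, hp, hlt⟩ := hh.2 ε hε
  refine ⟨p, hp, ?_⟩
  rwa [← energy_congr W (hhk.sub (ae_eq_refl (trigPoly p)))]

lemma energy_le_mix_left (hV : IsSpectralDensity V) (hW : IsSpectralDensity W) (h0 : 0 ≤ c)
    (h1 : c < 1) {h : ℝ → Vec T} (hh : AEStronglyMeasurable h period) :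
    energy V h ≤ (ENNReal.ofReal (1 - c))⁻¹ * energy (mix c V W) h := by
  rw [energy_mix hV hW h0 h1.le hh, mul_add, ← mul_assoc,
    ENNReal.inv_mul_cancel (by simpa using h1) ENNReal.ofReal_ne_top, one_mul]
  exact le_self_add

lemma energy_le_mix_right (hV : IsSpectralDensity V) (hW : IsSpectralDensity W) (h0 : 0 < c)
    (h1 : c ≤ 1) {h : ℝ → Vec T} (hh : AEStronglyMeasurable h period) :
    energy W h ≤ (ENNReal.ofReal c)⁻¹ * energy (mix c V W) h := by
  rw [energy_mix hV hW h0.le h1 hh, mul_add, ← mul_assoc _ (ENNReal.ofReal c),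
    ENNReal.inv_mul_cancel (by simpa using h0) ENNReal.ofReal_ne_top, one_mul]
  exact le_add_self

end Mix

/-! ### The saddle point -/

section Saddle

variable {F G₀ : Dens T} {S : Set ℤ} {a : ℤ → Vec T} {DG : Set (Dens T)}

lemma IsExtremal.mem (hext : IsExtremal S a ({F} ×ˢ DG) F G₀) : G₀ ∈ DG := hext.2.1.2

lemma IsExtremal.isMinimal (hext : IsExtremal S a ({F} ×ˢ DG) F G₀) : IsMinimal (F + G₀) :=
  hext.2.2

lemma IsExtremal.objective_le (hext : IsExtremal S a ({F} ×ˢ DG) F G₀) {G : Dens T}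
    (hG : G ∈ DG) (hm : IsMinimal (F + G)) : objective S a F G ≤ objective S a F G₀ := by
  have hmem : (F, G) ∈ {p : Dens T × Dens T |
      p ∈ ({F} : Set (Dens T)) ×ˢ DG ∧ IsMinimal (p.1 + p.2)} := by
    rw [Set.mem_ofPred_eq]
    exact ⟨Set.mk_mem_prod (Set.mem_singleton F) hG, hm⟩
  have h := isMaxOn_iff.1 hext.1 (F, G) hmem
  simp only at h
  exact h

lemma IsExtremal.meanSquareError_le (hext : IsExtremal S a ({F} ×ˢ DG) F G₀)
    (hF : IsSpectralDensity F) (hDG : ∀ G ∈ DG, IsSpectralDensity G)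
    (ha : Summable fun j => ∑ k, ‖a j k‖) {G : Dens T} (hG : G ∈ DG) (hm : IsMinimal (F + G)) :
    meanSquareError a (characteristic S a F G) F G ≤
      meanSquareError a (characteristic S a F G₀) F G₀ := by
  rw [meanSquareError_characteristic hF (hDG G hG) hm ha,
    meanSquareError_characteristic hF (hDG G₀ hext.mem) hext.isMinimal ha]
  exact ENNReal.ofReal_le_ofReal (hext.objective_le hG hm)

lemma tendsto_one_div_add_two : Tendsto (fun n : ℕ => 1 / ((n : ℝ) + 2)) atTop (𝓝 0) := by
  have h := (tendsto_add_atTop_iff_nat 1).2 (tendsto_one_div_add_atTop_nhds_zero_nat (𝕜 := ℝ))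
  refine h.congr fun n => ?_
  push_cast
  ring_nf

lemma one_div_add_two_pos (n : ℕ) : 0 < 1 / ((n : ℝ) + 2) := by positivity

lemma one_div_add_two_le (n : ℕ) : 1 / ((n : ℝ) + 2) ≤ 1 / 2 := by
  gcongr
  simp

/-- A competitor G need not give a minimal sum, so it is approached by (1 - c) G + c G₀ with c → 0.
This mixture is minimal thanks to G₀, and its optimal error is at least 1 - c times that of G. -/
theorem IsExtremal.isLeastFavorable (hext : IsExtremal S a ({F} ×ˢ DG) F G₀) (hS : S.Finite)
    (hF : IsSpectralDensity F) (hDG : ∀ G ∈ DG, IsSpectralDensity G)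
    (hconv : ∀ G ∈ DG, ∀ G' ∈ DG, ∀ c : ℝ, 0 ≤ c → c ≤ 1 → mix c G G' ∈ DG)
    (ha : Summable fun j => ∑ k, ‖a j k‖) : IsLeastFavorable S a ({F} ×ˢ DG) F G₀ := by
  refine ⟨hext.2.1, ?_⟩
  rintro ⟨F', G⟩ ⟨hF', hG⟩
  obtain rfl : F = F' := (Set.mem_singleton_iff.1 hF').symm
  have hG₀ := hext.mem
  have hm₀ := hext.isMinimal
  simp only at hG ⊢
  rw [optimalError_eq hF (hDG _ hG₀) hm₀ ha hS]
  have key : ∀ n : ℕ, ENNReal.ofReal (1 - 1 / ((n : ℝ) + 2)) * optimalError S a F G ≤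
      meanSquareError a (characteristic S a F G₀) F G₀ := fun n => by
    set c : ℝ := 1 / ((n : ℝ) + 2)
    have hc0 : 0 < c := one_div_add_two_pos n
    have hc1 : c < 1 := (one_div_add_two_le n).trans_lt (by norm_num)
    have hmem := hconv _ hG _ hG₀ c hc0.le hc1.le
    have hm : IsMinimal (F + mix c G G₀) := by
      rw [add_mix, ← mix_one_sub]
      exact hm₀.mix_left (hF.add (hDG _ hG₀)) (hF.add (hDG _ hG)) (by linarith)
        (by linarith)
    have hx := memL2s_characteristic hF (hDG _ hmem) hm ha hS
    refine le_trans ?_ (hext.meanSquareError_le hF hDG ha hmem hm)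
    rw [meanSquareError_mix (hDG _ hG) (hDG _ hG₀) hc0.le hc1.le hx.1.1]
    -- The nonnegative contribution of G₀ is dropped, and the estimate that is optimal for the
    -- mixture is also admissible for G.
    refine le_add_right ?_
    gcongr
    refine iInf₂_le _ (hx.of_le (C := (ENNReal.ofReal (1 - c))⁻¹) (by simpa using hc1) ?_)
    intro f hf
    rw [add_mix]
    exact energy_le_mix_left (hF.add (hDG _ hG)) (hF.add (hDG _ hG₀)) hc0.le hc1 hf
  have h1 : Tendsto (fun n : ℕ => ENNReal.ofReal (1 - 1 / ((n : ℝ) + 2)) *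
      optimalError S a F G) atTop (𝓝 (1 * optimalError S a F G)) := by
    refine ENNReal.Tendsto.mul_const ?_ (Or.inl one_ne_zero)
    simpa using ENNReal.tendsto_ofReal (tendsto_one_div_add_two.const_sub 1)
  rw [one_mul] at h1
  exact le_of_tendsto' h1 key

/-- Here p, q are the errors at G₀ and at G of the estimate optimal for weight c, p', q' those for
weight c', and d, e the squared distances of the two estimates. The hypotheses are the two excess
formulas. Eliminating p - p' leaves q - q', and weights of at most 1/2 make the coefficients of d
and e large enough. -/
lemma add_le_of_saddle {c c' p p' q q' d e : ℝ} (hc : 0 < c) (hcc' : c < c') (hc' : c' ≤ 1 / 2)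
    (hd : 0 ≤ d) (he : 0 ≤ e)
    (h1 : (1 - c) * p' + c * q' = (1 - c) * p + c * q + ((1 - c) * d + c * e))
    (h2 : (1 - c') * p + c' * q = (1 - c') * p' + c' * q' + ((1 - c') * d + c' * e)) :
    d + e ≤ q - q' := by
  have h3 : (c' - c) * (q - q') =
      2 * (1 - c) * (1 - c') * d + (c * (1 - c') + c' * (1 - c)) * e := by
    linear_combination (1 - c') * h1 + (1 - c) * h2
  have h4 : (c' - c) * (d + e) ≤ (c' - c) * (q - q') := by
    have h5 : 0 ≤ (2 * (1 - c) * (1 - c') - (c' - c)) * d := by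
      refine mul_nonneg ?_ hd
      nlinarith
    have h6 : 0 ≤ (c * (1 - c') + c' * (1 - c) - (c' - c)) * e := by
      refine mul_nonneg ?_ he
      nlinarith
    nlinarith
  exact le_of_mul_le_mul_left h4 (sub_pos.2 hcc')

lemma energy_sub_comm (W : Dens T) (f g : ℝ → Vec T) : energy W (f - g) = energy W (g - f) := by
  rw [← neg_sub, energy_neg]

/-- A priori h(F, G₀) belongs only to L₂ˢ(F + G₀), while G may be arbitrarily large compared with F
+ G₀. It is recovered as the limit, in a norm that controls G as well, of estimates optimal for
mixtures tending to G₀. -/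
theorem IsExtremal.characteristic_mem (hext : IsExtremal S a ({F} ×ˢ DG) F G₀) (hS : S.Finite)
    (hF : IsSpectralDensity F) (hDG : ∀ G ∈ DG, IsSpectralDensity G)
    (hconv : ∀ G ∈ DG, ∀ G' ∈ DG, ∀ c : ℝ, 0 ≤ c → c ≤ 1 → mix c G G' ∈ DG)
    (ha : Summable fun j => ∑ k, ‖a j k‖) {G : Dens T} (hG : G ∈ DG) :
    MemL2s S (F + G) (characteristic S a F G₀) ∧
      meanSquareError a (characteristic S a F G₀) F G ≤
        meanSquareError a (characteristic S a F G₀) F G₀ := by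
  have hG₀ := hext.mem
  have hm₀ := hext.isMinimal
  have hsG := hDG _ hG
  have hsG₀ := hDG _ hG₀
  have hV := hF.add hsG
  have hV₀ := hF.add hsG₀
  set M := meanSquareError a (characteristic S a F G₀) F G₀ with hM
  have hMtop : M ≠ ∞ := by
    rw [hM, meanSquareError_characteristic hF hsG₀ hm₀ ha]
    exact ENNReal.ofReal_ne_top
  set c : ℕ → ℝ := fun n => 1 / ((n : ℝ) + 2) with hcdef
  have hc0 : ∀ n, 0 < c n := one_div_add_two_pos
  have hc2 : ∀ n, c n ≤ 1 / 2 := one_div_add_two_le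
  have hc1 : ∀ n, c n < 1 := fun n => (hc2 n).trans_lt (by norm_num)
  have hclim : Tendsto c atTop (𝓝 0) := tendsto_one_div_add_two
  have hcanti : ∀ {m n}, m < n → c n < c m := fun {m n} hmn => by
    simp only [hcdef]
    gcongr
  have hmem : ∀ n, mix (c n) G₀ G ∈ DG := fun n =>
    hconv _ hG₀ _ hG _ (hc0 n).le (hc1 n).le
  have hmin : ∀ n, IsMinimal (F + mix (c n) G₀ G) := fun n => by
    rw [add_mix]
    exact hm₀.mix_left hV₀ hV (hc0 n).le (hc1 n)
  set x : ℕ → ℝ → Vec T := fun n => characteristic S a F (mix (c n) G₀ G) with hx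
  -- This density dominates all that occur. Conversely it is dominated by each mixture, since both
  -- weights are positive, so every x n lies in L₂ˢ(W).
  set W : Dens T := (F + G₀) + (F + G) with hWdef
  have hW : IsSpectralDensity W := hV₀.add hV
  have hmW : IsMinimal W := hm₀.add_right hV₀ hV
  have hle₀ : ∀ f : ℝ → Vec T, AEStronglyMeasurable f period →
      energy (F + G₀) f ≤ 1 * energy W f := fun f hf => by
    rw [one_mul, energy_add_density hV₀ hV hf]; exact le_self_add
  have hle : ∀ f : ℝ → Vec T, AEStronglyMeasurable f period →
      energy (F + G) f ≤ 1 * energy W f := fun f hf => by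
    rw [one_mul, energy_add_density hV₀ hV hf]; exact le_add_self
  have hlec : ∀ n, ∀ f : ℝ → Vec T, AEStronglyMeasurable f period →
      energy (F + mix (c n) G₀ G) f ≤ 1 * energy W f := fun n f hf => by
    rw [one_mul, add_mix, energy_mix hV₀ hV (hc0 n).le (hc1 n).le hf,
      energy_add_density hV₀ hV hf]
    gcongr
    · exact mul_le_of_le_one_left' (by simpa using (hc0 n).le)
    · exact mul_le_of_le_one_left' (by simpa using (hc1 n).le)
  have hxc : ∀ n, MemL2s S (F + mix (c n) G₀ G) (x n) := fun n =>
    memL2s_characteristic hF (hDG _ (hmem n)) (hmin n) ha hS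
  have hxW : ∀ n, MemL2s S W (x n) := fun n => by
    refine (hxc n).of_le
      (C := (ENNReal.ofReal (1 - c n))⁻¹ + (ENNReal.ofReal (c n))⁻¹) ?_ fun f hf => ?_
    · simpa using ⟨hc1 n, hc0 n⟩
    · rw [energy_add_density hV₀ hV hf, add_mul, add_mix]
      exact add_le_add (energy_le_mix_left hV₀ hV (hc0 n).le (hc1 n) hf)
        (energy_le_mix_right hV₀ hV (hc0 n) (hc1 n).le hf)
  have hxm : ∀ n, AEStronglyMeasurable (x n) period := fun n => (hxW n).1.1
  have hx₀ : MemL2s S (F + G₀) (characteristic S a F G₀) :=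
    memL2s_characteristic hF hsG₀ hm₀ ha hS
  -- the errors of the perturbed estimates
  have hEM : ∀ n, ENNReal.ofReal (1 - c n) * meanSquareError a (x n) F G₀ +
      ENNReal.ofReal (c n) * meanSquareError a (x n) F G ≤ M := fun n => by
    rw [← meanSquareError_mix hsG₀ hsG (hc0 n).le (hc1 n).le (hxm n)]
    exact hext.meanSquareError_le hF hDG ha (hmem n) (hmin n)
  have hPtop : ∀ n, meanSquareError a (x n) F G₀ ≠ ∞ := fun n h => by
    refine hMtop (top_le_iff.1 (le_trans ?_ (hEM n)))
    rw [h, ENNReal.mul_top (by simpa using hc1 n), top_add]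
  have hQtop : ∀ n, meanSquareError a (x n) F G ≠ ∞ := fun n h => by
    refine hMtop (top_le_iff.1 (le_trans ?_ (hEM n)))
    rw [h, ENNReal.mul_top (by simpa using hc0 n), add_top]
  have hPeq : ∀ n, meanSquareError a (x n) F G₀ =
      M + energy (F + G₀) (x n - characteristic S a F G₀) := fun n =>
    meanSquareError_eq_add hF hsG₀ hm₀ ha hS ((hxW n).of_le ENNReal.one_ne_top hle₀)
  have hDtop : ∀ n, energy (F + G₀) (x n - characteristic S a F G₀) ≠ ∞ := fun n h => by
    refine hPtop n ?_
    rw [hPeq, h, add_top]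
  set q : ℕ → ℝ := fun n => (meanSquareError a (x n) F G).toReal with hq
  -- The error at G₀ is M plus the excess. Cancelling (1 - c n) M in the extremality bound shows
  -- that q n ≤ M and that the excess is at most 2 c n M, hence tends to zero.
  have hreal : ∀ n, (1 - c n) * (energy (F + G₀) (x n - characteristic S a F G₀)).toReal +
      c n * q n ≤ c n * M.toReal := fun n => by
    have h := ENNReal.toReal_mono hMtop (hEM n)
    rw [ENNReal.toReal_add (ENNReal.mul_ne_top ENNReal.ofReal_ne_top (hPtop n))
      (ENNReal.mul_ne_top ENNReal.ofReal_ne_top (hQtop n)), ENNReal.toReal_mul,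
      ENNReal.toReal_mul, ENNReal.toReal_ofReal (hc0 n).le,
      ENNReal.toReal_ofReal (sub_nonneg.2 (hc1 n).le), hPeq,
      ENNReal.toReal_add hMtop (hDtop n)] at h
    linarith
  have hqM : ∀ n, q n ≤ M.toReal := fun n => by
    have h1 := hreal n
    have h2 : 0 ≤ (1 - c n) * (energy (F + G₀) (x n - characteristic S a F G₀)).toReal :=
      mul_nonneg (sub_nonneg.2 (hc1 n).le) ENNReal.toReal_nonneg
    exact le_of_mul_le_mul_left (by linarith) (hc0 n)
  have hlim₀ : Tendsto (fun n => energy (F + G₀) (x n - characteristic S a F G₀)) atTop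
      (𝓝 0) := by
    have h1 : Tendsto (fun n => ENNReal.ofReal (2 * (c n * M.toReal))) atTop (𝓝 0) := by
      simpa using ENNReal.tendsto_ofReal ((hclim.mul_const M.toReal).const_mul 2)
    refine tendsto_of_tendsto_of_tendsto_of_le_of_le tendsto_const_nhds h1
      (fun _ => zero_le) fun n => ?_
    simp only
    rw [← ENNReal.ofReal_toReal (hDtop n)]
    refine ENNReal.ofReal_le_ofReal ?_
    have h2 := hreal n
    have h3 : 0 ≤ c n * q n := mul_nonneg (hc0 n).le ENNReal.toReal_nonneg
    have h4 := hc2 n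
    have h5 : 0 ≤ (energy (F + G₀) (x n - characteristic S a F G₀)).toReal :=
      ENNReal.toReal_nonneg
    nlinarith
  -- monotonicity of the errors for `G`
  have hsub : ∀ m n, MemL2 W (x m - x n) := fun m n => (hxW m).1.sub hW (hxW n).1
  have hsub₀ : ∀ m n, energy (F + G₀) (x m - x n) ≠ ∞ := fun m n =>
    ((hle₀ _ (hsub m n).1).trans_lt (by simpa using (hsub m n).2)).ne
  have hsub₁ : ∀ m n, energy (F + G) (x m - x n) ≠ ∞ := fun m n =>
    ((hle _ (hsub m n).1).trans_lt (by simpa using (hsub m n).2)).ne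
  -- The excess formula at the mixture of weight c n, applied to the estimate x m and split by
  -- linearity in the density.
  have hbal : ∀ m n, (1 - c n) * (meanSquareError a (x m) F G₀).toReal + c n * q m =
      (1 - c n) * (meanSquareError a (x n) F G₀).toReal + c n * q n +
        ((1 - c n) * (energy (F + G₀) (x m - x n)).toReal +
          c n * (energy (F + G) (x m - x n)).toReal) := fun m n => by
    have h := meanSquareError_eq_add hF (hDG _ (hmem n)) (hmin n) ha hS
      ((hxW m).of_le ENNReal.one_ne_top (hlec n))
    have h' := congrArg ENNReal.toReal h
    change _ = (meanSquareError a (x n) F (mix (c n) G₀ G) +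
      energy (F + mix (c n) G₀ G) (x m - x n)).toReal at h'
    rw [add_mix, energy_mix hV₀ hV (hc0 n).le (hc1 n).le (hsub m n).1,
      meanSquareError_mix hsG₀ hsG (hc0 n).le (hc1 n).le (hxm m),
      meanSquareError_mix hsG₀ hsG (hc0 n).le (hc1 n).le (hxm n)] at h'
    have hmul : ∀ {r : ℝ} {y : ℝ≥0∞}, y ≠ ∞ → ENNReal.ofReal r * y ≠ ∞ := fun hy =>
      ENNReal.mul_ne_top ENNReal.ofReal_ne_top hy
    rw [ENNReal.toReal_add (hmul (hPtop m)) (hmul (hQtop m)),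
      ENNReal.toReal_add (ENNReal.add_ne_top.2 ⟨hmul (hPtop n), hmul (hQtop n)⟩)
        (ENNReal.add_ne_top.2 ⟨hmul (hsub₀ m n), hmul (hsub₁ m n)⟩),
      ENNReal.toReal_add (hmul (hPtop n)) (hmul (hQtop n)),
      ENNReal.toReal_add (hmul (hsub₀ m n)) (hmul (hsub₁ m n))] at h'
    simpa only [ENNReal.toReal_mul, ENNReal.toReal_ofReal (hc0 n).le,
      ENNReal.toReal_ofReal (sub_nonneg.2 (hc1 n).le)] using h'
  -- The key estimate: q is increasing and bounded by M, hence Cauchy, and it controls the distances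
  -- in L₂(W).
  have hdiff : ∀ {m n}, m ≤ n → (energy W (x n - x m)).toReal ≤ q n - q m := fun {m n} hmn => by
    rcases hmn.eq_or_lt with rfl | hlt
    · have : energy W 0 = 0 := by simp [energy]
      simp [this]
    · rw [energy_add_density hV₀ hV (hsub n m).1,
        ENNReal.toReal_add (hsub₀ n m) (hsub₁ n m)]
      refine add_le_of_saddle (hc0 n) (hcanti hlt) (hc2 m) ENNReal.toReal_nonneg
        ENNReal.toReal_nonneg ?_ (hbal n m)
      rw [energy_sub_comm _ (x n), energy_sub_comm _ (x n)]
      exact hbal m n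
  have hqmono : Monotone q := fun m n hmn =>
    sub_nonneg.1 (ENNReal.toReal_nonneg.trans (hdiff hmn))
  have hqcau : CauchySeq q :=
    (tendsto_atTop_ciSup hqmono ⟨M.toReal, by rintro _ ⟨n, rfl⟩; exact hqM n⟩).cauchySeq
  have hpi : (0 : ℝ) < 1 / (2 * Real.pi) := by positivity
  have hcau : CauchySeq fun n => toH W (x n) := by
    refine Metric.cauchySeq_iff'.2 fun ε hε => ?_
    obtain ⟨N, hN⟩ := Metric.cauchySeq_iff'.1 hqcau (1 / (2 * Real.pi) * ε ^ 2) (by positivity)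
    refine ⟨N, fun n hn => ?_⟩
    have h1 := (hdiff hn).trans_lt ((le_abs_self _).trans_lt (hN n hn))
    rw [energy_eq_norm hW (hsub n N), ENNReal.toReal_ofReal (by positivity),
      toH_sub hW (hxW n).1 (hxW N).1] at h1
    rw [dist_eq_norm]
    exact lt_of_pow_lt_pow_left₀ 2 hε.le (lt_of_mul_lt_mul_left h1 hpi.le)
  obtain ⟨z, hz⟩ := cauchySeq_tendsto_of_complete hcau
  have hy := memL2_fromH hW hmW z
  set y := fromH W z with hydef
  have hyS : MemL2s S W y := by
    rw [memL2s_iff hW]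
    refine ⟨hy, ?_⟩
    rw [toH_fromH hW hmW]
    exact (Submodule.isClosed_topologicalClosure _).mem_of_tendsto hz
      (Eventually.of_forall fun n => ((memL2s_iff hW).1 (hxW n)).2)
  have hylim : Tendsto (fun n => energy W (y - x n)) atTop (𝓝 0) := by
    have h1 : Tendsto (fun n => 1 / (2 * Real.pi) * ‖z - toH W (x n)‖ ^ 2) atTop (𝓝 0) := by
      simpa using (((tendsto_const_nhds (x := z)).sub hz).norm.pow 2).const_mul
        (1 / (2 * Real.pi))
    have h2 := ENNReal.tendsto_ofReal h1
    rw [ENNReal.ofReal_zero] at h2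
    refine h2.congr fun n => ?_
    rw [energy_eq_norm hW (hy.sub hW (hxW n).1), toH_sub hW hy (hxW n).1, toH_fromH hW hmW]
  have hdom : ∀ {V : Dens T}, (∀ f : ℝ → Vec T, AEStronglyMeasurable f period →
      energy V f ≤ 1 * energy W f) → Tendsto (fun n => energy V (y - x n)) atTop (𝓝 0) :=
    fun {V} h => tendsto_of_tendsto_of_tendsto_of_le_of_le tendsto_const_nhds hylim
      (fun _ => zero_le) fun n => (h _ (hy.1.sub (hxm n))).trans_eq (one_mul _)
  -- the limit is the optimal characteristic
  have hy₀ : MemL2s S (F + G₀) y := hyS.of_le ENNReal.one_ne_top hle₀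
  have heq : y =ᵐ[period] characteristic S a F G₀ := by
    refine ae_eq_of_toH_eq hV₀ hm₀ hy₀.1 hx₀.1 ?_
    have h0 : energy (F + G₀) (y - characteristic S a F G₀) = 0 := by
      have h1 : Tendsto (fun n => 2 * (energy (F + G₀) (y - x n) +
          energy (F + G₀) (x n - characteristic S a F G₀))) atTop (𝓝 0) := by
        simpa using ENNReal.Tendsto.const_mul (a := 2) ((hdom hle₀).add hlim₀)
          (Or.inr ENNReal.ofNat_ne_top)
      refine le_antisymm (ge_of_tendsto' h1 fun n => ?_) zero_le
      have h2 := energy_add_le hV₀ (hy.1.sub (hxm n)) ((hxm n).sub hx₀.1.1)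
      rwa [sub_add_sub_cancel] at h2
    rw [energy_eq_norm hV₀ (hy₀.1.sub hV₀ hx₀.1), ENNReal.ofReal_eq_zero,
      toH_sub hV₀ hy₀.1 hx₀.1] at h0
    have h3 : ‖toH (F + G₀) y - toH (F + G₀) (characteristic S a F G₀)‖ ^ 2 ≤ 0 := by
      by_contra hcon
      exact absurd h0 (not_le.2 (mul_pos hpi (not_le.1 hcon)))
    have h4 := pow_eq_zero_iff two_ne_zero |>.1 (le_antisymm h3 (sq_nonneg _))
    exact sub_eq_zero.1 (norm_eq_zero.1 h4)
  have hyG : MemL2s S (F + G) y := hyS.of_le ENNReal.one_ne_top hle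
  refine ⟨hyG.congr heq, ?_⟩
  have hmse : meanSquareError a (characteristic S a F G₀) F G = meanSquareError a y F G := by
    unfold meanSquareError
    rw [energy_congr F ((ae_eq_refl (symbolA a)).sub heq), energy_congr G heq]
  rw [hmse]
  have hAm := aestronglyMeasurable_symbolA (T := T) ha
  have hleF : ∀ f : ℝ → Vec T, AEStronglyMeasurable f period →
      energy F f ≤ 1 * energy W f := fun f hf => by
    refine le_trans ?_ (hle f hf)
    rw [energy_add_density hF hsG hf]; exact le_self_add
  have hleG : ∀ f : ℝ → Vec T, AEStronglyMeasurable f period →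
      energy G f ≤ 1 * energy W f := fun f hf => by
    refine le_trans ?_ (hle f hf)
    rw [energy_add_density hF hsG hf]; exact le_add_self
  have hlimG := tendsto_energy_of_sub hsG hxm hy.1 (hdom hleG)
  have hlimF : Tendsto (fun n => energy F (symbolA a - x n)) atTop
      (𝓝 (energy F (symbolA a - y))) := by
    refine tendsto_energy_of_sub hF (fun n => hAm.sub (hxm n)) (hAm.sub hy.1) ?_
    refine (hdom hleF).congr fun n => ?_
    rw [sub_sub_sub_cancel_left, energy_sub_comm]
  -- Each x n has error at most M for G, and convergence in L₂(W) carries this to the limit.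
  refine le_of_tendsto' (hlimF.add hlimG) fun n => ?_
  change meanSquareError a (x n) F G ≤ M
  exact (ENNReal.toReal_le_toReal (hQtop n) hMtop).1 (hqM n)

/-- The saddle point theorem for a known signal density and a convex class of noise densities. -/
theorem IsExtremal.isRobustSolution (hext : IsExtremal S a ({F} ×ˢ DG) F G₀) (hS : S.Finite)
    (hF : IsSpectralDensity F) (hDG : ∀ G ∈ DG, IsSpectralDensity G)
    (hconv : ∀ G ∈ DG, ∀ G' ∈ DG, ∀ c : ℝ, 0 ≤ c → c ≤ 1 → mix c G G' ∈ DG)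
    (ha : Summable fun j => ∑ k, ‖a j k‖) : IsRobustSolution S a F DG G₀ := by
  have hopt := isOptimal_characteristic hF (hDG _ hext.mem) hext.isMinimal ha hS
  have hchar := fun G (hG : G ∈ DG) =>
    hext.characteristic_mem hS hF hDG hconv ha hG
  refine ⟨hext.isLeastFavorable hS hF hDG hconv ha, hopt, ?_, ⟨(F, G₀), hext.2.1, ?_⟩, ?_⟩
  · rintro ⟨F', G⟩ ⟨hF', hG⟩
    obtain rfl : F = F' := (Set.mem_singleton_iff.1 hF').symm
    exact (hchar G hG).1
  · rintro ⟨F', G⟩ ⟨hF', hG⟩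
    obtain rfl : F = F' := (Set.mem_singleton_iff.1 hF').symm
    exact (hchar G hG).2
  · intro h hh
    rw [admissible, Set.mem_ofPred_eq] at hh
    have hadm := hh (F, G₀) hext.2.1
    simp only at hadm
    -- The saddle point: the worst error of h is at least its error at G₀, which is at least the
    -- optimal one, and that one is the worst error of h(F, G₀).
    have h1 : meanSquareError a (characteristic S a F G₀) F G₀ ≤
        ⨆ p ∈ ({F} : Set (Dens T)) ×ˢ DG, meanSquareError a h p.1 p.2 :=
      (hopt.2 h hadm).trans
        (le_iSup₂ (f := fun (p : Dens T × Dens T) (_ : p ∈ ({F} : Set (Dens T)) ×ˢ DG) =>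
          meanSquareError a h p.1 p.2) (F, G₀) hext.2.1)
    refine iSup₂_le ?_
    rintro ⟨F', G⟩ ⟨hF', hG⟩
    obtain rfl : F = F' := (Set.mem_singleton_iff.1 hF').symm
    exact (hchar G hG).2.trans h1

end Saddle

/-! ### Convexity of the classes of densities -/

lemma finite_missing {s : ℕ} (M N : Fin s → ℕ) : (missing M N).Finite := by
  refine (Set.finite_iUnion fun l => Set.finite_Icc (-((M l : ℤ) + N l)) (-(M l : ℤ))).subset ?_
  intro n hn
  rw [missing, Set.mem_ofPred_eq] at hn
  obtain ⟨l, h⟩ := hn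
  exact Set.mem_iUnion.2 ⟨l, h⟩

/-- Convexity of the squared modulus; after the triangle inequality the gap is c (1 - c) (|z| -
|w|)². -/
lemma enorm_sq_mix_le {c : ℝ} (h0 : 0 ≤ c) (h1 : c ≤ 1) (z w : ℂ) :
    ‖((1 - c : ℝ) : ℂ) * z + (c : ℂ) * w‖ₑ ^ 2 ≤
      ENNReal.ofReal (1 - c) * ‖z‖ₑ ^ 2 + ENNReal.ofReal c * ‖w‖ₑ ^ 2 := by
  have e : ∀ z : ℂ, ‖z‖ₑ ^ 2 = ENNReal.ofReal (‖z‖ ^ 2) := fun z => by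
    rw [ENNReal.ofReal_pow (norm_nonneg _), ofReal_norm]
  have h1' : 0 ≤ 1 - c := sub_nonneg.2 h1
  rw [e, e, e, ← ENNReal.ofReal_mul h1', ← ENNReal.ofReal_mul h0,
    ← ENNReal.ofReal_add (by positivity) (by positivity)]
  refine ENNReal.ofReal_le_ofReal ?_
  have h2 : ‖((1 - c : ℝ) : ℂ) * z + (c : ℂ) * w‖ ≤ (1 - c) * ‖z‖ + c * ‖w‖ := by
    refine (norm_add_le _ _).trans_eq ?_
    rw [norm_mul, norm_mul, Complex.norm_real, Complex.norm_real, Real.norm_of_nonneg h1',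
      Real.norm_of_nonneg h0]
  refine (pow_le_pow_left₀ (norm_nonneg _) h2 2).trans ?_
  nlinarith [mul_nonneg (mul_nonneg h0 h1') (sq_nonneg (‖z‖ - ‖w‖))]

lemma meanSq_mix_le {c : ℝ} (h0 : 0 ≤ c) (h1 : c ≤ 1) {f g : ℝ → ℂ}
    (hf : AEStronglyMeasurable f period) {δ : ℝ≥0∞} (hfδ : meanSq f ≤ δ) (hgδ : meanSq g ≤ δ) :
    meanSq (fun t => ((1 - c : ℝ) : ℂ) * f t + (c : ℂ) * g t) ≤ δ := by
  have e : ENNReal.ofReal (1 - c) + ENNReal.ofReal c = 1 := by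
    rw [← ENNReal.ofReal_add (sub_nonneg.2 h1) h0, sub_add_cancel, ENNReal.ofReal_one]
  calc meanSq (fun t => ((1 - c : ℝ) : ℂ) * f t + (c : ℂ) * g t)
      ≤ ENNReal.ofReal (1 / (2 * Real.pi)) * ∫⁻ t, (ENNReal.ofReal (1 - c) * ‖f t‖ₑ ^ 2 +
          ENNReal.ofReal c * ‖g t‖ₑ ^ 2) ∂period := by
        unfold meanSq
        gcongr
        exact enorm_sq_mix_le h0 h1 _ _
    _ = ENNReal.ofReal (1 - c) * meanSq f + ENNReal.ofReal c * meanSq g := by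
        rw [lintegral_add_left' ((hf.enorm.pow_const 2).const_mul _),
          lintegral_const_mul' _ _ ENNReal.ofReal_ne_top,
          lintegral_const_mul' _ _ ENNReal.ofReal_ne_top]
        unfold meanSq
        ring
    _ ≤ ENNReal.ofReal (1 - c) * δ + ENNReal.ofReal c * δ := by gcongr
    _ = δ := by rw [← add_mul, e, one_mul]

/-- A mean square constraint on a real linear functional of `G - G₁` is convex. -/
lemma meanSq_functional_mix_le {G G' G₁ : Dens T} (φ : Matrix (Fin T) (Fin T) ℂ →ₗ[ℝ] ℂ)
    (hφ : AEStronglyMeasurable (fun t => φ (G t - G₁ t)) period) {c : ℝ} (h0 : 0 ≤ c)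
    (h1 : c ≤ 1) {δ : ℝ≥0∞} (hG : meanSq (fun t => φ (G t - G₁ t)) ≤ δ)
    (hG' : meanSq (fun t => φ (G' t - G₁ t)) ≤ δ) :
    meanSq (fun t => φ (mix c G G' t - G₁ t)) ≤ δ := by
  refine le_of_eq_of_le ?_ (meanSq_mix_le h0 h1 hφ hG hG')
  congr 1
  funext t
  have e : mix c G G' t - G₁ t = (1 - c) • (G t - G₁ t) + c • (G' t - G₁ t) := by
    ext i j
    simp [mix]
    ring
  rw [e, map_add, map_smul, map_smul, Complex.real_smul, Complex.real_smul]

/-! ### Convexity of each of the four classes -/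

section Classes

variable {G G' G₁ : Dens T} {c : ℝ}

/-- The trace as a real linear functional. -/
def traceFunctional (T : ℕ) : Matrix (Fin T) (Fin T) ℂ →ₗ[ℝ] ℂ := Matrix.traceLinearMap (Fin T) ℝ ℂ

/-- An entry as a real linear functional. -/
def entryFunctional (i j : Fin T) : Matrix (Fin T) (Fin T) ℂ →ₗ[ℝ] ℂ :=
  Matrix.entryLinearMap ℝ ℂ i j

/-- `X ↦ ⟨B, X⟩` as a real linear functional. -/
def innerFunctional (B : Matrix (Fin T) (Fin T) ℂ) : Matrix (Fin T) (Fin T) ℂ →ₗ[ℝ] ℂ where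
  toFun X := matInner B X
  map_add' X Y := by simp [matInner, Matrix.mul_add]
  map_smul' c X := by simp [matInner, Matrix.conjTranspose_smul]

lemma aestronglyMeasurable_sub_apply (hG : IsSpectralDensity G) (hG₁ : IsSpectralDensity G₁)
    (i j : Fin T) : AEStronglyMeasurable (fun t => G t i j - G₁ t i j) period :=
  (hG.2 i j).1.sub (hG₁.2 i j).1

lemma mix_mem_class1 (hG₁ : IsSpectralDensity G₁) {δ : ℝ≥0} (hG : G ∈ class1 G₁ δ)
    (hG' : G' ∈ class1 G₁ δ) (h0 : 0 ≤ c) (h1 : c ≤ 1) : mix c G G' ∈ class1 G₁ δ := by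
  rw [class1, Set.mem_ofPred_eq] at *
  refine ⟨hG.1.mix hG'.1 h0 h1, meanSq_functional_mix_le (traceFunctional T) ?_ h0 h1 hG.2 hG'.2⟩
  have e : (fun t => traceFunctional T (G t - G₁ t)) = fun t => ∑ i, (G t i i - G₁ t i i) := by
    funext t
    simp [traceFunctional, Matrix.trace]
  rw [e]
  exact Finset.aestronglyMeasurable_fun_sum _ fun i _ =>
    aestronglyMeasurable_sub_apply hG.1 hG₁ i i

lemma mix_mem_class2 (hG₁ : IsSpectralDensity G₁) {δ : Fin T → ℝ≥0} (hG : G ∈ class2 G₁ δ)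
    (hG' : G' ∈ class2 G₁ δ) (h0 : 0 ≤ c) (h1 : c ≤ 1) : mix c G G' ∈ class2 G₁ δ := by
  rw [class2, Set.mem_ofPred_eq] at *
  exact ⟨hG.1.mix hG'.1 h0 h1, fun k => meanSq_functional_mix_le (entryFunctional k k)
    (aestronglyMeasurable_sub_apply hG.1 hG₁ k k) h0 h1 (hG.2 k) (hG'.2 k)⟩

lemma mix_mem_class3 (hG₁ : IsSpectralDensity G₁) {B : Matrix (Fin T) (Fin T) ℂ} {δ : ℝ≥0}
    (hG : G ∈ class3 G₁ B δ) (hG' : G' ∈ class3 G₁ B δ) (h0 : 0 ≤ c) (h1 : c ≤ 1) :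
    mix c G G' ∈ class3 G₁ B δ := by
  rw [class3, Set.mem_ofPred_eq] at *
  refine ⟨hG.1.mix hG'.1 h0 h1, meanSq_functional_mix_le (innerFunctional B) ?_ h0 h1 hG.2 hG'.2⟩
  have e : (fun t => innerFunctional B (G t - G₁ t)) =
      fun t => ∑ i, ∑ j, B i j * star (G t i j - G₁ t i j) := by
    funext t
    simp [innerFunctional, matInner, Matrix.trace, Matrix.mul_apply]
  rw [e]
  exact Finset.aestronglyMeasurable_fun_sum _ fun i _ =>
    Finset.aestronglyMeasurable_fun_sum _ fun j _ =>
      (continuous_star.comp_aestronglyMeasurable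
        (aestronglyMeasurable_sub_apply hG.1 hG₁ i j)).const_mul _

lemma mix_mem_class4 (hG₁ : IsSpectralDensity G₁) {δ : Fin T → Fin T → ℝ≥0}
    (hG : G ∈ class4 G₁ δ) (hG' : G' ∈ class4 G₁ δ) (h0 : 0 ≤ c) (h1 : c ≤ 1) :
    mix c G G' ∈ class4 G₁ δ := by
  rw [class4, Set.mem_ofPred_eq] at *
  exact ⟨hG.1.mix hG'.1 h0 h1, fun i j => meanSq_functional_mix_le (entryFunctional i j)
    (aestronglyMeasurable_sub_apply hG.1 hG₁ i j) h0 h1 (hG.2 i j) (hG'.2 i j)⟩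

end Classes

end MinimaxFilter

end

/-- Each class is a convex set of spectral densities, being cut out by mean square bounds on real
linear functionals of G - G₁, so the saddle point theorem applies to all four. -/
theorem corollary5 {T s : ℕ} (M N : Fin s → ℕ) (hM : ∀ l, 1 ≤ M l)
    (S : Set ℤ) (hS : S = MinimaxFilter.missing M N)
    (a : ℤ → Fin T → ℂ) (ha_zero : ∀ j, j ∉ MinimaxFilter.functionalIndex S → a j = 0)
    (ha_sum : Summable fun j => ∑ k, ‖a j k‖)
    (F G₁ G₀ : ℝ → Matrix (Fin T) (Fin T) ℂ)
    (hF : MinimaxFilter.IsSpectralDensity F) (hG₁ : MinimaxFilter.IsSpectralDensity G₁)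
    (hG₀ : MinimaxFilter.IsSpectralDensity G₀) (hmin : MinimaxFilter.IsMinimal (F + G₀))
    (r : ℝ → Fin T → ℂ)
    (hr : r = MinimaxFilter.rF S a F G₀ ∨ r = MinimaxFilter.numeratorF S a F G₀) :
    (∀ G, MinimaxFilter.IsSpectralDensity G → MinimaxFilter.ErrorFormula.{u} S a F G) ∧
    (∀ G, MinimaxFilter.IsSpectralDensity G → MinimaxFilter.IsMinimal (F + G) →
      MinimaxFilter.IsWellDefined S a F G) ∧
    (∀ δ : ℝ≥0, MinimaxFilter.Relations1 F G₁ G₀ δ r →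
      MinimaxFilter.IsExtremal S a ({F} ×ˢ MinimaxFilter.class1 G₁ δ) F G₀ →
      MinimaxFilter.IsRobustSolution S a F (MinimaxFilter.class1 G₁ δ) G₀) ∧
    (∀ δ : Fin T → ℝ≥0, MinimaxFilter.Relations2 F G₁ G₀ δ r →
      MinimaxFilter.IsExtremal S a ({F} ×ˢ MinimaxFilter.class2 G₁ δ) F G₀ →
      MinimaxFilter.IsRobustSolution S a F (MinimaxFilter.class2 G₁ δ) G₀) ∧
    (∀ (B₂ : Matrix (Fin T) (Fin T) ℂ) (δ : ℝ≥0), B₂.PosDef →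
      MinimaxFilter.Relations3 F G₁ G₀ B₂ δ r →
      MinimaxFilter.IsExtremal S a ({F} ×ˢ MinimaxFilter.class3 G₁ B₂ δ) F G₀ →
      MinimaxFilter.IsRobustSolution S a F (MinimaxFilter.class3 G₁ B₂ δ) G₀) ∧
    (∀ δ : Fin T → Fin T → ℝ≥0, MinimaxFilter.Relations4 F G₁ G₀ δ r →
      MinimaxFilter.IsExtremal S a ({F} ×ˢ MinimaxFilter.class4 G₁ δ) F G₀ →
      MinimaxFilter.IsRobustSolution S a F (MinimaxFilter.class4 G₁ δ) G₀) := by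
  have hfin : S.Finite := hS ▸ MinimaxFilter.finite_missing M N
  refine ⟨fun G hG => MinimaxFilter.errorFormula hF hG ha_sum,
    fun G hG hm => MinimaxFilter.isWellDefined hF hG hm ha_sum, ?_, ?_, ?_, ?_⟩
  · intro δ _ hext
    exact hext.isRobustSolution hfin hF (fun G hG => hG.1)
      (fun _ hG _ hG' _ h0 h1 => MinimaxFilter.mix_mem_class1 hG₁ hG hG' h0 h1) ha_sum
  · intro δ _ hext
    exact hext.isRobustSolution hfin hF (fun G hG => hG.1)
      (fun _ hG _ hG' _ h0 h1 => MinimaxFilter.mix_mem_class2 hG₁ hG hG' h0 h1) ha_sum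
  · intro B₂ δ _ _ hext
    exact hext.isRobustSolution hfin hF (fun G hG => hG.1)
      (fun _ hG _ hG' _ h0 h1 => MinimaxFilter.mix_mem_class3 hG₁ hG hG' h0 h1) ha_sum
  · intro δ _ hext
    exact hext.isRobustSolution hfin hF (fun G hG => hG.1)
      (fun _ hG _ hG' _ h0 h1 => MinimaxFilter.mix_mem_class4 hG₁ hG hG' h0 h1) ha_sum
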